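/- **Proposition (regret of LinGreedy, unbounded contexts).** There is an absolute constant $c>0$ such that the following holds. *Setting.* Let $d\ge 1$, $K\ge 2$, $T\ge 2$, $\theta^\star,\theta_0\in\mathbb R^d$ with $\|\theta^\star\|_2\le 1$, $\sigma\ge 0$, $x_{\max}>0$. In round $t=1,\dots,T$ a random context set $\mathcal X(t)=(X_1(t),\dots,X_K(t))$, $X_i(t)\in\mathbb R^d$, is drawn (contexts within a round may be dependent), an arm $a(t)\in[K]$ is pulled, and the reward $Y(t)=X_{a(t)}(t)^\top\theta^\star+\eta_{a(t)}(t)$ is received. Let $\mathcal H_t$ be the $\sigma$-algebra generated by $a(s),X_{a(s)}(s),Y(s)$, $s\le t$. Given $\mathcal H_{t-1}$, $a(t)$ and $X_{a(t)}(t)$, the noise $\eta_{a(t)}(t)$ has conditional mean $0$ and is conditionally $\sigma$-sub-Gaussian, i.e. $\mathbb E[e^{s\eta_{a(t)}(t)}\mid\cdot\,]\le e^{s^2\sigma^2/2}$ for all $s\in\mathbb R$. *Algorithm (LinGreedy).* Put $\Sigma(t)=\sum_{s\le t}X_{a(s)}(s)X_{a(s)}(s)^\top$ and $b(t)=\sum_{s\le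 t}Y(s)X_{a(s)}(s)$. In round $t$ the arm $a(t)$ maximizes $X_i(t)^\top\theta_0$ over $i\in[K]$ if $\Sigma(t-1)$ is singular, and $X_i(t)^\top\hat\theta_{t-1}$ with $\hat\theta_{t-1}=\Sigma(t-1)^{-1}b(t-1)$ otherwise (ties are broken in any measurable way). *Assumptions.* 1. The context sets $\mathcal X(1),\dots,\mathcal X(T)$ are independent, and $\mathcal X(t)$ is independent of $\mathcal H_{t-1}$ for every $t$. 2. $\|X_i(t)\|_{\psi_1}\le x_{\max}$ for all $i,t$, where $\|Z\|_{\psi_1}=\sup_{\|u\|_2=1}\sup_{p\ge1}p^{-1}(\mathbb E|\langle u,Z\rangle|^p)^{1/p}$. 3. (Diversity constant) There is $\lambda_\star>0$ with $\mathbb E[X_{a(t)}(t)X_{a(t)}(t)^\top\mid\mathcal H_{t-1}]\succeq\lambda_\star I_d$ almost surely for all $t\in[T]$. 4. (Margin constant) There is $C_\Delta$ such that, for all $t\in[T]$ and $\varepsilon>0$, $\mathbb P[\Delta(t)\le\varepsilon\mid\mathcal H_{t-1}]\le C_\Delta\,\varepsilon+1/\sqrt T$ almost surely, where $\Delta(t)=X_{a^\star(t)}(t)^\top\theta^\star-\max_{i\ne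 a^\star(t)}X_i(t)^\top\theta^\star$ and $a^\star(t)\in\arg\max_iX_i(t)^\top\theta^\star$. 5. (The horizon is not small compared with the problem parameters) $K\le T$ and $x_{\max}\log K\le\sigma^2C_\Delta\log T$. *Conclusion.* The regret of each round is integrable, and the cumulative expected regret satisfies $$\mathrm{Regret}(T)=\sum_{t=1}^T\mathbb E\big[X_{a^\star(t)}(t)^\top\theta^\star-X_{a(t)}(t)^\top\theta^\star\big]\;\le\;c\,\sigma^2x_{\max}^2\,d\,\frac{C_\Delta}{\lambda_\star}(\log T)^4 .$$ -/

import Mathlib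

open MeasureTheory ProbabilityTheory

namespace LinBandit

noncomputable section

/-- The `ψ₁` norm of a real random variable: `sup_{p ≥ 1} p⁻¹ (E|Z|^p)^{1/p}`, with values in
`[0, ∞]`. -/
def psiOneNorm {Ω : Type*} [MeasurableSpace Ω] (μ : Measure Ω) (Z : Ω → ℝ) : ENNReal :=
  ⨆ (p : ℝ) (_ : 1 ≤ p), eLpNorm Z (ENNReal.ofReal p) μ / ENNReal.ofReal p

/-- The `ψ₁` norm of a random vector: the supremum of the `ψ₁` norms of its projections on unit
vectors. -/
def psiOneNormVec {Ω : Type*} [MeasurableSpace Ω] {d : ℕ} (μ : Measure Ω)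
    (Z : Ω → EuclideanSpace ℝ (Fin d)) : ENNReal :=
  ⨆ (u : EuclideanSpace ℝ (Fin d)) (_ : ‖u‖ = 1), psiOneNorm μ (fun ω => inner ℝ u (Z ω))

/-- An optimal arm `argmax_i ⟨x_i, θ⟩` for the context set `x` and the parameter `θ`. -/
def optArm {d K : ℕ} [NeZero K] (θ : EuclideanSpace ℝ (Fin d))
    (x : Fin K → EuclideanSpace ℝ (Fin d)) : Fin K :=
  Classical.choose (Finite.exists_max (fun i => inner ℝ (x i) θ))

theorem inner_le_inner_optArm {d K : ℕ} [NeZero K] (θ : EuclideanSpace ℝ (Fin d))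
    (x : Fin K → EuclideanSpace ℝ (Fin d)) (i : Fin K) :
    inner ℝ (x i) θ ≤ inner ℝ (x (optArm θ x)) θ :=
  Classical.choose_spec (Finite.exists_max (fun i => inner ℝ (x i) θ)) i

/-- The suboptimality gap: the optimal expected reward minus the largest expected reward among the
other arms (at least two arms are meant). -/
def suboptGap {d K : ℕ} [NeZero K] (θ : EuclideanSpace ℝ (Fin d))
    (x : Fin K → EuclideanSpace ℝ (Fin d)) : ℝ :=
  inner ℝ (x (optArm θ x)) θ - ⨆ i : {i : Fin K // i ≠ optArm θ x}, inner ℝ (x i) θ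

/-! In what follows, `X t ω i` is the context vector of arm `i` in round `t`, `η t ω i` is the noise
of that arm's reward, `θ` is the true parameter and `a t ω` is the arm pulled in round `t`.  Rounds
are numbered from `1`. -/

/-- The context vector of the arm pulled in round `t`. -/
def chosen {Ω : Type*} {d K : ℕ} (X : ℕ → Ω → Fin K → EuclideanSpace ℝ (Fin d))
    (a : ℕ → Ω → Fin K) (t : ℕ) (ω : Ω) : EuclideanSpace ℝ (Fin d) :=
  X t ω (a t ω)

/-- The noise of the reward received in round `t`. -/
def chosenNoise {Ω : Type*} {K : ℕ} (η : ℕ → Ω → Fin K → ℝ) (a : ℕ → Ω → Fin K)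
    (t : ℕ) (ω : Ω) : ℝ :=
  η t ω (a t ω)

/-- The reward received in round `t`. -/
def reward {Ω : Type*} {d K : ℕ} (θ : EuclideanSpace ℝ (Fin d))
    (X : ℕ → Ω → Fin K → EuclideanSpace ℝ (Fin d)) (η : ℕ → Ω → Fin K → ℝ)
    (a : ℕ → Ω → Fin K) (t : ℕ) (ω : Ω) : ℝ :=
  inner ℝ (chosen X a t ω) θ + chosenNoise η a t ω

/-- The history after `t` rounds: the σ-algebra generated by the arms pulled in rounds `1, …, t`,
their context vectors and the rewards received. -/
@[reducible] def history {Ω : Type*} {d K : ℕ} (θ : EuclideanSpace ℝ (Fin d))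
    (X : ℕ → Ω → Fin K → EuclideanSpace ℝ (Fin d)) (η : ℕ → Ω → Fin K → ℝ)
    (a : ℕ → Ω → Fin K) (t : ℕ) : MeasurableSpace Ω :=
  ⨆ s ∈ Finset.Icc 1 t,
    MeasurableSpace.comap (fun ω => (a s ω, chosen X a s ω, reward θ X η a s ω)) inferInstance

/-- What is known just before the reward of round `t` is received: the history after `t - 1`
rounds, the arm pulled in round `t` and its context vector. -/
@[reducible] def preReward {Ω : Type*} {d K : ℕ} (θ : EuclideanSpace ℝ (Fin d))
    (X : ℕ → Ω → Fin K → EuclideanSpace ℝ (Fin d)) (η : ℕ → Ω → Fin K → ℝ)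
    (a : ℕ → Ω → Fin K) (t : ℕ) : MeasurableSpace Ω :=
  history θ X η a (t - 1) ⊔
    MeasurableSpace.comap (fun ω => (a t ω, chosen X a t ω)) inferInstance

/-- The Gram matrix `Σ(t)` of the chosen context vectors of rounds `1, …, t`. -/
def gram {Ω : Type*} {d K : ℕ} (X : ℕ → Ω → Fin K → EuclideanSpace ℝ (Fin d))
    (a : ℕ → Ω → Fin K) (t : ℕ) (ω : Ω) : Matrix (Fin d) (Fin d) ℝ :=
  ∑ s ∈ Finset.Icc 1 t, Matrix.vecMulVec (chosen X a s ω).ofLp (chosen X a s ω).ofLp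

/-- The vector `b(t)`: the sum of reward times chosen context vector over rounds `1, …, t`. -/
def rewardVec {Ω : Type*} {d K : ℕ} (θ : EuclideanSpace ℝ (Fin d))
    (X : ℕ → Ω → Fin K → EuclideanSpace ℝ (Fin d)) (η : ℕ → Ω → Fin K → ℝ)
    (a : ℕ → Ω → Fin K) (t : ℕ) (ω : Ω) : EuclideanSpace ℝ (Fin d) :=
  ∑ s ∈ Finset.Icc 1 t, reward θ X η a s ω • chosen X a s ω

/-- The parameter used by LinGreedy after `t` rounds: the initial parameter `θ₀` as long as the
Gram matrix (which is positive semidefinite) is singular, that is, has minimum eigenvalue `0`, and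
the least squares estimator `Σ(t)⁻¹ b(t)` otherwise. -/
def greedyParam {Ω : Type*} {d K : ℕ} (θ θ₀ : EuclideanSpace ℝ (Fin d))
    (X : ℕ → Ω → Fin K → EuclideanSpace ℝ (Fin d)) (η : ℕ → Ω → Fin K → ℝ)
    (a : ℕ → Ω → Fin K) (t : ℕ) (ω : Ω) : EuclideanSpace ℝ (Fin d) :=
  if (gram X a t ω).det = 0 then θ₀
  else WithLp.toLp 2 ((gram X a t ω)⁻¹.mulVec (rewardVec θ X η a t ω).ofLp)

/-- The arms `a` of rounds `1, …, T` are pulled by LinGreedy: in every round the arm maximizes the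
estimated expected reward (ties may be broken in any measurable way). -/
structure IsLinGreedy {Ω : Type*} [MeasurableSpace Ω] {d K : ℕ} (T : ℕ)
    (θ θ₀ : EuclideanSpace ℝ (Fin d))
    (X : ℕ → Ω → Fin K → EuclideanSpace ℝ (Fin d)) (η : ℕ → Ω → Fin K → ℝ)
    (a : ℕ → Ω → Fin K) : Prop where
  measurable : ∀ t ∈ Finset.Icc 1 T, Measurable (a t)
  greedy : ∀ t ∈ Finset.Icc 1 T, ∀ ω, ∀ i,
    inner ℝ (X t ω i) (greedyParam θ θ₀ X η a (t - 1) ω) ≤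
      inner ℝ (chosen X a t ω) (greedyParam θ θ₀ X η a (t - 1) ω)

/-- `Z` has conditional mean zero and is conditionally `σ`-sub-Gaussian given `m`. -/
structure IsCondSubGaussian {Ω : Type*} [mΩ : MeasurableSpace Ω] (μ : Measure Ω)
    (m : MeasurableSpace Ω) (Z : Ω → ℝ) (σ : ℝ) : Prop where
  integrable : Integrable Z μ
  condMean : μ[Z | m] =ᵐ[μ] 0
  integrable_exp : ∀ s : ℝ, Integrable (fun ω => Real.exp (s * Z ω)) μ
  condMGF : ∀ s : ℝ,
    μ[fun ω => Real.exp (s * Z ω) | m] ≤ᵐ[μ] fun _ => Real.exp (s ^ 2 * σ ^ 2 / 2)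

/-- The conditional second moment matrix `E[Z Zᵀ | m]` of a random vector. -/
def condSecondMoment {Ω : Type*} [mΩ : MeasurableSpace Ω] {d : ℕ} (μ : Measure Ω)
    (m : MeasurableSpace Ω) (Z : Ω → EuclideanSpace ℝ (Fin d)) (ω : Ω) :
    Matrix (Fin d) (Fin d) ℝ :=
  Matrix.of fun i j => (μ[fun ω' => Z ω' i * Z ω' j | m]) ω

/-- The (random) regret of round `t`. -/
def instRegret {Ω : Type*} {d K : ℕ} [NeZero K] (θ : EuclideanSpace ℝ (Fin d))
    (X : ℕ → Ω → Fin K → EuclideanSpace ℝ (Fin d)) (a : ℕ → Ω → Fin K) (t : ℕ) (ω : Ω) : ℝ :=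
  inner ℝ (X t ω (optArm θ (X t ω))) θ - inner ℝ (chosen X a t ω) θ

/-- The cumulative expected regret of rounds `1, …, T`. -/
def cumRegret {Ω : Type*} [MeasurableSpace Ω] {d K : ℕ} [NeZero K] (μ : Measure Ω)
    (θ : EuclideanSpace ℝ (Fin d)) (X : ℕ → Ω → Fin K → EuclideanSpace ℝ (Fin d))
    (a : ℕ → Ω → Fin K) (T : ℕ) : ℝ :=
  ∑ t ∈ Finset.Icc 1 T, ∫ ω, instRegret θ X a t ω ∂μ

end

end LinBandit

/-! Let `v` be the error of the estimate used in a round. The pulled arm is optimal for `θ + v`, so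
its regret is at most `|⟨v, X_opt⟩| + |⟨v, X_a⟩|`. Up to a tail that the `ψ₁` bound makes
polynomially small in `T`, every `|⟨v, X_i⟩|` is at most `r‖v‖`, with `r = hiRadius` of order `xmax
log T`. Outside that tail, a mistake costs at most `2r‖v‖` and requires a gap of at most `2r‖v‖`,
which by the margin condition has probability at most `2r‖v‖CΔ + 1/√T`. The regret is therefore
quadratic in the error, of order `CΔ r²‖v‖² + 1/(CΔ T)` (`lintegral_regretBound_le`). Since `v` is a
function of the past and the new contexts are independent of it, one may average over the contexts
with `v` frozen.

For the error, suppose that after `n` rounds the Gram matrix is at least `λn/64` (this holds on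
`gramGood`). Then `‖v‖² ≤ 128/(λn) · V_n`, where `V_n` is the squared noise sum in the inverse norm
of the Gram matrix regularized by `λ/64`. The mean of `V_n` is bounded directly: by the rank-one
update it grows per round by at most `4σ²` times the mean of `q/(1+q)`, with `q` the leverage, and
these ratios telescope into a log-determinant. Hence `E[‖v‖²; gramGood]` is of order `σ² d log
T/(λn)`. Two logarithms come from `r²`, one from the log-determinant and one from `∑ 1/n`.

The event `gramGood` comes from an exponential lower-tail bound in each direction, a union bound
over an integer grid and a crude trace bound. It fails with probability at most `2/T` once `n ≥
warmUp`, of order `xmax² d log³ T/λ`. In the warm-up and on the bad event the mean regret is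
controlled by an envelope over all arms, of mean at most `44 xmax log K`. The horizon assumption
`xmax log K ≤ σ² CΔ log T` brings this cost to the order of the main term. -/

namespace LinBandit

/-! ### Rank-one updates, self-normalized sums and the elliptical potential. -/

section LinearAlgebra

open Matrix

variable {d : ℕ}

/-- The Gram matrix of `x 1, …, x t`, regularized by `l • 1`. -/
noncomputable def regGram (l : ℝ) (x : ℕ → Fin d → ℝ) (t : ℕ) : Matrix (Fin d) (Fin d) ℝ :=
  l • 1 + ∑ s ∈ Finset.Icc 1 t, vecMulVec (x s) (x s)

/-- The noise-weighted sum of the vectors `x 1, …, x t`. -/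
noncomputable def noiseSum (x : ℕ → Fin d → ℝ) (e : ℕ → ℝ) (t : ℕ) : Fin d → ℝ :=
  ∑ s ∈ Finset.Icc 1 t, e s • x s

/-- The squared length of `x (t + 1)` in the norm of the inverse of `regGram l x t`. -/
noncomputable def leverage (l : ℝ) (x : ℕ → Fin d → ℝ) (t : ℕ) : ℝ :=
  x (t + 1) ⬝ᵥ (regGram l x t)⁻¹ *ᵥ x (t + 1)

/-- The prediction at `x (t + 1)` of the ridge regression on the noise. -/
noncomputable def noisePrediction (l : ℝ) (x : ℕ → Fin d → ℝ) (e : ℕ → ℝ) (t : ℕ) : ℝ :=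
  x (t + 1) ⬝ᵥ (regGram l x t)⁻¹ *ᵥ noiseSum x e t

/-- The squared self-normalized length of `noiseSum x e t`. -/
noncomputable def selfNormalized (l : ℝ) (x : ℕ → Fin d → ℝ) (e : ℕ → ℝ) (t : ℕ) : ℝ :=
  noiseSum x e t ⬝ᵥ (regGram l x t)⁻¹ *ᵥ noiseSum x e t

lemma regGram_succ (l : ℝ) (x : ℕ → Fin d → ℝ) (t : ℕ) :
    regGram l x (t + 1) = regGram l x t + vecMulVec (x (t + 1)) (x (t + 1)) := by
  simp only [regGram]
  rw [Finset.sum_Icc_succ_top (by omega), add_assoc]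

lemma noiseSum_succ (x : ℕ → Fin d → ℝ) (e : ℕ → ℝ) (t : ℕ) :
    noiseSum x e (t + 1) = noiseSum x e t + e (t + 1) • x (t + 1) := by
  simp only [noiseSum]
  rw [Finset.sum_Icc_succ_top (by omega)]

lemma vecMulVec_self_mulVec (v w : Fin d → ℝ) :
    vecMulVec v v *ᵥ w = (v ⬝ᵥ w) • v := by
  rw [vecMulVec_mulVec, op_smul_eq_smul]

lemma dotProduct_sum_vecMulVec_mulVec (x : ℕ → Fin d → ℝ) (I : Finset ℕ) (w : Fin d → ℝ) :
    w ⬝ᵥ (∑ s ∈ I, vecMulVec (x s) (x s)) *ᵥ w = ∑ s ∈ I, (x s ⬝ᵥ w) ^ 2 := by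
  rw [sum_mulVec, dotProduct_sum]
  refine Finset.sum_congr rfl fun s _ => ?_
  rw [vecMulVec_self_mulVec, dotProduct_smul, smul_eq_mul, dotProduct_comm w, sq]

lemma dotProduct_regGram_mulVec (l : ℝ) (x : ℕ → Fin d → ℝ) (t : ℕ) (w : Fin d → ℝ) :
    w ⬝ᵥ regGram l x t *ᵥ w = l * (w ⬝ᵥ w) + ∑ s ∈ Finset.Icc 1 t, (x s ⬝ᵥ w) ^ 2 := by
  rw [regGram, add_mulVec, dotProduct_add, dotProduct_sum_vecMulVec_mulVec, smul_mulVec,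
    one_mulVec, dotProduct_smul, smul_eq_mul]

lemma posSemidef_sum_vecMulVec (x : ℕ → Fin d → ℝ) (I : Finset ℕ) :
    (∑ s ∈ I, vecMulVec (x s) (x s)).PosSemidef := by
  refine posSemidef_sum I fun s _ => ?_
  simpa using posSemidef_vecMulVec_self_star (x s)

lemma posDef_regGram {l : ℝ} (hl : 0 < l) (x : ℕ → Fin d → ℝ) (t : ℕ) :
    (regGram l x t).PosDef :=
  (PosDef.one.smul hl).add_posSemidef (posSemidef_sum_vecMulVec x _)

lemma isUnit_det_regGram {l : ℝ} (hl : 0 < l) (x : ℕ → Fin d → ℝ) (t : ℕ) :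
    IsUnit (regGram l x t).det :=
  (isUnit_iff_isUnit_det _).1 (posDef_regGram hl x t).isUnit

lemma dotProduct_inv_mulVec_comm {l : ℝ} (hl : 0 < l) (x : ℕ → Fin d → ℝ) (t : ℕ)
    (v w : Fin d → ℝ) :
    v ⬝ᵥ (regGram l x t)⁻¹ *ᵥ w = w ⬝ᵥ (regGram l x t)⁻¹ *ᵥ v := by
  have h : ((regGram l x t)⁻¹)ᵀ = (regGram l x t)⁻¹ := by
    simpa using (posDef_regGram hl x t).inv.isHermitian.eq
  rw [dotProduct_mulVec, ← mulVec_transpose, h, dotProduct_comm]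

lemma dotProduct_inv_mulVec_self_nonneg {l : ℝ} (hl : 0 < l) (x : ℕ → Fin d → ℝ) (t : ℕ)
    (v : Fin d → ℝ) : 0 ≤ v ⬝ᵥ (regGram l x t)⁻¹ *ᵥ v := by
  simpa using (posDef_regGram hl x t).inv.posSemidef.dotProduct_mulVec_nonneg v

lemma leverage_nonneg {l : ℝ} (hl : 0 < l) (x : ℕ → Fin d → ℝ) (t : ℕ) : 0 ≤ leverage l x t :=
  dotProduct_inv_mulVec_self_nonneg hl x t _

lemma selfNormalized_nonneg {l : ℝ} (hl : 0 < l) (x : ℕ → Fin d → ℝ) (e : ℕ → ℝ) (t : ℕ) :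
    0 ≤ selfNormalized l x e t :=
  dotProduct_inv_mulVec_self_nonneg hl x t _

lemma regGram_mulVec_inv_mulVec {l : ℝ} (hl : 0 < l) (x : ℕ → Fin d → ℝ) (t : ℕ)
    (v : Fin d → ℝ) : regGram l x t *ᵥ ((regGram l x t)⁻¹ *ᵥ v) = v := by
  rw [mulVec_mulVec, mul_nonsing_inv _ (isUnit_det_regGram hl x t), one_mulVec]

lemma inv_regGram_mulVec_eq {l : ℝ} (hl : 0 < l) (x : ℕ → Fin d → ℝ) (t : ℕ)
    {v w : Fin d → ℝ} (h : regGram l x t *ᵥ w = v) : (regGram l x t)⁻¹ *ᵥ v = w := by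
  rw [← h, mulVec_mulVec, nonsing_inv_mul _ (isUnit_det_regGram hl x t), one_mulVec]

/-- A Sherman–Morrison update. The increment splits into a term linear in the new noise, a term
quadratic in it and a negative term, which is what the martingale argument for the mean needs. -/
lemma selfNormalized_succ {l : ℝ} (hl : 0 < l) (x : ℕ → Fin d → ℝ) (e : ℕ → ℝ) (t : ℕ) :
    selfNormalized l x e (t + 1) = selfNormalized l x e t
      + (2 * e (t + 1) * noisePrediction l x e t + e (t + 1) ^ 2 * leverage l x t
        - noisePrediction l x e t ^ 2) / (1 + leverage l x t) := by
  have hq := leverage_nonneg hl x t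
  have hq' : 1 + leverage l x t ≠ 0 := by positivity
  have hpS : noiseSum x e t ⬝ᵥ (regGram l x t)⁻¹ *ᵥ x (t + 1) = noisePrediction l x e t :=
    dotProduct_inv_mulVec_comm hl x t _ _
  -- The new ridge solution is the old one moved along the inverse image of `x (t + 1)` by the
  -- prediction residual divided by `1 + leverage`. It is verified by multiplying with the new
  -- matrix.
  have key : (regGram l x (t + 1))⁻¹ *ᵥ noiseSum x e (t + 1)
      = (regGram l x t)⁻¹ *ᵥ noiseSum x e t
        + ((e (t + 1) - noisePrediction l x e t) / (1 + leverage l x t)) •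
          ((regGram l x t)⁻¹ *ᵥ x (t + 1)) := by
    apply inv_regGram_mulVec_eq hl
    rw [regGram_succ, noiseSum_succ, add_mulVec, mulVec_add, mulVec_smul,
      regGram_mulVec_inv_mulVec hl, regGram_mulVec_inv_mulVec hl, vecMulVec_self_mulVec,
      dotProduct_add, dotProduct_smul]
    change _ + _ + (noisePrediction l x e t + _ • leverage l x t) • _ = _
    rw [add_assoc, ← add_smul]
    congr 2
    rw [smul_eq_mul]
    field_simp
    ring
  rw [selfNormalized, key, noiseSum_succ, add_dotProduct, dotProduct_add, dotProduct_add,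
    dotProduct_smul, hpS, smul_dotProduct, smul_dotProduct, dotProduct_smul]
  change selfNormalized l x e t + _ • _ + (_ • noisePrediction l x e t + _ • _ • leverage l x t) = _
  simp only [smul_eq_mul]
  field_simp
  ring

lemma det_regGram_succ {l : ℝ} (hl : 0 < l) (x : ℕ → Fin d → ℝ) (t : ℕ) :
    (regGram l x (t + 1)).det = (regGram l x t).det * (1 + leverage l x t) := by
  rw [regGram_succ, vecMulVec_eq Unit,
    det_add_replicateCol_mul_replicateRow (isUnit_det_regGram hl x t)]
  congr 1
  rw [det_unique, Matrix.add_apply, one_apply_eq, Matrix.mul_assoc, leverage]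
  rfl

/-- Completing the square: the difference of the two sides is the squared inverse norm of `A w - S`,
with `A` the regularized Gram matrix and `S` the noise sum. -/
lemma two_mul_dotProduct_sub_le_selfNormalized {l : ℝ} (hl : 0 < l) (x : ℕ → Fin d → ℝ)
    (e : ℕ → ℝ) (t : ℕ) (w : Fin d → ℝ) :
    2 * (w ⬝ᵥ noiseSum x e t) - w ⬝ᵥ regGram l x t *ᵥ w ≤ selfNormalized l x e t := by
  have h := dotProduct_inv_mulVec_self_nonneg hl x t (regGram l x t *ᵥ w - noiseSum x e t)
  have h1 : (regGram l x t)⁻¹ *ᵥ (regGram l x t *ᵥ w) = w := inv_regGram_mulVec_eq hl x t rfl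
  have h2 : (regGram l x t *ᵥ w) ⬝ᵥ (regGram l x t)⁻¹ *ᵥ noiseSum x e t
      = noiseSum x e t ⬝ᵥ w := by
    rw [dotProduct_inv_mulVec_comm hl, h1]
  rw [mulVec_sub, dotProduct_sub, sub_dotProduct, sub_dotProduct, h1, h2,
    dotProduct_comm _ w, dotProduct_comm _ w] at h
  change 0 ≤ _ - (_ - selfNormalized l x e t) at h
  linarith

/-- Supplies the square integrability of the coefficient of the linear noise term, although the
contexts are unbounded. It follows from nonnegativity of the squared inverse norm of `S - c x`,
where `c` is the quotient on the left. -/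
lemma sq_noisePrediction_div_le {l : ℝ} (hl : 0 < l) (x : ℕ → Fin d → ℝ) (e : ℕ → ℝ) (t : ℕ) :
    (noisePrediction l x e t / (1 + leverage l x t)) ^ 2 ≤ selfNormalized l x e t := by
  have hq := leverage_nonneg hl x t
  set c := noisePrediction l x e t / (1 + leverage l x t) with hc
  have h := dotProduct_inv_mulVec_self_nonneg hl x t (noiseSum x e t - c • x (t + 1))
  have hpS : noiseSum x e t ⬝ᵥ (regGram l x t)⁻¹ *ᵥ x (t + 1) = noisePrediction l x e t :=
    dotProduct_inv_mulVec_comm hl x t _ _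
  rw [mulVec_sub, dotProduct_sub, sub_dotProduct, sub_dotProduct, mulVec_smul,
    dotProduct_smul, dotProduct_smul, hpS, smul_dotProduct, smul_dotProduct] at h
  change 0 ≤ selfNormalized l x e t - c • noisePrediction l x e t
    - (c • noisePrediction l x e t - c • c • leverage l x t) at h
  have hp : noisePrediction l x e t = c * (1 + leverage l x t) := by
    rw [hc]; field_simp
  rw [hp] at h
  simp only [smul_eq_mul] at h
  nlinarith [mul_nonneg hq (sq_nonneg c)]

/-- `q / (1 + q) = 1 - 1 / (1 + q) ≤ log (1 + q)`, and `1 + q` is the ratio of consecutive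
determinants. -/
lemma sum_leverage_div_le_log_det {l : ℝ} (hl : 0 < l) (x : ℕ → Fin d → ℝ) (t : ℕ) :
    ∑ s ∈ Finset.range t, leverage l x s / (1 + leverage l x s)
      ≤ Real.log (regGram l x t).det - Real.log (regGram l x 0).det := by
  induction t with
  | zero => simp
  | succ t ih =>
    have hq := leverage_nonneg hl x t
    rw [Finset.sum_range_succ, det_regGram_succ hl,
      Real.log_mul (posDef_regGram hl x t).det_pos.ne' (by positivity)]
    have h := Real.one_sub_inv_le_log_of_pos (x := 1 + leverage l x t) (by positivity)
    have h' : leverage l x t / (1 + leverage l x t) = 1 - (1 + leverage l x t)⁻¹ := by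
      field_simp; ring
    linarith

/-- The tangent line of the logarithm at `m`, applied to each eigenvalue. Because the bound is
linear in the trace, taking expectations later needs only second moments of the contexts. -/
lemma PosDef.log_det_le {A : Matrix (Fin d) (Fin d) ℝ} (hA : A.PosDef) {m : ℝ} (hm : 0 < m) :
    Real.log A.det ≤ d * Real.log m + A.trace / m - d := by
  rw [hA.isHermitian.det_eq_prod_eigenvalues, hA.isHermitian.trace_eq_sum_eigenvalues]
  simp only [RCLike.ofReal_real_eq_id, id]
  rw [Real.log_prod (fun i _ => (hA.eigenvalues_pos i).ne'), Finset.sum_div]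
  have h : ∀ i, Real.log (hA.isHermitian.eigenvalues i)
      ≤ Real.log m + hA.isHermitian.eigenvalues i / m - 1 := by
    intro i
    have hi := hA.eigenvalues_pos i
    have := Real.log_le_sub_one_of_pos (div_pos hi hm)
    rw [Real.log_div hi.ne' hm.ne'] at this
    linarith
  refine (Finset.sum_le_sum fun i _ => h i).trans (le_of_eq ?_)
  simp [Finset.sum_add_distrib]

lemma sum_leverage_div_le {l : ℝ} (hl : 0 < l) (x : ℕ → Fin d → ℝ) (t : ℕ) {m : ℝ}
    (hm : 0 < m) :
    ∑ s ∈ Finset.range t, leverage l x s / (1 + leverage l x s)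
      ≤ d * Real.log m + (d + (∑ s ∈ Finset.Icc 1 t, x s ⬝ᵥ x s) / l) / m - d := by
  have h0 : Real.log (regGram l x 0).det = d * Real.log l := by
    simp [regGram]
  have htr : (regGram l x t).trace = d * l + ∑ s ∈ Finset.Icc 1 t, x s ⬝ᵥ x s := by
    simp [regGram, trace_sum, trace_vecMulVec, mul_comm]
  have h1 := PosDef.log_det_le (posDef_regGram hl x t) (mul_pos hl hm)
  rw [htr, Real.log_mul hl.ne' hm.ne'] at h1
  have h2 := sum_leverage_div_le_log_det hl x t
  rw [h0] at h2
  have h3 : (d * l + ∑ s ∈ Finset.Icc 1 t, x s ⬝ᵥ x s) / (l * m)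
      = (d + (∑ s ∈ Finset.Icc 1 t, x s ⬝ᵥ x s) / l) / m := by
    field_simp
  rw [h3] at h1
  linarith

/-- If all quadratic forms of the Gram matrix are at least `m ≥ l` times the squared norm, the least
squares error is controlled by the self-normalized noise. -/
lemma mul_dotProduct_self_le_selfNormalized {l m : ℝ} (hl : 0 < l) (hlm : l ≤ m)
    (x : ℕ → Fin d → ℝ) (e : ℕ → ℝ) (t : ℕ) {v : Fin d → ℝ}
    (hm : m * (v ⬝ᵥ v) ≤ ∑ s ∈ Finset.Icc 1 t, (x s ⬝ᵥ v) ^ 2)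
    (hv : (∑ s ∈ Finset.Icc 1 t, vecMulVec (x s) (x s)) *ᵥ v = noiseSum x e t) :
    m * (v ⬝ᵥ v) ≤ 2 * selfNormalized l x e t := by
  -- With `w = v / 2` and noise sum `G v`, the left side is `3/4 · vᵀGv - l/4 · |v|²`, which is at
  -- least `m/2 · |v|²`. The ridge thus serves only the analysis; `v` solves the unregularized
  -- equation.
  have h := two_mul_dotProduct_sub_le_selfNormalized hl x e t ((1 / 2 : ℝ) • v)
  have hvv : 0 ≤ v ⬝ᵥ v := by
    simpa using dotProduct_star_self_nonneg v
  rw [← hv, mulVec_smul, smul_dotProduct, smul_dotProduct, dotProduct_smul,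
    dotProduct_sum_vecMulVec_mulVec, dotProduct_regGram_mulVec] at h
  simp only [smul_eq_mul] at h
  nlinarith [mul_le_mul_of_nonneg_right hlm hvv]

end LinearAlgebra

/-! ### Truncated moments from the `ψ₁` norm. -/

section Tail

/-- `|y| ^ k` truncated from below: it vanishes as long as `|y| ≤ b`. -/
noncomputable def excess (k : ℕ) (b y : ℝ) : ℝ := if b < |y| then |y| ^ k else 0

lemma excess_nonneg (k : ℕ) (b y : ℝ) : 0 ≤ excess k b y := by
  unfold excess; split_ifs <;> positivity

lemma abs_pow_le_add_excess (k : ℕ) (b y : ℝ) (hb : 0 ≤ b) : |y| ^ k ≤ b ^ k + excess k b y := by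
  unfold excess
  split_ifs with h
  · have := pow_nonneg hb k
    linarith
  · rw [add_zero]
    exact pow_le_pow_left₀ (abs_nonneg y) (not_lt.1 h) k

lemma abs_pow_le_add_sum_excess {ι : Type*} [Fintype ι] (k : ℕ) {b : ℝ} (hb : 0 ≤ b)
    (y : ι → ℝ) (j : ι) : |y j| ^ k ≤ b ^ k + ∑ i, excess k b (y i) :=
  (abs_pow_le_add_excess k b (y j) hb).trans <| by
    gcongr
    exact Finset.single_le_sum (f := fun i => excess k b (y i))
      (fun i _ => excess_nonneg k b (y i)) (Finset.mem_univ j)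

lemma measurable_excess (k : ℕ) : Measurable fun p : ℝ × ℝ => excess k p.1 p.2 := by
  unfold excess
  refine Measurable.ite (measurableSet_lt measurable_fst ?_) ?_ measurable_const
  · exact measurable_snd.abs
  · exact measurable_snd.abs.pow_const k

lemma excess_le_rpow {k : ℕ} {b p : ℝ} (hb : 0 < b) (hp : k ≤ p) (y : ℝ) :
    excess k b y ≤ b ^ k * (b ^ p)⁻¹ * |y| ^ p := by
  unfold excess
  split_ifs with h
  · have h1 : 1 ≤ |y| / b := (one_le_div hb).2 h.le
    have h2 : (|y| / b) ^ (k : ℝ) ≤ (|y| / b) ^ p := Real.rpow_le_rpow_of_exponent_le h1 hp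
    rw [Real.rpow_natCast, div_pow, Real.div_rpow (abs_nonneg y) hb.le] at h2
    have h3 := mul_le_mul_of_nonneg_left h2 (pow_nonneg hb.le k)
    rw [mul_div_cancel₀ _ (by positivity)] at h3
    calc |y| ^ k ≤ _ := h3
      _ = _ := by ring
  · positivity

variable {Ω : Type*} [MeasurableSpace Ω] {μ : Measure Ω}

lemma lintegral_rpow_le_of_psiOneNorm_le {Y : Ω → ℝ} {x : ℝ} (hx : 0 ≤ x)
    (hY : psiOneNorm μ Y ≤ ENNReal.ofReal x) {p : ℝ} (hp : 1 ≤ p) :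
    ∫⁻ ω, ENNReal.ofReal (|Y ω| ^ p) ∂μ ≤ ENNReal.ofReal ((p * x) ^ p) := by
  have hp0 : 0 < p := by linarith
  have h1 : eLpNorm Y (ENNReal.ofReal p) μ / ENNReal.ofReal p ≤ ENNReal.ofReal x :=
    (le_iSup₂ (f := fun (p : ℝ) (_ : 1 ≤ p) =>
      eLpNorm Y (ENNReal.ofReal p) μ / ENNReal.ofReal p) p hp).trans hY
  have h2 : eLpNorm Y (ENNReal.ofReal p) μ ≤ ENNReal.ofReal (p * x) := by
    rw [ENNReal.div_le_iff (by simpa using hp0) ENNReal.ofReal_ne_top,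
      ← ENNReal.ofReal_mul hx, mul_comm] at h1
    exact h1
  rw [eLpNorm_eq_lintegral_rpow_enorm_toReal (by simpa using hp0) ENNReal.ofReal_ne_top,
    ENNReal.toReal_ofReal hp0.le] at h2
  have h3 := ENNReal.rpow_le_rpow h2 hp0.le
  rw [← ENNReal.rpow_mul, one_div, inv_mul_cancel₀ hp0.ne', ENNReal.rpow_one,
    ENNReal.ofReal_rpow_of_nonneg (by positivity) hp0.le] at h3
  refine le_trans (le_of_eq ?_) h3
  refine lintegral_congr fun ω => ?_
  rw [Real.enorm_eq_ofReal_abs, ENNReal.ofReal_rpow_of_nonneg (abs_nonneg _) hp0.le]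

/-- Markov's inequality with the `p`-th moment, at most `(p x) ^ p`. The threshold `e p x` exceeds
`p x` by the factor `e`, which leaves `exp (-p)`; the free exponent `p` sets the tail. -/
lemma lintegral_excess_le_of_psiOneNorm_le {Y : Ω → ℝ} {x : ℝ} (hx : 0 < x)
    (hY : psiOneNorm μ Y ≤ ENNReal.ofReal x) {k : ℕ} {p : ℝ} (hk : k ≤ p) (hp : 1 ≤ p) :
    ∫⁻ ω, ENNReal.ofReal (excess k (Real.exp 1 * p * x) (Y ω)) ∂μ
      ≤ ENNReal.ofReal ((Real.exp 1 * p * x) ^ k * Real.exp (-p)) := by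
  have hp0 : 0 < p := by linarith
  set b := Real.exp 1 * p * x with hb
  have hb0 : 0 < b := by positivity
  calc ∫⁻ ω, ENNReal.ofReal (excess k b (Y ω)) ∂μ
      ≤ ∫⁻ ω, ENNReal.ofReal (b ^ k * (b ^ p)⁻¹) * ENNReal.ofReal (|Y ω| ^ p) ∂μ := by
        refine lintegral_mono fun ω => ?_
        rw [← ENNReal.ofReal_mul (by positivity)]
        exact ENNReal.ofReal_le_ofReal (excess_le_rpow hb0 hk (Y ω))
    _ = ENNReal.ofReal (b ^ k * (b ^ p)⁻¹) * ∫⁻ ω, ENNReal.ofReal (|Y ω| ^ p) ∂μ :=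
        lintegral_const_mul' _ _ ENNReal.ofReal_ne_top
    _ ≤ ENNReal.ofReal (b ^ k * (b ^ p)⁻¹) * ENNReal.ofReal ((p * x) ^ p) := by
        gcongr
        exact lintegral_rpow_le_of_psiOneNorm_le hx.le hY hp
    _ = ENNReal.ofReal (b ^ k * Real.exp (-p)) := by
        rw [← ENNReal.ofReal_mul (by positivity)]
        congr 1
        have : b ^ p = Real.exp p * (p * x) ^ p := by
          rw [hb, mul_assoc, Real.mul_rpow (by positivity) (by positivity), ← Real.exp_mul,
            one_mul]
        rw [this, Real.exp_neg]
        have : 0 < (p * x) ^ p := by positivity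
        field_simp

variable {d : ℕ}

lemma lintegral_excess_inner_le {Z : Ω → EuclideanSpace ℝ (Fin d)} {x : ℝ} (hx : 0 < x)
    (hZ : psiOneNormVec μ Z ≤ ENNReal.ofReal x) {k : ℕ} {p : ℝ} (hk0 : k ≠ 0) (hk : k ≤ p)
    (u : EuclideanSpace ℝ (Fin d)) :
    ∫⁻ ω, ENNReal.ofReal (excess k (Real.exp 1 * p * x * ‖u‖) (inner ℝ u (Z ω))) ∂μ
      ≤ ENNReal.ofReal ((Real.exp 1 * p * x * ‖u‖) ^ k * Real.exp (-p)) := by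
  have hp : 1 ≤ p := le_trans (by exact_mod_cast Nat.one_le_iff_ne_zero.2 hk0) hk
  rcases eq_or_ne u 0 with rfl | hu
  · simp [excess]
  have hu' : 0 < ‖u‖ := norm_pos_iff.2 hu
  set w := ‖u‖⁻¹ • u with hw
  have hwn : ‖w‖ = 1 := by
    rw [hw, norm_smul, norm_inv, norm_norm, inv_mul_cancel₀ hu'.ne']
  have huw : u = ‖u‖ • w := by
    rw [hw, smul_smul, mul_inv_cancel₀ hu'.ne', one_smul]
  have hY : psiOneNorm μ (fun ω => inner ℝ w (Z ω)) ≤ ENNReal.ofReal x :=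
    (le_iSup₂ (f := fun (u : EuclideanSpace ℝ (Fin d)) (_ : ‖u‖ = 1) =>
      psiOneNorm μ (fun ω => inner ℝ u (Z ω))) w hwn).trans hZ
  have h := lintegral_excess_le_of_psiOneNorm_le hx hY hk hp
  have hpt : ∀ ω, excess k (Real.exp 1 * p * x * ‖u‖) (inner ℝ u (Z ω))
      = ‖u‖ ^ k * excess k (Real.exp 1 * p * x) (inner ℝ w (Z ω)) := by
    intro ω
    have : |inner ℝ u (Z ω)| = ‖u‖ * |inner ℝ w (Z ω)| := by
      conv_lhs => rw [huw]
      rw [real_inner_smul_left, abs_mul, abs_norm]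
    unfold excess
    rw [this, mul_comm _ ‖u‖, mul_pow, mul_ite, mul_zero]
    simp only [mul_lt_mul_iff_right₀ hu']
  simp_rw [hpt, ENNReal.ofReal_mul (pow_nonneg hu'.le k)]
  generalize Real.exp 1 * p * x = b at h ⊢
  rw [lintegral_const_mul' _ _ ENNReal.ofReal_ne_top, mul_pow, mul_comm (b ^ k), mul_assoc,
    ENNReal.ofReal_mul (pow_nonneg hu'.le k)]
  gcongr

end Tail

/-! ### Second moments of conditionally sub-Gaussian noise. -/

section SubGaussian

variable {Ω : Type*} {m mΩ : MeasurableSpace Ω} {μ : Measure Ω}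
  {Z : Ω → ℝ} {σ : ℝ}

lemma sq_le_sq_mul_exp_add_exp (hσ : 0 < σ) (z : ℝ) :
    z ^ 2 ≤ σ ^ 2 * (Real.exp (σ⁻¹ * z) + Real.exp (-σ⁻¹ * z)) := by
  have h1 : ∀ y : ℝ, 0 ≤ y → y ^ 2 ≤ Real.exp y + Real.exp (-y) := by
    intro y hy
    rcases le_total y 2 with h | h
    · have h1 := Real.quadratic_le_exp_of_nonneg hy
      have h2 := Real.add_one_le_exp (-y)
      nlinarith
    · have := Real.sum_le_exp_of_nonneg hy 4
      simp [Finset.sum_range_succ, Nat.factorial] at this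
      have := Real.exp_pos (-y)
      nlinarith [mul_nonneg hy (sq_nonneg (y - 3 / 2))]
  have h2 : (σ⁻¹ * z) ^ 2 ≤ Real.exp (σ⁻¹ * z) + Real.exp (-σ⁻¹ * z) := by
    rw [neg_mul]
    rcases le_total 0 (σ⁻¹ * z) with h | h
    · exact h1 _ h
    · have := h1 _ (neg_nonneg.2 h)
      rw [neg_neg] at this
      nlinarith
  calc z ^ 2 = σ ^ 2 * (σ⁻¹ * z) ^ 2 := by field_simp
    _ ≤ _ := by gcongr

lemma IsCondSubGaussian.integrable_sq (h : IsCondSubGaussian μ m Z σ) (hσ : 0 < σ) :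
    Integrable (fun ω => Z ω ^ 2) μ := by
  refine (((h.integrable_exp σ⁻¹).add (h.integrable_exp (-σ⁻¹))).const_mul (σ ^ 2)).mono'
    (h.integrable.aestronglyMeasurable.pow 2) (ae_of_all _ fun ω => ?_)
  rw [Real.norm_of_nonneg (sq_nonneg _)]
  exact sq_le_sq_mul_exp_add_exp hσ (Z ω)

lemma IsCondSubGaussian.memLp_two (h : IsCondSubGaussian μ m Z σ) (hσ : 0 < σ) :
    MemLp Z 2 μ :=
  (memLp_two_iff_integrable_sq h.integrable.aestronglyMeasurable).2 (h.integrable_sq hσ)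

lemma IsCondSubGaussian.integral_mul_eq_zero [IsProbabilityMeasure μ] (hm : m ≤ mΩ) (h : IsCondSubGaussian μ m Z σ)
    {g : Ω → ℝ} (hg : StronglyMeasurable[m] g) (hgZ : Integrable (g * Z) μ) :
    ∫ ω, g ω * Z ω ∂μ = 0 := by
  have h1 := condExp_mul_of_stronglyMeasurable_left hg hgZ h.integrable
  have h2 : μ[g * Z | m] =ᵐ[μ] 0 := by
    filter_upwards [h1, h.condMean] with ω h3 h4
    rw [h3, Pi.mul_apply, h4]
    simp
  calc ∫ ω, g ω * Z ω ∂μ = ∫ ω, (μ[g * Z | m]) ω ∂μ := (integral_condExp hm).symm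
    _ = 0 := by rw [integral_congr_ae h2]; simp

lemma IsCondSubGaussian.condExp_sq_le [IsProbabilityMeasure μ] (h : IsCondSubGaussian μ m Z σ) (hσ : 0 < σ) :
    μ[fun ω => Z ω ^ 2 | m] ≤ᵐ[μ] fun _ => 4 * σ ^ 2 := by
  have hi := (h.integrable_exp σ⁻¹).add (h.integrable_exp (-σ⁻¹))
  have h1 : μ[fun ω => Z ω ^ 2 | m] ≤ᵐ[μ] μ[σ ^ 2 •
      ((fun ω => Real.exp (σ⁻¹ * Z ω)) + fun ω => Real.exp (-σ⁻¹ * Z ω)) | m] :=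
    condExp_mono (h.integrable_sq hσ) (hi.smul (σ ^ 2))
      (ae_of_all _ fun ω => sq_le_sq_mul_exp_add_exp hσ (Z ω))
  filter_upwards [h1, condExp_smul (μ := μ) (σ ^ 2)
    ((fun ω => Real.exp (σ⁻¹ * Z ω)) + fun ω => Real.exp (-σ⁻¹ * Z ω)) m,
    condExp_add (h.integrable_exp σ⁻¹) (h.integrable_exp (-σ⁻¹)) m,
    h.condMGF σ⁻¹, h.condMGF (-σ⁻¹)] with ω h1 h2 h3 h4 h5
  rw [h2, Pi.smul_apply, h3, Pi.add_apply, smul_eq_mul] at h1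
  have h6 : σ⁻¹ ^ 2 * σ ^ 2 / 2 = 1 / 2 := by field_simp
  rw [neg_sq, h6] at h5
  rw [h6] at h4
  -- At parameters `±σ⁻¹` both exponential moments are at most `√e ≤ 2`, hence the constant 4.
  have h7 : Real.exp (1 / 2) ≤ 2 := by
    have h8 : Real.exp (1 / 2) * Real.exp (1 / 2) = Real.exp 1 := by
      rw [← Real.exp_add]; norm_num
    have := Real.exp_one_lt_d9
    nlinarith [Real.exp_pos (1 / 2)]
  refine h1.trans ?_
  nlinarith [sq_nonneg σ]

lemma IsCondSubGaussian.integral_mul_sq_le [IsProbabilityMeasure μ] (hm : m ≤ mΩ) (h : IsCondSubGaussian μ m Z σ)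
    (hσ : 0 < σ) {g : Ω → ℝ} (hg : StronglyMeasurable[m] g) (hg0 : ∀ ω, 0 ≤ g ω)
    (hg1 : ∀ ω, g ω ≤ 1) :
    ∫ ω, g ω * Z ω ^ 2 ∂μ ≤ 4 * σ ^ 2 * ∫ ω, g ω ∂μ := by
  have hsq := h.integrable_sq hσ
  have hb : ∀ᵐ ω ∂μ, ‖g ω‖ ≤ 1 :=
    ae_of_all _ fun ω => by rw [Real.norm_of_nonneg (hg0 ω)]; exact hg1 ω
  have hgi : Integrable g μ := Integrable.of_bound (hg.mono hm).aestronglyMeasurable 1 hb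
  have hi : Integrable (g * fun ω => Z ω ^ 2) μ :=
    hsq.bdd_mul (hg.mono hm).aestronglyMeasurable hb
  have h1 := condExp_mul_of_stronglyMeasurable_left hg hi hsq
  calc ∫ ω, g ω * Z ω ^ 2 ∂μ = ∫ ω, (μ[g * fun ω => Z ω ^ 2 | m]) ω ∂μ :=
        (integral_condExp hm).symm
    _ ≤ ∫ ω, 4 * σ ^ 2 * g ω ∂μ := by
        refine integral_mono_ae integrable_condExp (hgi.const_mul _) ?_
        filter_upwards [h1, h.condExp_sq_le hσ] with ω h3 h4
        rw [h3, Pi.mul_apply, mul_comm]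
        exact mul_le_mul_of_nonneg_right h4 (hg0 ω)
    _ = _ := integral_const_mul _ _

end SubGaussian

/-! ### Measurability of the matrix quantities. -/

section Measurability

open Matrix

variable {Ω : Type*} {m : MeasurableSpace Ω} {d : ℕ}

lemma measurable_det {A : Ω → Matrix (Fin d) (Fin d) ℝ}
    (hA : ∀ i j, Measurable fun ω => A ω i j) : Measurable fun ω => (A ω).det := by
  simp only [det_apply]
  refine Finset.measurable_sum _ fun σ _ => ?_
  exact (Finset.measurable_prod _ fun i _ => hA _ _).const_smul _

lemma measurable_inv_apply {A : Ω → Matrix (Fin d) (Fin d) ℝ}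
    (hA : ∀ i j, Measurable fun ω => A ω i j) (i j : Fin d) :
    Measurable fun ω => (A ω)⁻¹ i j := by
  simp only [inv_def, Matrix.smul_apply, Ring.inverse_eq_inv', adjugate_apply, smul_eq_mul]
  refine (measurable_det hA).inv.mul (measurable_det fun k l => ?_)
  simp only [updateRow_apply]
  split_ifs
  · exact measurable_const
  · exact hA k l

lemma measurable_dotProduct {v w : Ω → Fin d → ℝ} (hv : Measurable v) (hw : Measurable w) :
    Measurable fun ω => v ω ⬝ᵥ w ω :=
  Finset.measurable_sum _ fun i _ =>
    ((measurable_pi_apply i).comp hv).mul ((measurable_pi_apply i).comp hw)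

lemma measurable_mulVec {A : Ω → Matrix (Fin d) (Fin d) ℝ} {v : Ω → Fin d → ℝ}
    (hA : ∀ i j, Measurable fun ω => A ω i j) (hv : Measurable v) :
    Measurable fun ω => A ω *ᵥ v ω :=
  measurable_pi_lambda _ fun i => by
    simp only [mulVec, dotProduct]
    exact Finset.measurable_sum _ fun j _ => (hA i j).mul ((measurable_pi_apply j).comp hv)

lemma measurable_sum_vecMulVec {x : ℕ → Ω → Fin d → ℝ} {I : Finset ℕ}
    (hx : ∀ s ∈ I, Measurable (x s)) (i j : Fin d) :
    Measurable fun ω => (∑ s ∈ I, vecMulVec (x s ω) (x s ω)) i j := by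
  simp only [Matrix.sum_apply, vecMulVec_apply]
  exact Finset.measurable_sum _ fun s hs =>
    ((measurable_pi_apply i).comp (hx s hs)).mul ((measurable_pi_apply j).comp (hx s hs))

lemma measurable_regGram {x : ℕ → Ω → Fin d → ℝ} {t : ℕ} (l : ℝ)
    (hx : ∀ s ∈ Finset.Icc 1 t, Measurable (x s)) (i j : Fin d) :
    Measurable fun ω => regGram l (fun s => x s ω) t i j := by
  simp only [regGram, Matrix.add_apply]
  exact measurable_const.add (measurable_sum_vecMulVec hx i j)

lemma measurable_noiseSum {x : ℕ → Ω → Fin d → ℝ} {e : ℕ → Ω → ℝ} {t : ℕ}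
    (hx : ∀ s ∈ Finset.Icc 1 t, Measurable (x s)) (he : ∀ s ∈ Finset.Icc 1 t, Measurable (e s)) :
    Measurable fun ω => noiseSum (fun s => x s ω) (fun s => e s ω) t := by
  simp only [noiseSum]
  exact Finset.measurable_sum _ fun s hs => (he s hs).smul (hx s hs)

lemma measurable_leverage {x : ℕ → Ω → Fin d → ℝ} {t : ℕ} (l : ℝ)
    (hx : ∀ s ∈ Finset.Icc 1 (t + 1), Measurable (x s)) :
    Measurable fun ω => leverage l (fun s => x s ω) t := by
  have hx' : ∀ s ∈ Finset.Icc 1 t, Measurable (x s) := fun s hs =>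
    hx s (Finset.Icc_subset_Icc_right (Nat.le_succ t) hs)
  have h1 := hx (t + 1) (Finset.mem_Icc.2 ⟨by omega, le_rfl⟩)
  exact measurable_dotProduct h1
    (measurable_mulVec (measurable_inv_apply (measurable_regGram l hx')) h1)

lemma measurable_noisePrediction {x : ℕ → Ω → Fin d → ℝ} {e : ℕ → Ω → ℝ} {t : ℕ} (l : ℝ)
    (hx : ∀ s ∈ Finset.Icc 1 (t + 1), Measurable (x s))
    (he : ∀ s ∈ Finset.Icc 1 t, Measurable (e s)) :
    Measurable fun ω => noisePrediction l (fun s => x s ω) (fun s => e s ω) t := by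
  have hx' : ∀ s ∈ Finset.Icc 1 t, Measurable (x s) := fun s hs =>
    hx s (Finset.Icc_subset_Icc_right (Nat.le_succ t) hs)
  exact measurable_dotProduct (hx (t + 1) (Finset.mem_Icc.2 ⟨by omega, le_rfl⟩))
    (measurable_mulVec (measurable_inv_apply (measurable_regGram l hx'))
      (measurable_noiseSum hx' he))

lemma measurable_selfNormalized {x : ℕ → Ω → Fin d → ℝ} {e : ℕ → Ω → ℝ} {t : ℕ} (l : ℝ)
    (hx : ∀ s ∈ Finset.Icc 1 t, Measurable (x s))
    (he : ∀ s ∈ Finset.Icc 1 t, Measurable (e s)) :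
    Measurable fun ω => selfNormalized l (fun s => x s ω) (fun s => e s ω) t :=
  measurable_dotProduct (measurable_noiseSum hx he)
    (measurable_mulVec (measurable_inv_apply (measurable_regGram l hx)) (measurable_noiseSum hx he))

end Measurability

/-! ### Expected self-normalized noise. -/

section SelfNormalized

open Matrix

variable {Ω : Type*} {m : MeasurableSpace Ω} [mΩ : MeasurableSpace Ω] {μ : Measure Ω}
  [IsProbabilityMeasure μ] {d : ℕ} {x : ℕ → Ω → Fin d → ℝ} {e : ℕ → Ω → ℝ} {pre : ℕ → MeasurableSpace Ω} {T : ℕ} {σ l : ℝ}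

/-- In the rank-one update the linear term is centred, because its coefficient is known before the
noise; the negative term is dropped; the quadratic term contributes at most `4σ²` times its
coefficient in mean. No boundedness of contexts or noise is needed. -/
lemma integral_selfNormalized_succ_le (hl : 0 < l) (hσ : 0 < σ)
    (hm : m ≤ mΩ) {t : ℕ} (hx : ∀ s ∈ Finset.Icc 1 (t + 1), Measurable[m] (x s))
    (he : ∀ s ∈ Finset.Icc 1 t, Measurable[m] (e s))
    (hsub : IsCondSubGaussian μ m (e (t + 1)) σ) (hem : Measurable (e (t + 1)))
    (hV : Integrable (fun ω => selfNormalized l (fun s => x s ω) (fun s => e s ω) t) μ) :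
    Integrable (fun ω => selfNormalized l (fun s => x s ω) (fun s => e s ω) (t + 1)) μ ∧
      ∫ ω, selfNormalized l (fun s => x s ω) (fun s => e s ω) (t + 1) ∂μ
        ≤ ∫ ω, selfNormalized l (fun s => x s ω) (fun s => e s ω) t ∂μ
          + 4 * σ ^ 2 * ∫ ω, leverage l (fun s => x s ω) t
              / (1 + leverage l (fun s => x s ω) t) ∂μ := by
  set V : ℕ → Ω → ℝ := fun t ω => selfNormalized l (fun s => x s ω) (fun s => e s ω) t with hVdef
  set q : Ω → ℝ := fun ω => leverage l (fun s => x s ω) t with hqdef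
  set p : Ω → ℝ := fun ω => noisePrediction l (fun s => x s ω) (fun s => e s ω) t with hpdef
  have hq0 : ∀ ω, 0 ≤ q ω := fun ω => leverage_nonneg hl _ t
  have hqm : Measurable[m] q := measurable_leverage l hx
  have hpm : Measurable[m] p := measurable_noisePrediction l hx he
  set g : Ω → ℝ := fun ω => p ω / (1 + q ω) with hgdef
  set h : Ω → ℝ := fun ω => q ω / (1 + q ω) with hhdef
  have hgm : Measurable[m] g := hpm.div (measurable_const.add hqm)
  have hhm : Measurable[m] h := hqm.div (measurable_const.add hqm)
  have hh0 : ∀ ω, 0 ≤ h ω := fun ω => div_nonneg (hq0 ω) (by linarith [hq0 ω])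
  have hh1 : ∀ ω, h ω ≤ 1 := fun ω => (div_le_one (by linarith [hq0 ω])).2 (by linarith)
  have hg2 : MemLp g 2 μ := by
    refine (memLp_two_iff_integrable_sq (hgm.mono hm le_rfl).aestronglyMeasurable).2 ?_
    refine hV.mono' ((hgm.mono hm le_rfl).pow_const 2).aestronglyMeasurable (ae_of_all _ fun ω => ?_)
    rw [Real.norm_of_nonneg (sq_nonneg _)]
    exact sq_noisePrediction_div_le hl _ _ t
  have hge : Integrable (g * e (t + 1)) μ := hg2.integrable_mul (hsub.memLp_two hσ)
  have hhe : Integrable (fun ω => h ω * e (t + 1) ω ^ 2) μ :=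
    (hsub.integrable_sq hσ).bdd_mul (c := 1) (hhm.mono hm le_rfl).aestronglyMeasurable
      (ae_of_all _ fun ω => by rw [Real.norm_of_nonneg (hh0 ω)]; exact hh1 ω)
  have hge' : Integrable (fun ω => 2 * (g ω * e (t + 1) ω)) μ := hge.const_mul 2
  have hle : ∀ ω, V (t + 1) ω ≤ V t ω + 2 * (g ω * e (t + 1) ω) + h ω * e (t + 1) ω ^ 2 := by
    intro ω
    have h1 := selfNormalized_succ hl (fun s => x s ω) (fun s => e s ω) t
    change V (t + 1) ω = V t ω + (2 * e (t + 1) ω * p ω + e (t + 1) ω ^ 2 * q ω - p ω ^ 2)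
      / (1 + q ω) at h1
    have hq1 : 0 < 1 + q ω := by linarith [hq0 ω]
    have h2 : V (t + 1) ω = V t ω + 2 * (g ω * e (t + 1) ω) + h ω * e (t + 1) ω ^ 2
        - p ω ^ 2 / (1 + q ω) := by
      rw [h1]; simp only [hgdef, hhdef]; ring
    have : 0 ≤ p ω ^ 2 / (1 + q ω) := by positivity
    linarith
  have hint := (hV.add hge').add hhe
  have hV1 : Integrable (V (t + 1)) μ := by
    refine hint.mono' ?_ (ae_of_all _ fun ω => ?_)
    · refine (measurable_selfNormalized l (fun s hs => (hx s hs).mono hm le_rfl)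
        fun s hs => ?_).aestronglyMeasurable
      rcases eq_or_ne s (t + 1) with rfl | hne
      · exact hem
      · have := Finset.mem_Icc.1 hs
        exact (he s (Finset.mem_Icc.2 ⟨this.1, by omega⟩)).mono hm le_rfl
    · rw [Real.norm_of_nonneg (selfNormalized_nonneg hl _ _ _)]
      exact hle ω
  refine ⟨hV1, ?_⟩
  calc ∫ ω, V (t + 1) ω ∂μ
      ≤ ∫ ω, (V t ω + 2 * (g ω * e (t + 1) ω) + h ω * e (t + 1) ω ^ 2) ∂μ :=
        integral_mono hV1 hint hle
    _ = ∫ ω, V t ω ∂μ + 2 * ∫ ω, g ω * e (t + 1) ω ∂μ + ∫ ω, h ω * e (t + 1) ω ^ 2 ∂μ := by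
        have hV' : Integrable (fun ω => V t ω + 2 * (g ω * e (t + 1) ω)) μ := hV.add hge'
        rw [integral_add hV' hhe, integral_add hV hge', integral_const_mul]
    _ ≤ ∫ ω, V t ω ∂μ + 4 * σ ^ 2 * ∫ ω, h ω ∂μ := by
        rw [hsub.integral_mul_eq_zero hm hgm.stronglyMeasurable hge, mul_zero, add_zero]
        gcongr
        exact hsub.integral_mul_sq_le hm hσ hhm.stronglyMeasurable hh0 hh1

lemma integral_selfNormalized_le_sum (hl : 0 < l) (hσ : 0 < σ)
    (hpre : ∀ t < T, pre (t + 1) ≤ mΩ)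
    (hx : ∀ t < T, ∀ s ∈ Finset.Icc 1 (t + 1), Measurable[pre (t + 1)] (x s))
    (he : ∀ t < T, ∀ s ∈ Finset.Icc 1 t, Measurable[pre (t + 1)] (e s))
    (hem : ∀ t < T, Measurable (e (t + 1)))
    (hsub : ∀ t < T, IsCondSubGaussian μ (pre (t + 1)) (e (t + 1)) σ) {t : ℕ} (ht : t ≤ T) :
    Integrable (fun ω => selfNormalized l (fun s => x s ω) (fun s => e s ω) t) μ ∧
      ∫ ω, selfNormalized l (fun s => x s ω) (fun s => e s ω) t ∂μ
        ≤ 4 * σ ^ 2 * ∑ s ∈ Finset.range t, ∫ ω, leverage l (fun s => x s ω) s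
              / (1 + leverage l (fun s => x s ω) s) ∂μ := by
  induction t with
  | zero => simp [selfNormalized, noiseSum]
  | succ t ih =>
    have ht' : t < T := ht
    obtain ⟨h1, h2⟩ := ih ht'.le
    obtain ⟨h3, h4⟩ := integral_selfNormalized_succ_le hl hσ (hpre t ht') (hx t ht') (he t ht')
      (hsub t ht') (hem t ht') h1
    refine ⟨h3, ?_⟩
    rw [Finset.sum_range_succ, mul_add]
    linarith

lemma integral_selfNormalized_le (hl : 0 < l) (hσ : 0 < σ)
    (hpre : ∀ t < T, pre (t + 1) ≤ mΩ)
    (hx : ∀ t < T, ∀ s ∈ Finset.Icc 1 (t + 1), Measurable[pre (t + 1)] (x s))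
    (he : ∀ t < T, ∀ s ∈ Finset.Icc 1 t, Measurable[pre (t + 1)] (e s))
    (hem : ∀ t < T, Measurable (e (t + 1)))
    (hsub : ∀ t < T, IsCondSubGaussian μ (pre (t + 1)) (e (t + 1)) σ) {t : ℕ} (ht : t ≤ T)
    {r m : ℝ} (hm : 0 < m)
    (hxi : ∀ s ∈ Finset.Icc 1 t, Integrable (fun ω => x s ω ⬝ᵥ x s ω) μ)
    (hxr : ∀ s ∈ Finset.Icc 1 t, ∫ ω, x s ω ⬝ᵥ x s ω ∂μ ≤ d * r) (hmr : 1 + T * r / l ≤ m)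
    (hr : 0 ≤ r) :
    Integrable (fun ω => selfNormalized l (fun s => x s ω) (fun s => e s ω) t) μ ∧
      ∫ ω, selfNormalized l (fun s => x s ω) (fun s => e s ω) t ∂μ
        ≤ 4 * σ ^ 2 * (d * Real.log m) := by
  obtain ⟨h1, h2⟩ := integral_selfNormalized_le_sum hl hσ hpre hx he hem hsub ht
  refine ⟨h1, h2.trans ?_⟩
  gcongr
  have hint : ∀ s ∈ Finset.range t, Integrable (fun ω => leverage l (fun s => x s ω) s
      / (1 + leverage l (fun s => x s ω) s)) μ := by
    intro s hs
    have hs' : s < T := (Finset.mem_range.1 hs).trans_le ht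
    have hq := (measurable_leverage l (hx s hs')).mono (hpre s hs') le_rfl
    refine Integrable.of_bound (hq.div (measurable_const.add hq)).aestronglyMeasurable 1
      (ae_of_all _ fun ω => ?_)
    have h0 := leverage_nonneg hl (fun s => x s ω) s
    rw [Real.norm_of_nonneg (by positivity)]
    exact (div_le_one (by positivity)).2 (by linarith)
  have hsumi : Integrable (fun ω => ∑ s ∈ Finset.Icc 1 t, x s ω ⬝ᵥ x s ω) μ :=
    integrable_finsetSum _ hxi
  have hbi : Integrable (fun ω => d * Real.log m
      + (d + (∑ s ∈ Finset.Icc 1 t, x s ω ⬝ᵥ x s ω) / l) / m - d) μ :=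
    ((integrable_const _).add (((integrable_const _).add (hsumi.div_const l)).div_const m)).sub
      (integrable_const _)
  rw [← integral_finsetSum _ hint]
  calc _ ≤ ∫ ω, (d * Real.log m
          + (d + (∑ s ∈ Finset.Icc 1 t, x s ω ⬝ᵥ x s ω) / l) / m - d) ∂μ :=
        integral_mono (integrable_finsetSum _ hint) hbi fun ω => sum_leverage_div_le hl _ t hm
    _ = d * Real.log m + (d + (∑ s ∈ Finset.Icc 1 t, ∫ ω, x s ω ⬝ᵥ x s ω ∂μ) / l) / m - d := by
        rw [← integral_finsetSum _ hxi]
        rw [integral_sub, integral_add, integral_div, integral_add, integral_div] <;>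
          first
          | simp
          | fun_prop
    -- The choice `m ≥ 1 + T r / l` makes the trace term at most `d`, which cancels the `- d`.
    _ ≤ d * Real.log m := by
        have h3 : ∑ s ∈ Finset.Icc 1 t, ∫ ω, x s ω ⬝ᵥ x s ω ∂μ ≤ T * (d * r) := by
          refine (Finset.sum_le_sum hxr).trans ?_
          rw [Finset.sum_const, Nat.card_Icc, nsmul_eq_mul]
          gcongr
          simpa using ht
        have h4 : (d + (∑ s ∈ Finset.Icc 1 t, ∫ ω, x s ω ⬝ᵥ x s ω ∂μ) / l) / m ≤ d := by
          rw [div_le_iff₀ hm]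
          calc d + (∑ s ∈ Finset.Icc 1 t, ∫ ω, x s ω ⬝ᵥ x s ω ∂μ) / l
              ≤ d + (T * (d * r)) / l := by gcongr
            _ = d * (1 + T * r / l) := by ring
            _ ≤ d * m := by gcongr
        linarith

end SelfNormalized

/-! ### Lower tails of adapted nonnegative sums. -/

section LowerTail

lemma exp_neg_le_one_sub_half {y : ℝ} (h0 : 0 ≤ y) (h1 : y ≤ 1) : Real.exp (-y) ≤ 1 - y / 2 := by
  have h2 := Real.add_one_le_exp y
  have h3 : Real.exp y * Real.exp (-y) = 1 := by rw [← Real.exp_add]; simp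
  have h4 := Real.exp_pos (-y)
  nlinarith [mul_nonneg h0 (sub_nonneg.2 h1)]

variable {Ω : Type*} [mΩ : MeasurableSpace Ω] {μ : Measure Ω} [IsProbabilityMeasure μ]
  {Z : ℕ → Ω → ℝ} {ℱ : ℕ → MeasurableSpace Ω} {T : ℕ} {κ B : ℝ}

/-- Each truncated variable divided by `B` lies in `[0, 1]`, where `exp (-y) ≤ 1 - y / 2`; testing
the mean condition with the exponential of the past gives a factor `1 - κ / (2B)` per step. The
condition is phrased through test functions, so no conditional expectation of the truncation has to
be handled. -/
lemma integral_exp_neg_sum_min_le (hB : 0 < B) (hℱ : ∀ t ≤ T, ℱ t ≤ mΩ)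
    (hZm : ∀ t ≤ T, ∀ s ∈ Finset.Icc 1 t, Measurable[ℱ t] (Z s)) (hZ0 : ∀ s ω, 0 ≤ Z s ω)
    (hκ : ∀ t < T, ∀ g : Ω → ℝ, Measurable[ℱ t] g → (∀ ω, 0 ≤ g ω) → (∀ ω, g ω ≤ 1) →
      κ * ∫ ω, g ω ∂μ ≤ ∫ ω, g ω * min (Z (t + 1) ω) B ∂μ) {t : ℕ} (ht : t ≤ T) :
    ∫ ω, Real.exp (-∑ s ∈ Finset.Icc 1 t, min (Z s ω) B / B) ∂μ
      ≤ Real.exp (-(κ * t / (2 * B))) := by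
  induction t with
  | zero => simp
  | succ t ih =>
    have ht' : t < T := ht
    set G : Ω → ℝ := fun ω => Real.exp (-∑ s ∈ Finset.Icc 1 t, min (Z s ω) B / B) with hG
    have hG0 : ∀ ω, 0 ≤ G ω := fun ω => (Real.exp_pos _).le
    have hy0 : ∀ s ω, 0 ≤ min (Z s ω) B / B := fun s ω =>
      div_nonneg (le_min (hZ0 s ω) hB.le) hB.le
    have hG1 : ∀ ω, G ω ≤ 1 := fun ω => by
      simp only [hG]
      rw [Real.exp_le_one_iff, neg_nonpos]
      exact Finset.sum_nonneg fun s _ => hy0 s ω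
    have hGm : Measurable[ℱ t] G := by
      have : Measurable[ℱ t] fun ω => ∑ s ∈ Finset.Icc 1 t, min (Z s ω) B / B :=
        Finset.measurable_sum _ fun s hs =>
          ((hZm t ht'.le s hs).min measurable_const).div_const B
      exact this.neg.exp
    have hGM := hGm.mono (hℱ t ht'.le) le_rfl
    have hY : Measurable fun ω => min (Z (t + 1) ω) B :=
      ((hZm (t + 1) ht (t + 1) (Finset.mem_Icc.2 ⟨by omega, le_rfl⟩)).mono
        (hℱ _ ht) le_rfl).min measurable_const
    have hGi : Integrable G μ := Integrable.of_bound hGM.aestronglyMeasurable 1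
      (ae_of_all _ fun ω => by rw [Real.norm_of_nonneg (hG0 ω)]; exact hG1 ω)
    have hGY : Integrable (fun ω => G ω * min (Z (t + 1) ω) B) μ :=
      Integrable.of_bound (hGM.mul hY).aestronglyMeasurable B
        (ae_of_all _ fun ω => by
          have hn : 0 ≤ min (Z (t + 1) ω) B := le_min (hZ0 _ ω) hB.le
          rw [Real.norm_of_nonneg (mul_nonneg (hG0 ω) hn)]
          calc _ ≤ 1 * min (Z (t + 1) ω) B := mul_le_mul_of_nonneg_right (hG1 ω) hn
            _ ≤ B := by rw [one_mul]; exact min_le_right _ _)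
    have hpt : ∀ ω, Real.exp (-∑ s ∈ Finset.Icc 1 (t + 1), min (Z s ω) B / B)
        ≤ G ω - (2 * B)⁻¹ * (G ω * min (Z (t + 1) ω) B) := by
      intro ω
      rw [Finset.sum_Icc_succ_top (by omega), neg_add, Real.exp_add]
      have h1 := exp_neg_le_one_sub_half (hy0 (t + 1) ω)
        ((div_le_one hB).2 (min_le_right _ _))
      calc _ ≤ G ω * (1 - min (Z (t + 1) ω) B / B / 2) :=
            mul_le_mul_of_nonneg_left h1 (hG0 ω)
        _ = _ := by field_simp
    calc ∫ ω, Real.exp (-∑ s ∈ Finset.Icc 1 (t + 1), min (Z s ω) B / B) ∂μ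
        ≤ ∫ ω, (G ω - (2 * B)⁻¹ * (G ω * min (Z (t + 1) ω) B)) ∂μ :=
          integral_mono_of_nonneg (ae_of_all _ fun ω => (Real.exp_pos _).le)
            (hGi.sub (hGY.const_mul _)) (ae_of_all _ hpt)
      _ = ∫ ω, G ω ∂μ - (2 * B)⁻¹ * ∫ ω, G ω * min (Z (t + 1) ω) B ∂μ := by
          rw [integral_sub hGi (hGY.const_mul _), integral_const_mul]
      _ ≤ ∫ ω, G ω ∂μ - (2 * B)⁻¹ * (κ * ∫ ω, G ω ∂μ) := by
          gcongr
          exact hκ t ht' G hGm hG0 hG1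
      _ = (-(κ / (2 * B)) + 1) * ∫ ω, G ω ∂μ := by ring
      _ ≤ Real.exp (-(κ / (2 * B))) * Real.exp (-(κ * t / (2 * B))) :=
          mul_le_mul (Real.add_one_le_exp _) (ih ht'.le) (integral_nonneg hG0)
            (Real.exp_pos _).le
      _ = Real.exp (-(κ * (t + 1 : ℕ) / (2 * B))) := by
          rw [← Real.exp_add]; congr 1; push_cast; ring

/-- Lower tail of a sum of nonnegative variables whose truncations have conditional mean at
least `κ`. -/
lemma measureReal_sum_lt_le (hB : 0 < B) (hℱ : ∀ t ≤ T, ℱ t ≤ mΩ)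
    (hZm : ∀ t ≤ T, ∀ s ∈ Finset.Icc 1 t, Measurable[ℱ t] (Z s)) (hZ0 : ∀ s ω, 0 ≤ Z s ω)
    (hκ : ∀ t < T, ∀ g : Ω → ℝ, Measurable[ℱ t] g → (∀ ω, 0 ≤ g ω) → (∀ ω, g ω ≤ 1) →
      κ * ∫ ω, g ω ∂μ ≤ ∫ ω, g ω * min (Z (t + 1) ω) B ∂μ) {t : ℕ} (ht : t ≤ T) :
    μ.real {ω | ∑ s ∈ Finset.Icc 1 t, Z s ω < κ * t / 4} ≤ Real.exp (-(κ * t / (4 * B))) := by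
  set G : Ω → ℝ := fun ω => Real.exp (-∑ s ∈ Finset.Icc 1 t, min (Z s ω) B / B) with hG
  have hGM : Measurable G := by
    have : Measurable fun ω => ∑ s ∈ Finset.Icc 1 t, min (Z s ω) B / B :=
      Finset.measurable_sum _ fun s hs =>
        (((hZm t ht s hs).mono (hℱ t ht) le_rfl).min measurable_const).div_const B
    exact this.neg.exp
  have hG1 : ∀ ω, G ω ≤ 1 := fun ω => by
    simp only [hG]
    rw [Real.exp_le_one_iff, neg_nonpos]
    exact Finset.sum_nonneg fun s _ => div_nonneg (le_min (hZ0 s ω) hB.le) hB.le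
  have hGi : Integrable G μ := Integrable.of_bound hGM.aestronglyMeasurable 1
    (ae_of_all _ fun ω => by rw [Real.norm_of_nonneg (Real.exp_pos _).le]; exact hG1 ω)
  -- Markov's inequality at the square root of the exponential bound, so one factor `exp (-(κ t /
  -- (4B)))` remains.
  have h1 := mul_meas_ge_le_integral_of_nonneg
    (ae_of_all μ fun ω => (Real.exp_pos (-∑ s ∈ Finset.Icc 1 t, min (Z s ω) B / B)).le) hGi
    (Real.exp (-(κ * t / (4 * B))))
  have h2 := h1.trans (integral_exp_neg_sum_min_le hB hℱ hZm hZ0 hκ ht)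
  have hsub : {ω | ∑ s ∈ Finset.Icc 1 t, Z s ω < κ * t / 4}
      ⊆ {ω | Real.exp (-(κ * t / (4 * B))) ≤ G ω} := by
    intro ω hω
    simp only [Set.mem_ofPred_eq, hG] at hω ⊢
    rw [Real.exp_le_exp, neg_le_neg_iff, ← Finset.sum_div, div_le_div_iff₀ hB (by positivity)]
    have : ∑ s ∈ Finset.Icc 1 t, min (Z s ω) B ≤ ∑ s ∈ Finset.Icc 1 t, Z s ω :=
      Finset.sum_le_sum fun s _ => min_le_left _ _
    nlinarith
  have h3 := measureReal_mono (μ := μ) hsub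
  have h4 : Real.exp (-(κ * t / (2 * B)))
      = Real.exp (-(κ * t / (4 * B))) * Real.exp (-(κ * t / (4 * B))) := by
    rw [← Real.exp_add]; congr 1; ring
  rw [h4] at h2
  exact h3.trans (le_of_mul_le_mul_left h2 (Real.exp_pos _))

end LowerTail

/-! ### An integer grid in place of a net of the sphere. -/

section Net

open Matrix

variable {d : ℕ}

/-- The integer vectors with entries in `[-m, m]`. -/
noncomputable def gridPoints (d m : ℕ) : Finset (Fin d → ℤ) :=
  Fintype.piFinset fun _ => Finset.Icc (-(m : ℤ)) m

lemma card_gridPoints (d m : ℕ) : (gridPoints d m).card = (2 * m + 1) ^ d := by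
  simp only [gridPoints, Fintype.card_piFinset, Int.card_Icc, Finset.prod_const, Finset.card_univ,
    Fintype.card_fin]
  congr 1
  omega

lemma sq_dotProduct_le (v w : Fin d → ℝ) : (v ⬝ᵥ w) ^ 2 ≤ (v ⬝ᵥ v) * (w ⬝ᵥ w) := by
  have := Finset.sum_mul_sq_le_sq_mul_sq Finset.univ v w
  simpa [dotProduct, sq] using this

lemma dotProduct_self_nonneg' (v : Fin d → ℝ) : 0 ≤ v ⬝ᵥ v :=
  Finset.sum_nonneg fun _ _ => mul_self_nonneg _

lemma exists_gridPoint_near (m : ℕ) {u : Fin d → ℝ} (hu : u ⬝ᵥ u = 1) :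
    ∃ k ∈ gridPoints d m, ∃ w : Fin d → ℝ, w ⬝ᵥ w ≤ d ∧
      (fun i => (k i : ℝ)) = (m : ℝ) • u - w := by
  have hui : ∀ i, |u i| ≤ 1 := by
    intro i
    have h1 : u i * u i ≤ u ⬝ᵥ u :=
      Finset.single_le_sum (f := fun i => u i * u i) (fun i _ => mul_self_nonneg _)
        (Finset.mem_univ i)
    rw [hu] at h1
    exact abs_le_one_iff_mul_self_le_one.2 h1
  refine ⟨fun i => ⌊(m : ℝ) * u i⌋, ?_, fun i => Int.fract ((m : ℝ) * u i), ?_, ?_⟩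
  · simp only [gridPoints, Fintype.mem_piFinset, Finset.mem_Icc]
    intro i
    have h1 := abs_le.1 (hui i)
    have hm : (0 : ℝ) ≤ m := Nat.cast_nonneg m
    refine ⟨Int.le_floor.2 ?_, ?_⟩
    · push_cast; nlinarith
    · have : (⌊(m : ℝ) * u i⌋ : ℝ) ≤ (m : ℤ) := (Int.floor_le _).trans (by push_cast; nlinarith)
      exact_mod_cast this
  · calc ∑ i, Int.fract ((m : ℝ) * u i) * Int.fract ((m : ℝ) * u i) ≤ ∑ _i : Fin d, (1 : ℝ) :=
        Finset.sum_le_sum fun i _ => by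
          have h0 := Int.fract_nonneg ((m : ℝ) * u i)
          have h1 := (Int.fract_lt_one ((m : ℝ) * u i)).le
          nlinarith
      _ = d := by simp
  · ext i
    exact (Int.self_sub_fract _).symm

/-- A lower bound of a quadratic form on the grid extends to all vectors. -/
lemma le_sum_sq_of_gridPoints {x : ℕ → Fin d → ℝ} {I : Finset ℕ} {c r : ℝ} {m : ℕ} (hm : 0 < m)
    (hgrid : ∀ k ∈ gridPoints d m, c * ((fun i => (k i : ℝ)) ⬝ᵥ fun i => (k i : ℝ))
      ≤ ∑ s ∈ I, (x s ⬝ᵥ fun i => (k i : ℝ)) ^ 2)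
    (htr : ∑ s ∈ I, x s ⬝ᵥ x s ≤ r) (hc : 0 ≤ c) (hmr : 4 * d * (c + 2 * r) ≤ c * m ^ 2)
    (u : Fin d → ℝ) : c / 8 * (u ⬝ᵥ u) ≤ ∑ s ∈ I, (x s ⬝ᵥ u) ^ 2 := by
  have hm' : (0 : ℝ) < m := by exact_mod_cast hm
  have unit : ∀ u : Fin d → ℝ, u ⬝ᵥ u = 1 → c / 8 ≤ ∑ s ∈ I, (x s ⬝ᵥ u) ^ 2 := by
    intro u hu
    obtain ⟨k, hk, w, hw, hkw⟩ := exists_gridPoint_near m hu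
    have h1 := hgrid k hk
    rw [hkw] at h1
    -- The grid point is `m u - w` with `|w|² ≤ d`. Its squared length is at least `m²/2 - d`, and
    -- its quadratic form is at most `2m²` times that of `u` plus `2 d r`. The condition on `m`
    -- makes both errors at most half of the main term, leaving `c / 8`.
    have h2 : (m : ℝ) ^ 2 / 2 - d ≤ ((m : ℝ) • u - w) ⬝ᵥ ((m : ℝ) • u - w) := by
      have h3 := dotProduct_self_nonneg' ((m : ℝ) • u - (2 : ℝ) • w)
      simp only [sub_dotProduct, dotProduct_sub, smul_dotProduct, dotProduct_smul, smul_eq_mul,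
        hu] at h3 ⊢
      rw [dotProduct_comm w u] at *
      nlinarith
    have h4 : ∑ s ∈ I, (x s ⬝ᵥ ((m : ℝ) • u - w)) ^ 2
        ≤ 2 * m ^ 2 * ∑ s ∈ I, (x s ⬝ᵥ u) ^ 2 + 2 * (d * r) := by
      calc ∑ s ∈ I, (x s ⬝ᵥ ((m : ℝ) • u - w)) ^ 2
          ≤ ∑ s ∈ I, (2 * m ^ 2 * (x s ⬝ᵥ u) ^ 2 + 2 * (d * (x s ⬝ᵥ x s))) := by
            refine Finset.sum_le_sum fun s _ => ?_
            have h5 := sq_dotProduct_le (x s) w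
            have h6 := mul_le_mul_of_nonneg_left hw (dotProduct_self_nonneg' (x s))
            rw [dotProduct_sub, dotProduct_smul, smul_eq_mul]
            nlinarith [sq_nonneg ((m : ℝ) * (x s ⬝ᵥ u) + x s ⬝ᵥ w)]
        _ = 2 * m ^ 2 * ∑ s ∈ I, (x s ⬝ᵥ u) ^ 2 + 2 * (d * ∑ s ∈ I, x s ⬝ᵥ x s) := by
            rw [Finset.sum_add_distrib, Finset.mul_sum, Finset.mul_sum, Finset.mul_sum]
        _ ≤ _ := by gcongr
    have h7 := (mul_le_mul_of_nonneg_left h2 hc).trans (h1.trans h4)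
    have h8 : c / 8 * (2 * (m : ℝ) ^ 2) ≤ (∑ s ∈ I, (x s ⬝ᵥ u) ^ 2) * (2 * m ^ 2) := by
      nlinarith
    exact le_of_mul_le_mul_right h8 (by positivity)
  rcases (dotProduct_self_nonneg' u).eq_or_lt with h0 | h0
  · rw [← h0, mul_zero]
    exact Finset.sum_nonneg fun _ _ => sq_nonneg _
  · set a := Real.sqrt (u ⬝ᵥ u) with ha
    have ha2 : a ^ 2 = u ⬝ᵥ u := Real.sq_sqrt h0.le
    have ha0 : 0 < a := Real.sqrt_pos.2 h0
    have h1 := unit (a⁻¹ • u) (by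
      rw [smul_dotProduct, dotProduct_smul, smul_eq_mul, smul_eq_mul, ← ha2]; field_simp)
    simp only [dotProduct_smul, smul_eq_mul, mul_pow] at h1
    rw [← Finset.mul_sum, inv_pow, ha2, ← div_eq_inv_mul, le_div_iff₀ h0] at h1
    exact h1

end Net

/-! ### Measurability with respect to the history. -/

section History

variable {Ω : Type*} {d K : ℕ} {θ : EuclideanSpace ℝ (Fin d)}
  {X : ℕ → Ω → Fin K → EuclideanSpace ℝ (Fin d)} {η : ℕ → Ω → Fin K → ℝ} {a : ℕ → Ω → Fin K}
  {s t : ℕ}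

lemma measurable_history_triple (hs : s ∈ Finset.Icc 1 t) :
    Measurable[history θ X η a t] fun ω => (a s ω, chosen X a s ω, reward θ X η a s ω) :=
  Measurable.mono (comap_measurable _)
    (le_iSup₂ (f := fun s (_ : s ∈ Finset.Icc 1 t) => MeasurableSpace.comap
      (fun ω => (a s ω, chosen X a s ω, reward θ X η a s ω)) inferInstance) s hs) le_rfl

lemma measurable_history_chosen (hs : s ∈ Finset.Icc 1 t) :
    Measurable[history θ X η a t] (chosen X a s) :=
  (measurable_fst.comp measurable_snd).comp (measurable_history_triple hs)

lemma measurable_history_reward (hs : s ∈ Finset.Icc 1 t) :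
    Measurable[history θ X η a t] (reward θ X η a s) :=
  (measurable_snd.comp measurable_snd).comp (measurable_history_triple hs)

lemma measurable_history_chosenNoise (hs : s ∈ Finset.Icc 1 t) :
    Measurable[history θ X η a t] (chosenNoise η a s) := by
  have h1 : chosenNoise η a s
      = fun ω => reward θ X η a s ω - inner ℝ (chosen X a s ω) θ := by
    ext ω; simp [reward]
  rw [h1]
  exact (measurable_history_reward hs).sub
    (Measurable.inner_const (measurable_history_chosen hs))

lemma measurable_preReward_chosen (hs : s ∈ Finset.Icc 1 (t + 1)) :
    Measurable[preReward θ X η a (t + 1)] (chosen X a s) := by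
  rcases eq_or_ne s (t + 1) with rfl | hne
  · have h1 : Measurable[preReward θ X η a (t + 1)]
        fun ω => (a (t + 1) ω, chosen X a (t + 1) ω) :=
      Measurable.mono (comap_measurable _) le_sup_right le_rfl
    exact measurable_snd.comp h1
  · have := Finset.mem_Icc.1 hs
    exact (measurable_history_chosen (Finset.mem_Icc.2 ⟨this.1, by omega⟩)).mono le_sup_left le_rfl

end History

/-! ### The bandit model. -/

section Model

variable {Ω : Type*} [mΩ : MeasurableSpace Ω] {μ : Measure Ω}

lemma integrable_and_integral_le_of_lintegral_le {f : Ω → ℝ} {c : ℝ} (hf : Measurable f)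
    (hf0 : ∀ ω, 0 ≤ f ω) (hc : 0 ≤ c) (h : ∫⁻ ω, ENNReal.ofReal (f ω) ∂μ ≤ ENNReal.ofReal c) :
    Integrable f μ ∧ ∫ ω, f ω ∂μ ≤ c := by
  have hi : Integrable f μ :=
    (lintegral_ofReal_ne_top_iff_integrable hf.aestronglyMeasurable (ae_of_all _ hf0)).1
      (h.trans_lt ENNReal.ofReal_lt_top).ne
  refine ⟨hi, ?_⟩
  rw [← ofReal_integral_eq_lintegral_ofReal hi (ae_of_all _ hf0)] at h
  exact (ENNReal.ofReal_le_ofReal_iff hc).1 h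

/-- A linear bandit with diversity constant `lam` and margin constant `CΔ`, played by LinGreedy. -/
structure GreedyBandit (μ : Measure Ω) {d K : ℕ} [NeZero K] (T : ℕ)
    (θ θ₀ : EuclideanSpace ℝ (Fin d)) (σ xmax lam CΔ : ℝ)
    (X : ℕ → Ω → Fin K → EuclideanSpace ℝ (Fin d)) (η : ℕ → Ω → Fin K → ℝ)
    (a : ℕ → Ω → Fin K) : Prop where
  one_le_d : 1 ≤ d
  two_le_K : 2 ≤ K
  two_le_T : 2 ≤ T
  norm_le : ‖θ‖ ≤ 1
  sigma_nonneg : 0 ≤ σ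
  xmax_pos : 0 < xmax
  lam_pos : 0 < lam
  K_le_T : K ≤ T
  horizon : xmax * Real.log K ≤ σ ^ 2 * CΔ * Real.log T
  measurable_X : ∀ t ∈ Finset.Icc 1 T, Measurable (X t)
  measurable_noise : ∀ t ∈ Finset.Icc 1 T, Measurable (η t)
  greedy : IsLinGreedy T θ θ₀ X η a
  subGaussian : ∀ t ∈ Finset.Icc 1 T,
    IsCondSubGaussian μ (preReward θ X η a t) (chosenNoise η a t) σ
  indep : ∀ t ∈ Finset.Icc 1 T,
    Indep (MeasurableSpace.comap (X t) inferInstance) (history θ X η a (t - 1)) μ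
  psiOne_le : ∀ t ∈ Finset.Icc 1 T, ∀ i,
    psiOneNormVec μ (fun ω => X t ω i) ≤ ENNReal.ofReal xmax
  diversity : ∀ t ∈ Finset.Icc 1 T, ∀ᵐ ω ∂μ,
    (condSecondMoment μ (history θ X η a (t - 1)) (chosen X a t) ω
      - lam • (1 : Matrix (Fin d) (Fin d) ℝ)).PosSemidef
  margin : ∀ t ∈ Finset.Icc 1 T, ∀ ε : ℝ, 0 < ε →
    μ⟦{ω | suboptGap θ (X t ω) ≤ ε} | history θ X η a (t - 1)⟧
      ≤ᵐ[μ] fun _ => ε * CΔ + 1 / Real.sqrt T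

namespace GreedyBandit

variable {d K : ℕ} [NeZero K] {T : ℕ} {θ θ₀ : EuclideanSpace ℝ (Fin d)} {σ xmax lam CΔ : ℝ}
  {X : ℕ → Ω → Fin K → EuclideanSpace ℝ (Fin d)} {η : ℕ → Ω → Fin K → ℝ} {a : ℕ → Ω → Fin K}

/-! ### Measurability -/

lemma measurable_chosen (h : GreedyBandit μ T θ θ₀ σ xmax lam CΔ X η a) {t : ℕ}
    (ht : t ∈ Finset.Icc 1 T) : Measurable (chosen X a t) := by
  have h1 : Measurable fun p : Fin K × (Fin K → EuclideanSpace ℝ (Fin d)) => p.2 p.1 :=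
    measurable_from_prod_countable_right fun i => measurable_pi_apply i
  exact h1.comp ((h.greedy.measurable t ht).prodMk (h.measurable_X t ht))

lemma measurable_chosenNoise (h : GreedyBandit μ T θ θ₀ σ xmax lam CΔ X η a) {t : ℕ}
    (ht : t ∈ Finset.Icc 1 T) : Measurable (chosenNoise η a t) := by
  have h1 : Measurable fun p : Fin K × (Fin K → ℝ) => p.2 p.1 :=
    measurable_from_prod_countable_right fun i => measurable_pi_apply i
  exact h1.comp ((h.greedy.measurable t ht).prodMk (h.measurable_noise t ht))

lemma measurable_reward (h : GreedyBandit μ T θ θ₀ σ xmax lam CΔ X η a) {t : ℕ}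
    (ht : t ∈ Finset.Icc 1 T) : Measurable (reward θ X η a t) :=
  ((h.measurable_chosen ht).inner_const).add (h.measurable_chosenNoise ht)

lemma history_le (h : GreedyBandit μ T θ θ₀ σ xmax lam CΔ X η a) {t : ℕ} (ht : t ≤ T) :
    history θ X η a t ≤ mΩ := by
  refine iSup₂_le fun s hs => Measurable.comap_le ?_
  have hs' : s ∈ Finset.Icc 1 T := Finset.Icc_subset_Icc_right ht hs
  exact (h.greedy.measurable s hs').prodMk
    ((h.measurable_chosen hs').prodMk (h.measurable_reward hs'))

lemma preReward_le (h : GreedyBandit μ T θ θ₀ σ xmax lam CΔ X η a) {t : ℕ}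
    (ht : t ∈ Finset.Icc 1 T) : preReward θ X η a t ≤ mΩ := by
  have := (Finset.mem_Icc.1 ht)
  exact sup_le (h.history_le (by omega))
    ((h.greedy.measurable t ht).prodMk (h.measurable_chosen ht)).comap_le

end GreedyBandit

end Model

/-! ### Numerical estimates for the two truncation radii. -/

section Constants

/-- The truncation radius below which all contexts stay with high probability. -/
noncomputable def hiRadius (xmax : ℝ) (T : ℕ) : ℝ := Real.exp 1 * (20 * Real.log T) * xmax

/-- The truncation radius that governs the mean of the largest context. -/
noncomputable def loRadius (xmax : ℝ) (K : ℕ) : ℝ := Real.exp 1 * (Real.log K + 2) * xmax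

lemma log_ge_of_two_le {n : ℕ} (hn : 2 ≤ n) : 0.693 ≤ Real.log n := by
  have h1 : Real.log 2 ≤ Real.log n := Real.log_le_log (by norm_num) (by exact_mod_cast hn)
  have := Real.log_two_gt_d9
  linarith

lemma hiRadius_pos {xmax : ℝ} {T : ℕ} (hx : 0 < xmax) (hT : 2 ≤ T) : 0 < hiRadius xmax T := by
  have := log_ge_of_two_le hT
  have h2 : 0 < Real.log T := by linarith
  unfold hiRadius; positivity

lemma loRadius_nonneg {xmax : ℝ} {K : ℕ} (hx : 0 ≤ xmax) : 0 ≤ loRadius xmax K := by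
  have : 0 ≤ Real.log K := Real.log_natCast_nonneg K
  unfold loRadius; positivity

lemma hiRadius_sq_le (xmax : ℝ) (T : ℕ) :
    hiRadius xmax T ^ 2 ≤ 3000 * (xmax ^ 2 * Real.log T ^ 2) := by
  have h1 := Real.exp_one_lt_d9
  have h2 := Real.exp_pos 1
  have h3 : Real.exp 1 ^ 2 * 400 ≤ 3000 := by nlinarith
  calc hiRadius xmax T ^ 2 = (Real.exp 1 ^ 2 * 400) * (xmax ^ 2 * Real.log T ^ 2) := by
        unfold hiRadius; ring
    _ ≤ _ := by gcongr

lemma loRadius_le {xmax : ℝ} {K : ℕ} (hx : 0 ≤ xmax) (hK : 2 ≤ K) :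
    loRadius xmax K ≤ 11 * (xmax * Real.log K) := by
  have h1 := Real.exp_one_lt_d9
  have h2 := Real.exp_pos 1
  have h3 := log_ge_of_two_le hK
  have h4 : Real.exp 1 * (Real.log K + 2) ≤ 11 * Real.log K := by nlinarith
  calc loRadius xmax K = Real.exp 1 * (Real.log K + 2) * xmax := rfl
    _ ≤ 11 * Real.log K * xmax := by gcongr
    _ = _ := by ring

lemma mul_exp_neg_log_add_two_le {K : ℕ} (hK : 2 ≤ K) :
    K * Real.exp (-(Real.log K + 2)) ≤ 1 := by
  have hK0 : (0 : ℝ) < K := by positivity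
  rw [neg_add, Real.exp_add, Real.exp_neg, Real.exp_log hK0, ← mul_assoc,
    mul_inv_cancel₀ hK0.ne', one_mul, Real.exp_le_one_iff]
  norm_num

lemma exp_neg_twenty_mul_log {T : ℕ} (hT : 2 ≤ T) :
    Real.exp (-(20 * Real.log T)) = ((T : ℝ) ^ 20)⁻¹ := by
  have hT0 : (0 : ℝ) < T := by positivity
  rw [Real.exp_neg, mul_comm, Real.exp_mul, Real.exp_log hT0]
  norm_cast

end Constants

section

variable {d K : ℕ}

lemma measurable_sum_excess (k : ℕ) (b : ℝ) (u : EuclideanSpace ℝ (Fin d)) :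
    Measurable fun x : Fin K → EuclideanSpace ℝ (Fin d) =>
      ∑ i, excess k b (inner ℝ u (x i)) :=
  Finset.measurable_sum _ fun i _ => (measurable_excess k).comp
    (measurable_const.prodMk (Measurable.const_inner (measurable_pi_apply i)))

lemma sum_excess_nonneg (k : ℕ) (b : ℝ) (u : EuclideanSpace ℝ (Fin d))
    (x : Fin K → EuclideanSpace ℝ (Fin d)) : 0 ≤ ∑ i, excess k b (inner ℝ u (x i)) :=
  Finset.sum_nonneg fun _ _ => excess_nonneg _ _ _

end

namespace GreedyBandit

variable {Ω : Type*} [mΩ : MeasurableSpace Ω] {μ : Measure Ω}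
  {d K : ℕ} [NeZero K] {T : ℕ} {θ θ₀ : EuclideanSpace ℝ (Fin d)} {σ xmax lam CΔ : ℝ}
  {X : ℕ → Ω → Fin K → EuclideanSpace ℝ (Fin d)} {η : ℕ → Ω → Fin K → ℝ} {a : ℕ → Ω → Fin K}

/-! ### Moments of the contexts -/

lemma lintegral_sum_excess_le (h : GreedyBandit μ T θ θ₀ σ xmax lam CΔ X η a) {t : ℕ}
    (ht : t ∈ Finset.Icc 1 T) {k : ℕ} {p : ℝ} (hk0 : k ≠ 0) (hk : k ≤ p)
    (u : EuclideanSpace ℝ (Fin d)) :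
    ∫⁻ ω, ENNReal.ofReal (∑ i, excess k (Real.exp 1 * p * xmax * ‖u‖) (inner ℝ u (X t ω i))) ∂μ
      ≤ ENNReal.ofReal (K * ((Real.exp 1 * p * xmax * ‖u‖) ^ k * Real.exp (-p))) := by
  have hxm : ∀ i, Measurable fun ω => X t ω i := fun i =>
    (measurable_pi_apply i).comp (h.measurable_X t ht)
  simp_rw [ENNReal.ofReal_sum_of_nonneg fun i (_ : i ∈ Finset.univ) => excess_nonneg k
    (Real.exp 1 * p * xmax * ‖u‖) _]
  rw [lintegral_finsetSum _ fun i _ => ?_]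
  · refine (Finset.sum_le_sum fun i _ =>
      lintegral_excess_inner_le h.xmax_pos (h.psiOne_le t ht i) hk0 hk u).trans (le_of_eq ?_)
    rw [Finset.sum_const, Finset.card_univ, Fintype.card_fin, nsmul_eq_mul,
      ENNReal.ofReal_mul (Nat.cast_nonneg K), ENNReal.ofReal_natCast]
  · exact ((measurable_excess k).comp
      (measurable_const.prodMk (Measurable.const_inner (hxm i)))).ennreal_ofReal

lemma integral_sum_excess_le (h : GreedyBandit μ T θ θ₀ σ xmax lam CΔ X η a) {t : ℕ}
    (ht : t ∈ Finset.Icc 1 T) {k : ℕ} {p : ℝ} (hk0 : k ≠ 0) (hk : k ≤ p)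
    (u : EuclideanSpace ℝ (Fin d)) :
    Integrable (fun ω => ∑ i, excess k (Real.exp 1 * p * xmax * ‖u‖) (inner ℝ u (X t ω i))) μ ∧
    ∫ ω, ∑ i, excess k (Real.exp 1 * p * xmax * ‖u‖) (inner ℝ u (X t ω i)) ∂μ
      ≤ K * ((Real.exp 1 * p * xmax * ‖u‖) ^ k * Real.exp (-p)) := by
  have hp : 0 ≤ p := (Nat.cast_nonneg k).trans hk
  have := h.xmax_pos
  exact integrable_and_integral_le_of_lintegral_le
    ((measurable_sum_excess k _ u).comp (h.measurable_X t ht))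
    (fun ω => sum_excess_nonneg _ _ _ _) (by positivity) (h.lintegral_sum_excess_le ht hk0 hk u)

/-- The exponent `p = log K + 2` makes `K exp (-p) ≤ 1`, so summing the tails over the arms costs no
factor `K`; it is at least 2, as the second moment requires. -/
lemma integral_sum_excess_lo_le (h : GreedyBandit μ T θ θ₀ σ xmax lam CΔ X η a) {t : ℕ}
    (ht : t ∈ Finset.Icc 1 T) {k : ℕ} (hk0 : k ≠ 0) (hk : k ≤ 2)
    (u : EuclideanSpace ℝ (Fin d)) :
    Integrable (fun ω => ∑ i, excess k (loRadius xmax K * ‖u‖) (inner ℝ u (X t ω i))) μ ∧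
    ∫ ω, ∑ i, excess k (loRadius xmax K * ‖u‖) (inner ℝ u (X t ω i)) ∂μ
      ≤ (loRadius xmax K * ‖u‖) ^ k := by
  have h0 := log_ge_of_two_le h.two_le_K
  have hk' : (k : ℝ) ≤ 2 := by exact_mod_cast hk
  obtain ⟨h1, h2⟩ := h.integral_sum_excess_le ht hk0 (p := Real.log K + 2) (by linarith) u
  refine ⟨h1, h2.trans ?_⟩
  have h3 := mul_exp_neg_log_add_two_le h.two_le_K
  have h4 := loRadius_nonneg (K := K) h.xmax_pos.le
  change K * ((loRadius xmax K * ‖u‖) ^ k * _) ≤ _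
  calc K * ((loRadius xmax K * ‖u‖) ^ k * Real.exp (-(Real.log K + 2)))
      = (loRadius xmax K * ‖u‖) ^ k * (K * Real.exp (-(Real.log K + 2))) := by ring
    _ ≤ (loRadius xmax K * ‖u‖) ^ k * 1 := by gcongr
    _ = _ := mul_one _

/-- The exponent `p = 20 log T` gives `T⁻²⁰` per arm, and `K ≤ T` absorbs the sum over the arms. -/
lemma integral_sum_excess_hi_le (h : GreedyBandit μ T θ θ₀ σ xmax lam CΔ X η a) {t : ℕ}
    (ht : t ∈ Finset.Icc 1 T) {k : ℕ} (hk0 : k ≠ 0) (hk : k ≤ 2)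
    (u : EuclideanSpace ℝ (Fin d)) :
    Integrable (fun ω => ∑ i, excess k (hiRadius xmax T * ‖u‖) (inner ℝ u (X t ω i))) μ ∧
    ∫ ω, ∑ i, excess k (hiRadius xmax T * ‖u‖) (inner ℝ u (X t ω i)) ∂μ
      ≤ (hiRadius xmax T * ‖u‖) ^ k * ((T : ℝ) ^ 19)⁻¹ := by
  have h0 := log_ge_of_two_le h.two_le_T
  have hk' : (k : ℝ) ≤ 2 := by exact_mod_cast hk
  have hT0 : (0 : ℝ) < T := by have := h.two_le_T; positivity
  obtain ⟨h1, h2⟩ := h.integral_sum_excess_le ht hk0 (p := 20 * Real.log T) (by linarith) u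
  refine ⟨h1, h2.trans ?_⟩
  rw [exp_neg_twenty_mul_log h.two_le_T]
  have h4 := hiRadius_pos h.xmax_pos h.two_le_T
  have h5 : (K : ℝ) ≤ T := by exact_mod_cast h.K_le_T
  change K * ((hiRadius xmax T * ‖u‖) ^ k * _) ≤ _
  calc K * ((hiRadius xmax T * ‖u‖) ^ k * ((T : ℝ) ^ 20)⁻¹)
      ≤ T * ((hiRadius xmax T * ‖u‖) ^ k * ((T : ℝ) ^ 20)⁻¹) := by gcongr
    _ = _ := by field_simp

lemma integral_sq_inner_chosen_le [IsProbabilityMeasure μ]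
    (h : GreedyBandit μ T θ θ₀ σ xmax lam CΔ X η a) {t : ℕ}
    (ht : t ∈ Finset.Icc 1 T) (u : EuclideanSpace ℝ (Fin d)) :
    Integrable (fun ω => (inner ℝ u (chosen X a t ω)) ^ 2) μ ∧
    ∫ ω, (inner ℝ u (chosen X a t ω)) ^ 2 ∂μ
      ≤ 242 * (xmax * Real.log K) ^ 2 * ‖u‖ ^ 2 := by
  obtain ⟨h1, h2⟩ := h.integral_sum_excess_lo_le ht two_ne_zero le_rfl u
  have hb := mul_nonneg (loRadius_nonneg (K := K) h.xmax_pos.le) (norm_nonneg u)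
  have hm : Measurable fun ω => (inner ℝ u (chosen X a t ω)) ^ 2 :=
    (Measurable.const_inner (h.measurable_chosen ht)).pow_const 2
  -- The pulled arm depends on the contexts, so its moments are not covered by the `ψ₁` bound on
  -- single arms; they are dominated by a sum over all arms.
  have hpt : ∀ ω, (inner ℝ u (chosen X a t ω)) ^ 2 ≤ (loRadius xmax K * ‖u‖) ^ 2
      + ∑ i, excess 2 (loRadius xmax K * ‖u‖) (inner ℝ u (X t ω i)) := by
    intro ω
    have := abs_pow_le_add_sum_excess 2 hb (fun i => inner ℝ u (X t ω i)) (a t ω)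
    rwa [sq_abs] at this
  have hi := (integrable_const (μ := μ) ((loRadius xmax K * ‖u‖) ^ 2)).add h1
  have hint : Integrable (fun ω => (inner ℝ u (chosen X a t ω)) ^ 2) μ :=
    hi.mono' hm.aestronglyMeasurable (ae_of_all _ fun ω => by
      rw [Real.norm_of_nonneg (sq_nonneg _)]; exact hpt ω)
  refine ⟨hint, (integral_mono hint hi hpt).trans ?_⟩
  have h3 : ∫ ω, ((loRadius xmax K * ‖u‖) ^ 2
      + ∑ i, excess 2 (loRadius xmax K * ‖u‖) (inner ℝ u (X t ω i))) ∂μ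
      ≤ 2 * (loRadius xmax K * ‖u‖) ^ 2 := by
    rw [integral_add (integrable_const _) h1]
    simp only [integral_const, probReal_univ, one_smul]
    linarith
  refine h3.trans ?_
  have h4 := loRadius_le h.xmax_pos.le h.two_le_K
  have h5 := loRadius_nonneg (K := K) h.xmax_pos.le
  calc 2 * (loRadius xmax K * ‖u‖) ^ 2 = 2 * loRadius xmax K ^ 2 * ‖u‖ ^ 2 := by ring
    _ ≤ 2 * (11 * (xmax * Real.log K)) ^ 2 * ‖u‖ ^ 2 := by gcongr
    _ = _ := by ring

lemma integrable_mul_coord (h : GreedyBandit μ T θ θ₀ σ xmax lam CΔ X η a)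
    [IsProbabilityMeasure μ] {t : ℕ} (ht : t ∈ Finset.Icc 1 T) (i j : Fin d) :
    Integrable (fun ω => chosen X a t ω i * chosen X a t ω j) μ := by
  have h1 : ∀ i, MemLp (fun ω => chosen X a t ω i) 2 μ := by
    intro i
    have h2 := (h.integral_sq_inner_chosen_le ht (EuclideanSpace.single i 1)).1
    have h3 : ∀ ω, inner ℝ (EuclideanSpace.single i (1 : ℝ)) (chosen X a t ω)
        = chosen X a t ω i := by
      intro ω; simp [EuclideanSpace.inner_single_left]
    simp only [h3] at h2
    refine (memLp_two_iff_integrable_sq ?_).2 h2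
    have h4 : Measurable fun ω => chosen X a t ω i := by
      simp only [← h3]
      exact Measurable.const_inner (h.measurable_chosen ht)
    exact h4.aestronglyMeasurable
  exact (h1 i).integrable_mul (h1 j)

/-- The diversity assumption, tested against a bounded function of the history. -/
lemma lam_mul_le_integral (h : GreedyBandit μ T θ θ₀ σ xmax lam CΔ X η a)
    [IsProbabilityMeasure μ] {t : ℕ} (ht : t ∈ Finset.Icc 1 T) (u : EuclideanSpace ℝ (Fin d))
    {g : Ω → ℝ} (hg : Measurable[history θ X η a (t - 1)] g) (hg0 : ∀ ω, 0 ≤ g ω)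
    (hg1 : ∀ ω, g ω ≤ 1) :
    lam * ‖u‖ ^ 2 * ∫ ω, g ω ∂μ ≤ ∫ ω, g ω * (inner ℝ u (chosen X a t ω)) ^ 2 ∂μ := by
  have hm : history θ X η a (t - 1) ≤ mΩ := h.history_le (by
    have := (Finset.mem_Icc.1 ht); omega)
  set f : Fin d → Fin d → Ω → ℝ := fun i j ω => chosen X a t ω i * chosen X a t ω j with hf
  have hb : ∀ᵐ ω ∂μ, ‖g ω‖ ≤ 1 :=
    ae_of_all _ fun ω => by rw [Real.norm_of_nonneg (hg0 ω)]; exact hg1 ω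
  have hgM := (hg.mono hm le_rfl).aestronglyMeasurable (μ := μ)
  have hgi : Integrable g μ := Integrable.of_bound hgM 1 hb
  have hgf : ∀ i j, Integrable (g * f i j) μ := fun i j =>
    (h.integrable_mul_coord ht i j).bdd_mul hgM hb
  have hgc : ∀ i j, Integrable
      (fun ω => g ω * (μ[f i j | history θ X η a (t - 1)]) ω) μ := fun i j =>
    integrable_condExp.bdd_mul hgM hb
  have hpull : ∀ i j, ∫ ω, (g * f i j) ω ∂μ
      = ∫ ω, g ω * (μ[f i j | history θ X η a (t - 1)]) ω ∂μ := by
    intro i j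
    rw [← integral_condExp hm]
    refine integral_congr_ae ?_
    filter_upwards [condExp_mul_of_stronglyMeasurable_left hg.stronglyMeasurable (hgf i j)
      (h.integrable_mul_coord ht i j)] with ω hω
    rw [hω, Pi.mul_apply]
  have hsq : ∀ ω, g ω * (inner ℝ u (chosen X a t ω)) ^ 2
      = ∑ i, ∑ j, u i * u j * (g * f i j) ω := by
    intro ω
    have h1 : inner ℝ u (chosen X a t ω) = ∑ i, u i * chosen X a t ω i := by
      simp [PiLp.inner_apply, mul_comm]
    rw [h1, sq, Finset.sum_mul_sum, Finset.mul_sum]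
    refine Finset.sum_congr rfl fun i _ => ?_
    rw [Finset.mul_sum]
    refine Finset.sum_congr rfl fun j _ => ?_
    simp only [hf, Pi.mul_apply]
    ring
  calc lam * ‖u‖ ^ 2 * ∫ ω, g ω ∂μ = ∫ ω, lam * ‖u‖ ^ 2 * g ω ∂μ :=
        (integral_const_mul _ _).symm
    _ ≤ ∫ ω, ∑ i, ∑ j, u i * u j * (g ω * (μ[f i j | history θ X η a (t - 1)]) ω) ∂μ := by
        refine integral_mono_ae (hgi.const_mul _) (integrable_finsetSum _ fun i _ =>
          integrable_finsetSum _ fun j _ => (hgc i j).const_mul _) ?_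
        filter_upwards [h.diversity t ht] with ω hω
        have h1 := hω.dotProduct_mulVec_nonneg u.ofLp
        have h2 : ‖u‖ ^ 2 = ∑ i, u i * u i := by
          rw [EuclideanSpace.real_norm_sq_eq]; simp only [sq]
        have h3 : ∑ i, ∑ j, u i * u j * (g ω * (μ[f i j | history θ X η a (t - 1)]) ω)
            = g ω * ∑ i, ∑ j, u i * u j * (μ[f i j | history θ X η a (t - 1)]) ω := by
          simp only [Finset.mul_sum]
          refine Finset.sum_congr rfl fun i _ => Finset.sum_congr rfl fun j _ => ?_
          ring
        have h4 : ∑ i, ∑ j, u i * u j * (μ[f i j | history θ X η a (t - 1)]) ω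
            = u.ofLp ⬝ᵥ (condSecondMoment μ (history θ X η a (t - 1)) (chosen X a t) ω).mulVec
              u.ofLp := by
          simp only [dotProduct, Matrix.mulVec, Finset.mul_sum]
          refine Finset.sum_congr rfl fun i _ => Finset.sum_congr rfl fun j _ => ?_
          simp only [condSecondMoment, Matrix.of_apply, hf]
          ring
        rw [star_trivial, Matrix.sub_mulVec, dotProduct_sub, Matrix.smul_mulVec,
          Matrix.one_mulVec, dotProduct_smul, smul_eq_mul, ← h4] at h1
        change lam * ‖u‖ ^ 2 * g ω ≤ _
        rw [h3, h2, mul_comm]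
        refine mul_le_mul_of_nonneg_left ?_ (hg0 ω)
        change 0 ≤ _ - lam * ∑ i, u i * u i at h1
        linarith
    _ = ∫ ω, g ω * (inner ℝ u (chosen X a t ω)) ^ 2 ∂μ := by
        simp_rw [hsq]
        rw [integral_finsetSum _ fun i _ => integrable_finsetSum _ fun j _ =>
            (hgc i j).const_mul _,
          integral_finsetSum _ fun i _ => integrable_finsetSum _ fun j _ => (hgf i j).const_mul _]
        refine Finset.sum_congr rfl fun i _ => ?_
        rw [integral_finsetSum _ fun j _ => (hgc i j).const_mul _,
          integral_finsetSum _ fun j _ => (hgf i j).const_mul _]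
        refine Finset.sum_congr rfl fun j _ => ?_
        rw [integral_const_mul, integral_const_mul, hpull]

/-- Diversity and the second-moment bound compared in one coordinate direction. This forces the
warm-up to last at least `d` rounds. -/
lemma lam_le (h : GreedyBandit μ T θ θ₀ σ xmax lam CΔ X η a) [IsProbabilityMeasure μ] :
    lam ≤ 242 * (xmax * Real.log K) ^ 2 := by
  have h1 : 1 ∈ Finset.Icc 1 T := Finset.mem_Icc.2 ⟨le_rfl, by have := h.two_le_T; omega⟩
  set u : EuclideanSpace ℝ (Fin d) := EuclideanSpace.single ⟨0, h.one_le_d⟩ (1 : ℝ) with hu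
  have hn : ‖u‖ = 1 := by simp [hu]
  have h2 := h.lam_mul_le_integral h1 u (g := fun _ => 1) measurable_const
    (fun _ => zero_le_one) (fun _ => le_rfl)
  have h3 := (h.integral_sq_inner_chosen_le h1 u).2
  simp only [hn, one_pow, mul_one, one_mul, integral_const, probReal_univ, smul_eq_mul] at h2 h3
  linarith

end GreedyBandit

lemma inner_eq_dotProduct {d : ℕ} (u v : EuclideanSpace ℝ (Fin d)) :
    inner ℝ u v = v.ofLp ⬝ᵥ u.ofLp := by
  simp [PiLp.inner_apply, dotProduct]

lemma norm_sq_eq_dotProduct {d : ℕ} (u : EuclideanSpace ℝ (Fin d)) :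
    ‖u‖ ^ 2 = u.ofLp ⬝ᵥ u.ofLp := by
  rw [← inner_eq_dotProduct, real_inner_self_eq_norm_sq]

/-! ### The event that the Gram matrix is well conditioned. -/

section

variable {Ω : Type*} {d K T : ℕ} {θ : EuclideanSpace ℝ (Fin d)} {xmax lam : ℝ}
  {X : ℕ → Ω → Fin K → EuclideanSpace ℝ (Fin d)} {η : ℕ → Ω → Fin K → ℝ} {a : ℕ → Ω → Fin K}

/-- The bound on the trace of the Gram matrix that fails with probability at most `1 / T`. -/
noncomputable def traceBound (d K T : ℕ) (xmax : ℝ) : ℝ :=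
  (T : ℝ) ^ 2 * (d * (242 * (xmax * Real.log K) ^ 2))

/-- The event that the quadratic forms of the Gram matrix are large on the grid, and that its trace
is not too large. -/
def gramGood (T : ℕ) (lam xmax : ℝ) (X : ℕ → Ω → Fin K → EuclideanSpace ℝ (Fin d))
    (a : ℕ → Ω → Fin K) (t : ℕ) : Set Ω :=
  {ω | (∀ k ∈ gridPoints d (T ^ 11), lam * t / 8 * ((fun i => (k i : ℝ)) ⬝ᵥ fun i => (k i : ℝ))
      ≤ ∑ s ∈ Finset.Icc 1 t, ((chosen X a s ω).ofLp ⬝ᵥ fun i => (k i : ℝ)) ^ 2) ∧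
    ∑ s ∈ Finset.Icc 1 t, (chosen X a s ω).ofLp ⬝ᵥ (chosen X a s ω).ofLp
      ≤ traceBound d K T xmax}

lemma measurableSet_gramGood (t : ℕ) :
    MeasurableSet[history θ X η a t] (gramGood T lam xmax X a t) := by
  have hx : ∀ s ∈ Finset.Icc 1 t,
      Measurable[history θ X η a t] fun ω => (chosen X a s ω).ofLp := fun s hs =>
    (WithLp.measurable_ofLp 2 (Fin d → ℝ)).comp (measurable_history_chosen hs)
  have heq : gramGood T lam xmax X a t = (⋂ k ∈ gridPoints d (T ^ 11),
      {ω | lam * t / 8 * ((fun i => (k i : ℝ)) ⬝ᵥ fun i => (k i : ℝ))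
        ≤ ∑ s ∈ Finset.Icc 1 t, ((chosen X a s ω).ofLp ⬝ᵥ fun i => (k i : ℝ)) ^ 2}) ∩
      {ω | ∑ s ∈ Finset.Icc 1 t, (chosen X a s ω).ofLp ⬝ᵥ (chosen X a s ω).ofLp
        ≤ traceBound d K T xmax} := by
    ext ω
    simp [gramGood]
  rw [heq]
  refine MeasurableSet.inter (Finset.measurableSet_biInter _ fun k _ => ?_) ?_
  · exact measurableSet_le measurable_const (Finset.measurable_sum _ fun s hs =>
      (measurable_dotProduct (hx s hs) measurable_const).pow_const 2)
  · exact measurableSet_le (Finset.measurable_sum _ fun s hs =>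
      measurable_dotProduct (hx s hs) (hx s hs)) measurable_const

end

namespace GreedyBandit

variable {Ω : Type*} [mΩ : MeasurableSpace Ω] {μ : Measure Ω}
  {d K : ℕ} [NeZero K] {T : ℕ} {θ θ₀ : EuclideanSpace ℝ (Fin d)} {σ xmax lam CΔ : ℝ}
  {X : ℕ → Ω → Fin K → EuclideanSpace ℝ (Fin d)} {η : ℕ → Ω → Fin K → ℝ} {a : ℕ → Ω → Fin K}

lemma indepFun_of_measurable_history (h : GreedyBandit μ T θ θ₀ σ xmax lam CΔ X η a) {t : ℕ}
    (ht : t ∈ Finset.Icc 1 T) {β : Type*} [MeasurableSpace β] {f : Ω → β}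
    (hf : Measurable[history θ X η a (t - 1)] f) : IndepFun (X t) f μ :=
  (IndepFun_iff_Indep _ _ _).2 (indep_of_indep_of_le_right (h.indep t ht) hf.comap_le)

lemma one_le_cast_d (h : GreedyBandit μ T θ θ₀ σ xmax lam CΔ X η a) : (1 : ℝ) ≤ d := by
  exact_mod_cast h.one_le_d

lemma T_pos (h : GreedyBandit μ T θ θ₀ σ xmax lam CΔ X η a) : (0 : ℝ) < T := by
  have := h.two_le_T
  positivity

lemma log_T_pos (h : GreedyBandit μ T θ θ₀ σ xmax lam CΔ X η a) : 0 < Real.log T := by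
  have := log_ge_of_two_le h.two_le_T
  linarith

lemma log_T_le (h : GreedyBandit μ T θ θ₀ σ xmax lam CΔ X η a) : Real.log T ≤ T := by
  have := Real.log_le_sub_one_of_pos h.T_pos
  linarith

lemma log_K_pos (h : GreedyBandit μ T θ θ₀ σ xmax lam CΔ X η a) : 0 < Real.log K := by
  have := log_ge_of_two_le h.two_le_K
  linarith

lemma log_K_le (h : GreedyBandit μ T θ θ₀ σ xmax lam CΔ X η a) : Real.log K ≤ Real.log T := by
  have := h.two_le_K
  exact Real.log_le_log (by positivity) (by exact_mod_cast h.K_le_T)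

lemma pow_le_T_pow (h : GreedyBandit μ T θ θ₀ σ xmax lam CΔ X η a) (n : ℕ) :
    (2 : ℝ) ^ n ≤ (T : ℝ) ^ n :=
  pow_le_pow_left₀ (by norm_num) (by exact_mod_cast h.two_le_T) n

lemma le_sum_sq_of_mem_gramGood (h : GreedyBandit μ T θ θ₀ σ xmax lam CΔ X η a)
    (hlam : xmax ^ 2 ≤ lam * T) (hd : d ≤ T) {t : ℕ} (ht : 1 ≤ t) {ω : Ω}
    (hω : ω ∈ gramGood T lam xmax X a t) (u : Fin d → ℝ) :
    lam * t / 64 * (u ⬝ᵥ u) ≤ ∑ s ∈ Finset.Icc 1 t, ((chosen X a s ω).ofLp ⬝ᵥ u) ^ 2 := by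
  have hlam0 := h.lam_pos
  have hT := h.T_pos
  have hc : lam / 8 ≤ lam * t / 8 := by
    have : (1 : ℝ) ≤ t := by exact_mod_cast ht
    nlinarith
  have hd' : (d : ℝ) ≤ T := by exact_mod_cast hd
  have h1 := le_sum_sq_of_gridPoints (m := T ^ 11) (by have := h.two_le_T; positivity) hω.1 hω.2
    (by positivity) ?_ u
  · rw [div_div] at h1
    norm_num at h1 ⊢
    exact h1
  push_cast
  have h2 : 4 * (d : ℝ) * (lam * t / 8) ≤ lam * t / 8 * ((T : ℝ) ^ 11) ^ 2 / 2 := by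
    have h3 : 8 * (T : ℝ) ≤ ((T : ℝ) ^ 11) ^ 2 := by
      have h4 := h.pow_le_T_pow 21
      calc 8 * (T : ℝ) ≤ (T : ℝ) ^ 21 * T := by gcongr; linarith
        _ = _ := by ring
    have h5 : 0 ≤ lam * t / 8 := by positivity
    nlinarith [mul_le_mul_of_nonneg_left (h3.trans' (mul_le_mul_of_nonneg_left hd'
      (by norm_num : (0 : ℝ) ≤ 8))) h5]
  have h3 : 8 * (d : ℝ) * traceBound d K T xmax ≤ lam * t / 8 * ((T : ℝ) ^ 11) ^ 2 / 2 := by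
    -- All problem parameters are traded for powers of `T`, using `d ≤ T`, `log K ≤ T` and `xmax² ≤
    -- lam T`; the grid size `T ^ 11` is large enough to beat them.
    have h4 : traceBound d K T xmax ≤ (T : ℝ) ^ 2 * (T * (242 * ((lam * T) * (T : ℝ) ^ 2))) := by
      unfold traceBound
      rw [mul_pow]
      have h5 := h.log_K_le.trans h.log_T_le
      have h6 := h.log_K_pos
      gcongr
    have h7 := h.pow_le_T_pow 15
    calc 8 * (d : ℝ) * traceBound d K T xmax
        ≤ 8 * (T : ℝ) * ((T : ℝ) ^ 2 * (T * (242 * ((lam * T) * (T : ℝ) ^ 2)))) := by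
          have : 0 ≤ traceBound d K T xmax := by unfold traceBound; positivity
          gcongr
      _ = lam / 16 * (T : ℝ) ^ 7 * 30976 := by ring
      _ ≤ lam / 16 * (T : ℝ) ^ 7 * (T : ℝ) ^ 15 := by gcongr; linarith
      _ = lam / 8 * ((T : ℝ) ^ 11) ^ 2 / 2 := by ring
      _ ≤ _ := by gcongr
  linarith

variable [IsProbabilityMeasure μ]

/-- The diversity assumption survives the truncation of the contexts. -/
lemma half_lam_mul_le_integral_min (h : GreedyBandit μ T θ θ₀ σ xmax lam CΔ X η a)
    (hlam : xmax ^ 2 ≤ lam * T) {t : ℕ} (ht : t ∈ Finset.Icc 1 T)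
    (u : EuclideanSpace ℝ (Fin d))
    {g : Ω → ℝ} (hg : Measurable[history θ X η a (t - 1)] g) (hg0 : ∀ ω, 0 ≤ g ω)
    (hg1 : ∀ ω, g ω ≤ 1) :
    lam * ‖u‖ ^ 2 / 2 * ∫ ω, g ω ∂μ ≤ ∫ ω, g ω * min ((inner ℝ u (chosen X a t ω)) ^ 2)
      ((hiRadius xmax T * ‖u‖) ^ 2) ∂μ := by
  have hm : history θ X η a (t - 1) ≤ mΩ := h.history_le (by
    have := (Finset.mem_Icc.1 ht); omega)
  have hb0 := hiRadius_pos h.xmax_pos h.two_le_T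
  set b := hiRadius xmax T * ‖u‖ with hb
  have hb1 : 0 ≤ b := by positivity
  set S : Ω → ℝ := fun ω => ∑ i, excess 2 b (inner ℝ u (X t ω i)) with hS
  obtain ⟨hSi, hSle⟩ := h.integral_sum_excess_hi_le ht two_ne_zero le_rfl u
  have hgb : ∀ᵐ ω ∂μ, ‖g ω‖ ≤ 1 :=
    ae_of_all _ fun ω => by rw [Real.norm_of_nonneg (hg0 ω)]; exact hg1 ω
  have hgM := hg.mono hm le_rfl
  have hgi : Integrable g μ := Integrable.of_bound hgM.aestronglyMeasurable 1 hgb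
  have hZi := (h.integral_sq_inner_chosen_le ht u).1
  have hZm : Measurable fun ω => (inner ℝ u (chosen X a t ω)) ^ 2 :=
    (Measurable.const_inner (h.measurable_chosen ht)).pow_const 2
  have hmin : Integrable (fun ω => min ((inner ℝ u (chosen X a t ω)) ^ 2) (b ^ 2)) μ :=
    hZi.mono' (hZm.min measurable_const).aestronglyMeasurable (ae_of_all _ fun ω => by
      rw [Real.norm_of_nonneg (le_min (sq_nonneg _) (sq_nonneg _))]; exact min_le_left _ _)
  have hgmin := hmin.bdd_mul hgM.aestronglyMeasurable hgb
  have hgS := hSi.bdd_mul hgM.aestronglyMeasurable hgb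
  -- The excess is summed over all arms, hence a function of the contexts alone and independent of
  -- the history. The excess of the pulled arm would not be.
  have hind : ∫ ω, g ω * S ω ∂μ = (∫ ω, g ω ∂μ) * ∫ ω, S ω ∂μ := by
    have h1 := ((h.indepFun_of_measurable_history ht hg).comp (measurable_sum_excess 2 b u)
      measurable_id).symm
    exact h1.integral_mul_eq_mul_integral hgM.aestronglyMeasurable hSi.aestronglyMeasurable
  have hpt : ∀ ω, g ω * (inner ℝ u (chosen X a t ω)) ^ 2
      ≤ g ω * min ((inner ℝ u (chosen X a t ω)) ^ 2) (b ^ 2) + g ω * S ω := by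
    intro ω
    rw [← mul_add]
    refine mul_le_mul_of_nonneg_left ?_ (hg0 ω)
    have h1 := abs_pow_le_add_sum_excess 2 hb1 (fun i => inner ℝ u (X t ω i)) (a t ω)
    rw [sq_abs] at h1
    have h2 : 0 ≤ S ω := sum_excess_nonneg _ _ _ _
    rcases min_cases ((inner ℝ u (chosen X a t ω)) ^ 2) (b ^ 2) with h3 | h3
    · rw [h3.1]; linarith
    · rw [h3.1]; exact h1
  have h1 : ∫ ω, g ω * (inner ℝ u (chosen X a t ω)) ^ 2 ∂μ
      ≤ ∫ ω, g ω * min ((inner ℝ u (chosen X a t ω)) ^ 2) (b ^ 2) ∂μ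
        + (∫ ω, g ω ∂μ) * ∫ ω, S ω ∂μ := by
    rw [← hind, ← integral_add hgmin hgS]
    exact integral_mono (hZi.bdd_mul hgM.aestronglyMeasurable hgb) (hgmin.add hgS) hpt
  have h2 := h.lam_mul_le_integral ht u hg hg0 hg1
  have hSsmall : ∫ ω, S ω ∂μ ≤ lam * ‖u‖ ^ 2 / 2 := by
    refine hSle.trans ?_
    have h3 := hiRadius_sq_le xmax T
    have h4 := h.log_T_le
    have h5 := h.log_T_pos
    have h6 := h.T_pos
    have h7 := h.pow_le_T_pow 16
    have h8 := h.lam_pos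
    calc b ^ 2 * ((T : ℝ) ^ 19)⁻¹ = hiRadius xmax T ^ 2 * (‖u‖ ^ 2 * ((T : ℝ) ^ 19)⁻¹) := by
          rw [hb]; ring
      _ ≤ (3000 * (lam * T * (T : ℝ) ^ 2)) * (‖u‖ ^ 2 * ((T : ℝ) ^ 19)⁻¹) := by
          gcongr
          exact h3.trans (by gcongr)
      _ = 3000 * (lam * ‖u‖ ^ 2) * ((T : ℝ) ^ 16)⁻¹ := by field_simp
      _ ≤ 3000 * (lam * ‖u‖ ^ 2) * ((2 : ℝ) ^ 16)⁻¹ := by gcongr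
      _ ≤ lam * ‖u‖ ^ 2 / 2 := by
          have : 0 ≤ lam * ‖u‖ ^ 2 := by positivity
          linarith
  have h9 := mul_le_mul_of_nonneg_left hSsmall (integral_nonneg (μ := μ) hg0)
  linarith

lemma measureReal_sum_sq_inner_lt_le (h : GreedyBandit μ T θ θ₀ σ xmax lam CΔ X η a)
    (hlam : xmax ^ 2 ≤ lam * T) {t : ℕ} (ht : t ≤ T) (u : EuclideanSpace ℝ (Fin d)) :
    μ.real {ω | ∑ s ∈ Finset.Icc 1 t, (inner ℝ u (chosen X a s ω)) ^ 2 < lam * t / 8 * ‖u‖ ^ 2}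
      ≤ Real.exp (-(lam * t / (8 * hiRadius xmax T ^ 2))) := by
  rcases eq_or_ne u 0 with rfl | hu
  · simp [Real.exp_nonneg]
  have hu' : 0 < ‖u‖ := norm_pos_iff.2 hu
  have hb0 := hiRadius_pos h.xmax_pos h.two_le_T
  have h1 := measureReal_sum_lt_le (μ := μ) (T := T) (κ := lam * ‖u‖ ^ 2 / 2)
    (B := (hiRadius xmax T * ‖u‖) ^ 2) (ℱ := fun t => history θ X η a t)
    (Z := fun s ω => (inner ℝ u (chosen X a s ω)) ^ 2) (by positivity)
    (fun t ht => h.history_le ht)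
    (fun t _ s hs => (Measurable.const_inner (measurable_history_chosen hs)).pow_const 2)
    (fun _ _ => sq_nonneg _)
    (fun t ht g hg hg0 hg1 => h.half_lam_mul_le_integral_min hlam
      (Finset.mem_Icc.2 ⟨by omega, ht⟩) u hg hg0 hg1) ht
  have h2 : lam * ‖u‖ ^ 2 / 2 * t / 4 = lam * t / 8 * ‖u‖ ^ 2 := by ring
  have h3 : lam * ‖u‖ ^ 2 / 2 * t / (4 * (hiRadius xmax T * ‖u‖) ^ 2)
      = lam * t / (8 * hiRadius xmax T ^ 2) := by
    field_simp
    ring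
  rwa [h2, h3] at h1

lemma integral_dotProduct_chosen_le (h : GreedyBandit μ T θ θ₀ σ xmax lam CΔ X η a) {t : ℕ}
    (ht : t ∈ Finset.Icc 1 T) :
    Integrable (fun ω => (chosen X a t ω).ofLp ⬝ᵥ (chosen X a t ω).ofLp) μ ∧
    ∫ ω, (chosen X a t ω).ofLp ⬝ᵥ (chosen X a t ω).ofLp ∂μ
      ≤ d * (242 * (xmax * Real.log K) ^ 2) := by
  have h1 : ∀ i : Fin d, Integrable (fun ω => chosen X a t ω i * chosen X a t ω i) μ :=
    fun i => h.integrable_mul_coord ht i i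
  refine ⟨integrable_finsetSum _ fun i _ => h1 i, ?_⟩
  simp only [dotProduct]
  rw [integral_finsetSum _ fun i _ => h1 i]
  calc _ ≤ ∑ _i : Fin d, 242 * (xmax * Real.log K) ^ 2 := by
        refine Finset.sum_le_sum fun i _ => ?_
        have h2 := (h.integral_sq_inner_chosen_le ht (EuclideanSpace.single i 1)).2
        simpa [EuclideanSpace.inner_single_left, sq] using h2
    _ = _ := by simp

lemma measureReal_compl_gramGood_le (h : GreedyBandit μ T θ θ₀ σ xmax lam CΔ X η a)
    (hlam : xmax ^ 2 ≤ lam * T) {t : ℕ} (ht : t ≤ T)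
    (ht0 : 336000 * (xmax ^ 2 * d * Real.log T ^ 3) / lam ≤ t) :
    μ.real (gramGood T lam xmax X a t)ᶜ ≤ 2 / T := by
  have hT := h.T_pos
  have hL := h.log_T_pos
  have hx := h.xmax_pos
  have hlam0 := h.lam_pos
  set A : (Fin d → ℤ) → Set Ω := fun k => {ω | ∑ s ∈ Finset.Icc 1 t,
    ((chosen X a s ω).ofLp ⬝ᵥ fun i => (k i : ℝ)) ^ 2
      < lam * t / 8 * ((fun i => (k i : ℝ)) ⬝ᵥ fun i => (k i : ℝ))} with hA
  set D : Set Ω := {ω | traceBound d K T xmax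
    ≤ ∑ s ∈ Finset.Icc 1 t, (chosen X a s ω).ofLp ⬝ᵥ (chosen X a s ω).ofLp} with hD
  have hsub : (gramGood T lam xmax X a t)ᶜ ⊆ (⋃ k ∈ gridPoints d (T ^ 11), A k) ∪ D := by
    intro ω hω
    by_contra hcon
    apply hω
    simp only [Set.mem_union, Set.mem_iUnion, not_or, not_exists] at hcon
    exact ⟨fun k hk => not_lt.1 (hcon.1 k hk), (not_le.1 hcon.2).le⟩
  -- The warm-up constant is `336000 = 14 · 8 · 3000`, chosen so that each grid point fails with
  -- probability at most `T ^ (-14 d)`, against at most `T ^ (13 d)` grid points.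
  have hAk : ∀ k, μ.real (A k) ≤ Real.exp (-(14 * d * Real.log T)) := by
    intro k
    have h1 := h.measureReal_sum_sq_inner_lt_le hlam ht (WithLp.toLp 2 fun i => (k i : ℝ))
    simp only [inner_eq_dotProduct, norm_sq_eq_dotProduct] at h1
    refine h1.trans (Real.exp_le_exp.2 (neg_le_neg ?_))
    have hb0 := hiRadius_pos h.xmax_pos h.two_le_T
    rw [le_div_iff₀ (by positivity)]
    rw [div_le_iff₀ hlam0] at ht0
    have h2 := hiRadius_sq_le xmax T
    calc 14 * d * Real.log T * (8 * hiRadius xmax T ^ 2)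
        ≤ 14 * d * Real.log T * (8 * (3000 * (xmax ^ 2 * Real.log T ^ 2))) := by gcongr
      _ = 336000 * (xmax ^ 2 * d * Real.log T ^ 3) := by ring
      _ ≤ lam * t := by linarith
  have hAU : μ.real (⋃ k ∈ gridPoints d (T ^ 11), A k) ≤ 1 / T := by
    calc μ.real (⋃ k ∈ gridPoints d (T ^ 11), A k)
        ≤ ∑ k ∈ gridPoints d (T ^ 11), μ.real (A k) := measureReal_biUnion_finset_le _ _
      _ ≤ ∑ _k ∈ gridPoints d (T ^ 11), Real.exp (-(14 * d * Real.log T)) :=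
          Finset.sum_le_sum fun k _ => hAk k
      _ = (2 * (T : ℝ) ^ 11 + 1) ^ d * Real.exp (-(14 * d * Real.log T)) := by
          rw [Finset.sum_const, card_gridPoints, nsmul_eq_mul]; push_cast; rfl
      _ ≤ ((T : ℝ) ^ 13) ^ d * Real.exp (-(14 * d * Real.log T)) := by
          gcongr
          have h2 := h.pow_le_T_pow 2
          have h3 := h.pow_le_T_pow 11
          calc 2 * (T : ℝ) ^ 11 + 1 ≤ 2 ^ 2 * (T : ℝ) ^ 11 := by linarith
            _ ≤ (T : ℝ) ^ 2 * (T : ℝ) ^ 11 := by gcongr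
            _ = _ := by ring
      _ = ((T : ℝ) ^ d)⁻¹ := by
          have h4 : Real.exp (-(14 * d * Real.log T)) = ((T : ℝ) ^ (14 * d))⁻¹ := by
            rw [Real.exp_neg, mul_comm, Real.exp_mul, Real.exp_log hT]
            norm_cast
          rw [h4, ← pow_mul]
          have h5 : (T : ℝ) ^ (14 * d) = (T : ℝ) ^ (13 * d) * (T : ℝ) ^ d := by
            rw [← pow_add]; congr 1; ring
          rw [h5]
          field_simp
      _ ≤ 1 / T := by
          rw [one_div]
          gcongr
          have : (1 : ℝ) ≤ T := by have := h.two_le_T; exact_mod_cast (by omega : 1 ≤ T)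
          exact le_self_pow₀ this (by have := h.one_le_d; omega)
  have hsumi : ∀ s ∈ Finset.Icc 1 t, Integrable (fun ω =>
      (chosen X a s ω).ofLp ⬝ᵥ (chosen X a s ω).ofLp) μ := fun s hs =>
    (h.integral_dotProduct_chosen_le (Finset.Icc_subset_Icc_right ht hs)).1
  -- Markov's inequality: `traceBound` is `T` times the bound on the mean of the trace.
  have hDle : μ.real D ≤ 1 / T := by
    have h1 := mul_meas_ge_le_integral_of_nonneg (μ := μ)
      (f := fun ω => ∑ s ∈ Finset.Icc 1 t, (chosen X a s ω).ofLp ⬝ᵥ (chosen X a s ω).ofLp)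
      (ae_of_all _ fun ω => Finset.sum_nonneg fun s _ => dotProduct_self_nonneg' _)
      (integrable_finsetSum _ hsumi) (traceBound d K T xmax)
    rw [integral_finsetSum _ hsumi] at h1
    have h2 : ∑ s ∈ Finset.Icc 1 t, ∫ ω, (chosen X a s ω).ofLp ⬝ᵥ (chosen X a s ω).ofLp ∂μ
        ≤ T * (d * (242 * (xmax * Real.log K) ^ 2)) := by
      refine (Finset.sum_le_sum fun s hs => (h.integral_dotProduct_chosen_le
        (Finset.Icc_subset_Icc_right ht hs)).2).trans ?_
      rw [Finset.sum_const, Nat.card_Icc, nsmul_eq_mul]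
      gcongr
      simpa using ht
    have hp : (0 : ℝ) < d * (242 * (xmax * Real.log K) ^ 2) := by
      have := h.one_le_d
      have := h.log_K_pos
      positivity
    have h3 := h1.trans h2
    change traceBound d K T xmax * μ.real D ≤ _ at h3
    unfold traceBound at h3
    rw [le_div_iff₀ hT]
    have h6 : (T * (d * (242 * (xmax * Real.log K) ^ 2))) * (μ.real D * T)
        ≤ (T * (d * (242 * (xmax * Real.log K) ^ 2))) * 1 := by linarith
    exact le_of_mul_le_mul_left h6 (by positivity)
  calc μ.real (gramGood T lam xmax X a t)ᶜ
      ≤ μ.real (⋃ k ∈ gridPoints d (T ^ 11), A k) + μ.real D :=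
        (measureReal_mono hsub).trans (measureReal_union_le _ _)
    _ ≤ 1 / T + 1 / T := add_le_add hAU hDle
    _ = 2 / T := by ring

end GreedyBandit

/-! ### Error of the least squares estimator. -/

section

open Matrix

variable {Ω : Type*} {d K T : ℕ} {θ θ₀ : EuclideanSpace ℝ (Fin d)}
  {X : ℕ → Ω → Fin K → EuclideanSpace ℝ (Fin d)} {η : ℕ → Ω → Fin K → ℝ} {a : ℕ → Ω → Fin K}

lemma measurable_greedyParam (t : ℕ) :
    Measurable[history θ X η a t] (greedyParam θ θ₀ X η a t) := by
  have hx : ∀ s ∈ Finset.Icc 1 t,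
      Measurable[history θ X η a t] fun ω => (chosen X a s ω).ofLp := fun s hs =>
    (WithLp.measurable_ofLp 2 (Fin d → ℝ)).comp (measurable_history_chosen hs)
  have hG : ∀ i j, Measurable[history θ X η a t] fun ω => gram X a t ω i j :=
    measurable_sum_vecMulVec hx
  have hb : Measurable[history θ X η a t] fun ω => (rewardVec θ X η a t ω).ofLp := by
    refine (WithLp.measurable_ofLp 2 (Fin d → ℝ)).comp ?_
    unfold rewardVec
    exact Finset.measurable_sum _ fun s hs =>
      (measurable_history_reward hs).smul (measurable_history_chosen hs)
  exact Measurable.ite (measurable_det hG (measurableSet_singleton 0)) measurable_const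
    ((WithLp.measurable_toLp 2 (Fin d → ℝ)).comp
      (measurable_mulVec (measurable_inv_apply hG) hb))

lemma rewardVec_eq (t : ℕ) (ω : Ω) :
    (rewardVec θ X η a t ω).ofLp = gram X a t ω *ᵥ θ.ofLp
      + noiseSum (fun s => (chosen X a s ω).ofLp) (fun s => chosenNoise η a s ω) t := by
  simp only [rewardVec, gram, noiseSum, sum_mulVec, vecMulVec_self_mulVec]
  rw [WithLp.ofLp_sum, ← Finset.sum_add_distrib]
  refine Finset.sum_congr rfl fun s _ => ?_
  rw [WithLp.ofLp_smul, ← add_smul, reward, inner_eq_dotProduct, dotProduct_comm]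

/-- If all quadratic forms of the Gram matrix are at least `m > 0` times the squared norm, the
error of the least squares estimator is controlled by the self-normalized noise. -/
lemma mul_norm_sq_greedyParam_sub_le {l m : ℝ} (hl : 0 < l) (hlm : l ≤ m) {t : ℕ} {ω : Ω}
    (hm : ∀ u : Fin d → ℝ,
      m * (u ⬝ᵥ u) ≤ ∑ s ∈ Finset.Icc 1 t, ((chosen X a s ω).ofLp ⬝ᵥ u) ^ 2) :
    m * ‖greedyParam θ θ₀ X η a t ω - θ‖ ^ 2
      ≤ 2 * selfNormalized l (fun s => (chosen X a s ω).ofLp)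
        (fun s => chosenNoise η a s ω) t := by
  -- The lower bound on the quadratic forms excludes a kernel, so the algorithm is in its least
  -- squares branch.
  have hdet : (gram X a t ω).det ≠ 0 := by
    intro h0
    obtain ⟨w, hw, hw0⟩ := exists_mulVec_eq_zero_iff.2 h0
    have h1 := hm w
    rw [← dotProduct_sum_vecMulVec_mulVec] at h1
    change _ ≤ w ⬝ᵥ gram X a t ω *ᵥ w at h1
    rw [hw0, dotProduct_zero] at h1
    have h2 : 0 < w ⬝ᵥ w := (dotProduct_self_nonneg' w).lt_of_ne fun h3 =>
      hw (dotProduct_self_eq_zero.1 h3.symm)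
    nlinarith
  rw [norm_sq_eq_dotProduct]
  refine mul_dotProduct_self_le_selfNormalized hl hlm _ _ t (hm _) ?_
  change gram X a t ω *ᵥ _ = _
  rw [greedyParam, if_neg hdet, WithLp.ofLp_sub, mulVec_sub, WithLp.ofLp_toLp, mulVec_mulVec,
    mul_nonsing_inv _ (isUnit_iff_ne_zero.2 hdet), one_mulVec, rewardVec_eq, add_sub_cancel_left]

end

namespace GreedyBandit

variable {Ω : Type*} [mΩ : MeasurableSpace Ω] {μ : Measure Ω}
  {d K : ℕ} [NeZero K] {T : ℕ} {θ θ₀ : EuclideanSpace ℝ (Fin d)} {σ xmax lam CΔ : ℝ}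
  {X : ℕ → Ω → Fin K → EuclideanSpace ℝ (Fin d)} {η : ℕ → Ω → Fin K → ℝ} {a : ℕ → Ω → Fin K}

/-- The left side of the horizon condition is positive since `K ≥ 2`; this rules out `σ = 0`, and
likewise `CΔ ≤ 0`. -/
lemma sigma_pos (h : GreedyBandit μ T θ θ₀ σ xmax lam CΔ X η a) : 0 < σ := by
  refine h.sigma_nonneg.lt_of_ne fun h0 => ?_
  have h1 := h.horizon
  have h2 := mul_pos h.xmax_pos h.log_K_pos
  rw [← h0] at h1
  norm_num at h1
  linarith

lemma margin_const_pos (h : GreedyBandit μ T θ θ₀ σ xmax lam CΔ X η a) : 0 < CΔ := by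
  have h1 := h.horizon
  have h2 := mul_pos h.xmax_pos h.log_K_pos
  have h3 := h.log_T_pos
  have h4 := h.sigma_pos
  by_contra hcon
  have h5 : σ ^ 2 * CΔ * Real.log T ≤ 0 := by
    refine mul_nonpos_of_nonpos_of_nonneg ?_ h3.le
    exact mul_nonpos_of_nonneg_of_nonpos (by positivity) (not_lt.1 hcon)
  linarith

variable [IsProbabilityMeasure μ]

lemma integral_selfNormalized_le (h : GreedyBandit μ T θ θ₀ σ xmax lam CΔ X η a)
    (hlam : xmax ^ 2 ≤ lam * T) {t : ℕ} (ht : t ≤ T) :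
    Integrable (fun ω => selfNormalized (lam / 64) (fun s => (chosen X a s ω).ofLp)
        (fun s => chosenNoise η a s ω) t) μ ∧
      ∫ ω, selfNormalized (lam / 64) (fun s => (chosen X a s ω).ofLp)
        (fun s => chosenNoise η a s ω) t ∂μ ≤ 76 * (σ ^ 2 * d * Real.log T) := by
  have hlam0 := h.lam_pos
  have hT := h.T_pos
  have hmem : ∀ t < T, t + 1 ∈ Finset.Icc 1 T := fun t ht => Finset.mem_Icc.2 ⟨by omega, ht⟩
  have h1 := LinBandit.integral_selfNormalized_le (μ := μ) (T := T) (l := lam / 64) (σ := σ)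
    (x := fun s ω => (chosen X a s ω).ofLp) (e := chosenNoise η a)
    (pre := fun t => preReward θ X η a t) (by positivity) h.sigma_pos
    (fun t ht => h.preReward_le (hmem t ht))
    (fun t _ s hs => (WithLp.measurable_ofLp 2 (Fin d → ℝ)).comp (measurable_preReward_chosen hs))
    (fun t _ s hs => (measurable_history_chosenNoise hs).mono le_sup_left le_rfl)
    (fun t ht => h.measurable_chosenNoise (hmem t ht))
    (fun t ht => h.subGaussian (t + 1) (hmem t ht)) ht (r := 242 * (xmax * Real.log K) ^ 2)
    -- A power of `T` dominating `1 + T r / l`; its logarithm yields the constant `76 = 4 · 19`.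
    (m := (T : ℝ) ^ 19) (by positivity)
    (fun s hs => (h.integral_dotProduct_chosen_le (Finset.Icc_subset_Icc_right ht hs)).1)
    (fun s hs => (h.integral_dotProduct_chosen_le (Finset.Icc_subset_Icc_right ht hs)).2)
    ?_ (by positivity)
  · refine ⟨h1.1, h1.2.trans (le_of_eq ?_)⟩
    rw [Real.log_pow]
    push_cast
    ring
  · have h5 := h.log_K_le.trans h.log_T_le
    have h6 := h.log_K_pos
    have h7 := h.pow_le_T_pow 15
    have h8 := h.pow_le_T_pow 4
    have h9 : (xmax * Real.log K) ^ 2 ≤ lam * T * (T : ℝ) ^ 2 := by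
      rw [mul_pow]; gcongr
    calc 1 + T * (242 * (xmax * Real.log K) ^ 2) / (lam / 64)
        ≤ 1 + T * (242 * (lam * T * (T : ℝ) ^ 2)) / (lam / 64) := by gcongr
      _ = 1 + 15488 * (T : ℝ) ^ 4 := by field_simp; ring
      _ ≤ (T : ℝ) ^ 15 * (T : ℝ) ^ 4 := by nlinarith
      _ = _ := by ring

lemma integral_norm_sq_indicator_le (h : GreedyBandit μ T θ θ₀ σ xmax lam CΔ X η a)
    (hlam : xmax ^ 2 ≤ lam * T) (hd : d ≤ T) {t : ℕ} (ht1 : 1 ≤ t) (ht : t ≤ T) :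
    Integrable (fun ω => ‖(gramGood T lam xmax X a t).indicator
        (fun ω => greedyParam θ θ₀ X η a t ω - θ) ω‖ ^ 2) μ ∧
      ∫ ω, ‖(gramGood T lam xmax X a t).indicator
        (fun ω => greedyParam θ θ₀ X η a t ω - θ) ω‖ ^ 2 ∂μ
        ≤ 9728 * (σ ^ 2 * d * Real.log T) / (lam * t) := by
  obtain ⟨h1, h2⟩ := h.integral_selfNormalized_le hlam ht
  have hlam0 := h.lam_pos
  have ht1' : (1 : ℝ) ≤ t := by exact_mod_cast ht1
  have hc : 0 < lam * t := by positivity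
  set V : Ω → ℝ := fun ω => selfNormalized (lam / 64) (fun s => (chosen X a s ω).ofLp)
    (fun s => chosenNoise η a s ω) t with hV
  have hV0 : ∀ ω, 0 ≤ V ω := fun ω => selfNormalized_nonneg (by positivity) _ _ _
  have hpt : ∀ ω, ‖(gramGood T lam xmax X a t).indicator
      (fun ω => greedyParam θ θ₀ X η a t ω - θ) ω‖ ^ 2 ≤ 128 / (lam * t) * V ω := by
    intro ω
    by_cases hω : ω ∈ gramGood T lam xmax X a t
    · rw [Set.indicator_of_mem hω]
      have h3 := mul_norm_sq_greedyParam_sub_le (θ := θ) (θ₀ := θ₀) (η := η) (l := lam / 64)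
        (m := lam * t / 64) (by positivity) (by nlinarith)
        (h.le_sum_sq_of_mem_gramGood hlam hd ht1 hω)
      rw [div_mul_eq_mul_div, le_div_iff₀ hc]
      linarith
    · rw [Set.indicator_of_notMem hω, norm_zero, zero_pow two_ne_zero]
      have := hV0 ω
      positivity
  have hm : Measurable fun ω => ‖(gramGood T lam xmax X a t).indicator
      (fun ω => greedyParam θ θ₀ X η a t ω - θ) ω‖ ^ 2 :=
    ((((measurable_greedyParam t).sub_const θ).indicator (measurableSet_gramGood t)).mono
      (h.history_le ht) le_rfl).norm.pow_const 2
  have hi : Integrable (fun ω => ‖(gramGood T lam xmax X a t).indicator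
      (fun ω => greedyParam θ θ₀ X η a t ω - θ) ω‖ ^ 2) μ :=
    (h1.const_mul (128 / (lam * t))).mono' hm.aestronglyMeasurable (ae_of_all _ fun ω => by
      rw [Real.norm_of_nonneg (sq_nonneg _)]; exact hpt ω)
  refine ⟨hi, (integral_mono hi (h1.const_mul (128 / (lam * t))) hpt).trans ?_⟩
  rw [integral_const_mul]
  calc 128 / (lam * t) * ∫ ω, V ω ∂μ ≤ 128 / (lam * t) * (76 * (σ ^ 2 * d * Real.log T)) := by
        gcongr
    _ = _ := by ring

end GreedyBandit

/-! ### From estimation error to the regret of one round. -/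

section

variable {d K : ℕ}

/-- The two largest expected rewards of the context set `x` differ by at most `ε`. -/
def NearTie (θ : EuclideanSpace ℝ (Fin d)) (ε : ℝ) (x : Fin K → EuclideanSpace ℝ (Fin d)) : Prop :=
  ∃ i j, i ≠ j ∧ (∀ k, (inner ℝ (x k) θ : ℝ) ≤ inner ℝ (x i) θ) ∧
    (inner ℝ (x i) θ : ℝ) - inner ℝ (x j) θ ≤ ε

/-- Removes the arbitrary choice of `optArm`: `NearTie` is a finite combination of inequalities
between inner products, so its measurability is immediate. If the maximizer `i` is not `optArm`,
then there is an exact tie and the gap is at most zero. -/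
lemma suboptGap_le_iff [NeZero K] (hK : 2 ≤ K) (θ : EuclideanSpace ℝ (Fin d)) {ε : ℝ} (hε : 0 ≤ ε)
    (x : Fin K → EuclideanSpace ℝ (Fin d)) : suboptGap θ x ≤ ε ↔ NearTie θ ε x := by
  have hne : Nonempty {i : Fin K // i ≠ optArm θ x} := by
    have : Nontrivial (Fin K) := Fin.nontrivial_iff_two_le.2 hK
    obtain ⟨j, hj⟩ := exists_ne (optArm θ x)
    exact ⟨⟨j, hj⟩⟩
  have hbdd : BddAbove (Set.range fun i : {i : Fin K // i ≠ optArm θ x} =>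
      (inner ℝ (x i) θ : ℝ)) := (Set.finite_range _).bddAbove
  constructor
  · intro h
    obtain ⟨j, hj⟩ := exists_eq_ciSup_of_finite
      (f := fun i : {i : Fin K // i ≠ optArm θ x} => (inner ℝ (x i) θ : ℝ))
    refine ⟨optArm θ x, j, j.2.symm, inner_le_inner_optArm θ x, ?_⟩
    rw [suboptGap, ← hj] at h
    exact h
  · rintro ⟨i, j, hij, hmax, hle⟩
    unfold suboptGap
    have h1 := hmax (optArm θ x)
    by_cases hi : i = optArm θ x
    · have h2 := le_ciSup hbdd ⟨j, fun h => hij (hi.trans h.symm)⟩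
      simp only at h2
      linarith
    · have h2 := le_ciSup hbdd ⟨i, hi⟩
      simp only at h2
      linarith

lemma measurable_inner_apply (θ : EuclideanSpace ℝ (Fin d)) (i : Fin K) :
    Measurable fun x : Fin K → EuclideanSpace ℝ (Fin d) => (inner ℝ (x i) θ : ℝ) :=
  Measurable.inner_const (measurable_pi_apply i)

lemma measurableSet_nearTie (θ : EuclideanSpace ℝ (Fin d)) :
    MeasurableSet {p : (Fin K → EuclideanSpace ℝ (Fin d)) × ℝ | NearTie θ p.2 p.1} := by
  have heq : {p : (Fin K → EuclideanSpace ℝ (Fin d)) × ℝ | NearTie θ p.2 p.1}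
      = ⋃ i, ⋃ j, ⋃ (_ : i ≠ j), (⋂ k, {p | (inner ℝ (p.1 k) θ : ℝ) ≤ inner ℝ (p.1 i) θ}) ∩
        {p | (inner ℝ (p.1 i) θ : ℝ) - inner ℝ (p.1 j) θ ≤ p.2} := by
    ext p
    simp only [NearTie, Set.mem_ofPred_eq, Set.mem_iUnion, Set.mem_inter_iff, Set.mem_iInter,
      exists_prop]
  have hm : ∀ i, Measurable fun p : (Fin K → EuclideanSpace ℝ (Fin d)) × ℝ =>
      (inner ℝ (p.1 i) θ : ℝ) := fun i => (measurable_inner_apply θ i).comp measurable_fst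
  rw [heq]
  exact MeasurableSet.iUnion fun i => MeasurableSet.iUnion fun j => MeasurableSet.iUnion fun _ =>
    (MeasurableSet.iInter fun k => measurableSet_le (hm k) (hm i)).inter
      (measurableSet_le ((hm i).sub (hm j)) measurable_snd)

lemma measurable_inner_optArm [NeZero K] (θ : EuclideanSpace ℝ (Fin d)) :
    Measurable fun x : Fin K → EuclideanSpace ℝ (Fin d) =>
      (inner ℝ (x (optArm θ x)) θ : ℝ) := by
  have heq : (fun x : Fin K → EuclideanSpace ℝ (Fin d) => (inner ℝ (x (optArm θ x)) θ : ℝ))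
      = Finset.univ.sup' Finset.univ_nonempty
        fun i (x : Fin K → EuclideanSpace ℝ (Fin d)) => (inner ℝ (x i) θ : ℝ) := by
    ext x
    rw [Finset.sup'_apply]
    exact le_antisymm (Finset.le_sup' (fun i => (inner ℝ (x i) θ : ℝ)) (Finset.mem_univ _))
      (Finset.sup'_le _ _ fun i _ => inner_le_inner_optArm θ x i)
  rw [heq]
  exact Finset.measurable_sup' _ fun i _ => measurable_inner_apply θ i

variable {Ω : Type*} {X : ℕ → Ω → Fin K → EuclideanSpace ℝ (Fin d)} {a : ℕ → Ω → Fin K}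

lemma instRegret_nonneg [NeZero K] (θ : EuclideanSpace ℝ (Fin d)) (t : ℕ) (ω : Ω) :
    0 ≤ instRegret θ X a t ω :=
  sub_nonneg.2 (inner_le_inner_optArm θ (X t ω) (a t ω))

lemma abs_add_abs_le_add_sum_excess {ι : Type*} [Fintype ι] {b : ℝ} (hb : 0 ≤ b)
    (y : ι → ℝ) (i j : ι) : |y i| + |y j| ≤ 2 * b + 2 * ∑ i, excess 1 b (y i) := by
  have h1 := abs_pow_le_add_sum_excess 1 hb y i
  have h2 := abs_pow_le_add_sum_excess 1 hb y j
  simp only [pow_one] at h1 h2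
  linarith

lemma instRegret_le [NeZero K] (θ : EuclideanSpace ℝ (Fin d)) (t : ℕ) (ω : Ω) {b : ℝ}
    (hb : 0 ≤ b) :
    instRegret θ X a t ω ≤ 2 * b + 2 * ∑ i, excess 1 b (inner ℝ θ (X t ω i)) := by
  refine le_trans ?_ (abs_add_abs_le_add_sum_excess hb (fun i => inner ℝ θ (X t ω i))
    (optArm θ (X t ω)) (a t ω))
  rw [instRegret, chosen, real_inner_comm, real_inner_comm θ (X t ω (a t ω))]
  exact (le_abs_self _).trans (abs_sub _ _)

/-- An upper bound of the regret of an arm that is optimal for the parameter `θ + v`. -/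
noncomputable def regretBound (θ : EuclideanSpace ℝ (Fin d)) (r : ℝ)
    (x : Fin K → EuclideanSpace ℝ (Fin d)) (v : EuclideanSpace ℝ (Fin d)) : ℝ :=
  {p : (Fin K → EuclideanSpace ℝ (Fin d)) × ℝ | NearTie θ p.2 p.1}.indicator (fun p => p.2)
      (x, 2 * (r * ‖v‖)) + 2 * ∑ i, excess 1 (r * ‖v‖) (inner ℝ v (x i))

lemma measurable_regretBound (θ : EuclideanSpace ℝ (Fin d)) (r : ℝ) :
    Measurable fun p : (Fin K → EuclideanSpace ℝ (Fin d)) × EuclideanSpace ℝ (Fin d) =>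
      regretBound θ r p.1 p.2 := by
  have hr : Measurable fun p : (Fin K → EuclideanSpace ℝ (Fin d)) × EuclideanSpace ℝ (Fin d) =>
      r * ‖p.2‖ := measurable_snd.norm.const_mul r
  refine Measurable.add ?_ (Measurable.const_mul (Finset.measurable_sum _ fun i _ => ?_) 2)
  · exact (measurable_snd.indicator (measurableSet_nearTie θ)).comp
      (measurable_fst.prodMk (hr.const_mul 2))
  · exact (measurable_excess 1).comp (hr.prodMk
      (measurable_snd.inner ((measurable_pi_apply i).comp measurable_fst)))

lemma instRegret_le_regretBound [NeZero K] {θ v : EuclideanSpace ℝ (Fin d)} {r : ℝ} (hr : 0 ≤ r)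
    {t : ℕ} {ω : Ω} (hv : ∀ i, (inner ℝ (X t ω i) (θ + v) : ℝ) ≤ inner ℝ (chosen X a t ω) (θ + v)) :
    instRegret θ X a t ω ≤ regretBound θ r (X t ω) v := by
  set b := r * ‖v‖ with hb
  have hb0 : 0 ≤ b := by positivity
  set y : Fin K → ℝ := fun i => inner ℝ v (X t ω i) with hy
  have hS0 : 0 ≤ ∑ i, excess 1 b (y i) := Finset.sum_nonneg fun i _ => excess_nonneg _ _ _
  have h1 : instRegret θ X a t ω ≤ |y (optArm θ (X t ω))| + |y (a t ω)| := by
    have h2 := hv (optArm θ (X t ω))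
    rw [inner_add_right, inner_add_right, chosen, real_inner_comm v, real_inner_comm v] at h2
    have h3 := neg_abs_le (y (optArm θ (X t ω)))
    have h4 := le_abs_self (y (a t ω))
    simp only [hy, instRegret, chosen] at h2 h3 h4 ⊢
    linarith
  change _ ≤ Set.indicator _ _ (X t ω, 2 * b) + 2 * ∑ i, excess 1 b (y i)
  have hind : 0 ≤ {p : (Fin K → EuclideanSpace ℝ (Fin d)) × ℝ | NearTie θ p.2 p.1}.indicator
      (fun p => p.2) (X t ω, 2 * b) :=
    Set.indicator_apply_nonneg fun _ => by positivity
  have hsingle : ∀ i, excess 1 b (y i) ≤ ∑ i, excess 1 b (y i) := fun i =>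
    Finset.single_le_sum (f := fun i => excess 1 b (y i))
      (fun i _ => excess_nonneg _ _ _) (Finset.mem_univ i)
  -- If one of the two projections exceeds `b`, the excess sum dominates it, and the other
  -- projection too, being either large itself or at most `b`. Otherwise the regret is at most `2
  -- b`, and a wrong arm witnesses a near tie.
  have hbig : ∀ i, b < |y i| → |y i| ≤ ∑ i, excess 1 b (y i) := fun i hi => by
    have := hsingle i
    rwa [excess, if_pos hi, pow_one] at this
  by_cases hi : b < |y (optArm θ (X t ω))|
  · have h5 := hbig _ hi
    by_cases hj : b < |y (a t ω)|
    · have h6 := hbig _ hj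
      linarith
    · have h6 := not_lt.1 hj
      linarith
  by_cases hj : b < |y (a t ω)|
  · have h5 := hbig _ hj
    have h6 := not_lt.1 hi
    linarith
  have h7 : instRegret θ X a t ω ≤ 2 * b := by
    have h5 := not_lt.1 hi
    have h6 := not_lt.1 hj
    linarith
  by_cases hopt : optArm θ (X t ω) = a t ω
  · have h8 : instRegret θ X a t ω = 0 := by
      rw [instRegret, chosen, hopt, sub_self]
    linarith
  · have h8 : (X t ω, 2 * b) ∈
        {p : (Fin K → EuclideanSpace ℝ (Fin d)) × ℝ | NearTie θ p.2 p.1} :=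
      ⟨optArm θ (X t ω), a t ω, hopt, inner_le_inner_optArm θ (X t ω), h7⟩
    rw [Set.indicator_of_mem h8]
    simp only
    linarith

lemma regretBound_nonneg (θ : EuclideanSpace ℝ (Fin d)) {r : ℝ} (hr : 0 ≤ r)
    (x : Fin K → EuclideanSpace ℝ (Fin d)) (v : EuclideanSpace ℝ (Fin d)) :
    0 ≤ regretBound θ r x v := by
  refine add_nonneg ?_ (mul_nonneg zero_le_two (sum_excess_nonneg _ _ _ _))
  exact Set.indicator_apply_nonneg fun _ => by positivity

end

/-- Independence makes the joint law a product, so Tonelli applies. It is used with the new contexts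
as `f` and the estimation error as `g`. -/
lemma lintegral_eq_lintegral_lintegral_of_indepFun {Ω β γ : Type*} [MeasurableSpace Ω]
    [MeasurableSpace β] [MeasurableSpace γ] {μ : Measure Ω} [IsProbabilityMeasure μ]
    {f : Ω → β} {g : Ω → γ} (hf : Measurable f) (hg : Measurable g) (h : IndepFun f g μ)
    {F : β × γ → ENNReal} (hF : Measurable F) :
    ∫⁻ ω, F (f ω, g ω) ∂μ = ∫⁻ ω, ∫⁻ ω', F (f ω', g ω) ∂μ ∂μ := by
  rw [← lintegral_map (μ := μ) hF (hf.prodMk hg),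
    (indepFun_iff_map_prod_eq_prod_map_map hf.aemeasurable hg.aemeasurable).1 h,
    lintegral_prod_symm _ hF.aemeasurable, lintegral_map hF.lintegral_prod_left' hg]
  refine lintegral_congr fun ω => ?_
  exact lintegral_map (hF.comp (measurable_id.prodMk measurable_const)) hf

namespace GreedyBandit

variable {Ω : Type*} [mΩ : MeasurableSpace Ω] {μ : Measure Ω}
  {d K : ℕ} [NeZero K] {T : ℕ} {θ θ₀ : EuclideanSpace ℝ (Fin d)} {σ xmax lam CΔ : ℝ}
  {X : ℕ → Ω → Fin K → EuclideanSpace ℝ (Fin d)} {η : ℕ → Ω → Fin K → ℝ} {a : ℕ → Ω → Fin K}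

lemma measurable_instRegret (h : GreedyBandit μ T θ θ₀ σ xmax lam CΔ X η a) {t : ℕ}
    (ht : t ∈ Finset.Icc 1 T) : Measurable (instRegret θ X a t) :=
  ((measurable_inner_optArm θ).comp (h.measurable_X t ht)).sub
    ((h.measurable_chosen ht).inner_const)

lemma measurableSet_nearTie_X (h : GreedyBandit μ T θ θ₀ σ xmax lam CΔ X η a) {t : ℕ}
    (ht : t ∈ Finset.Icc 1 T) (ε : ℝ) : MeasurableSet {ω | NearTie θ ε (X t ω)} :=
  ((h.measurable_X t ht).prodMk measurable_const) (measurableSet_nearTie θ)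

variable [IsProbabilityMeasure μ]

lemma measureReal_nearTie_le (h : GreedyBandit μ T θ θ₀ σ xmax lam CΔ X η a) {t : ℕ}
    (ht : t ∈ Finset.Icc 1 T) {ε : ℝ} (hε : 0 < ε) :
    μ.real {ω | NearTie θ ε (X t ω)} ≤ ε * CΔ + 1 / Real.sqrt T := by
  have hm : history θ X η a (t - 1) ≤ mΩ := h.history_le (by
    have := (Finset.mem_Icc.1 ht); omega)
  have heq : {ω | suboptGap θ (X t ω) ≤ ε} = {ω | NearTie θ ε (X t ω)} := by
    ext ω
    exact suboptGap_le_iff h.two_le_K θ hε.le (X t ω)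
  have h1 := h.margin t ht ε hε
  rw [heq] at h1
  have hS := h.measurableSet_nearTie_X ht ε
  calc μ.real {ω | NearTie θ ε (X t ω)}
      = ∫ ω, ({ω | NearTie θ ε (X t ω)}.indicator fun _ => (1 : ℝ)) ω ∂μ := by
        rw [integral_indicator hS]; simp
    _ = ∫ ω, (μ⟦{ω | NearTie θ ε (X t ω)} | history θ X η a (t - 1)⟧) ω ∂μ :=
        (integral_condExp hm).symm
    _ ≤ ∫ _, (ε * CΔ + 1 / Real.sqrt T) ∂μ :=
        integral_mono_ae integrable_condExp (integrable_const _) h1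
    _ = _ := by simp

/-- The mean regret bound of an arm that is optimal for the parameter `θ + v`. -/
lemma lintegral_regretBound_le (h : GreedyBandit μ T θ θ₀ σ xmax lam CΔ X η a) {t : ℕ}
    (ht : t ∈ Finset.Icc 1 T) (v : EuclideanSpace ℝ (Fin d)) :
    ∫⁻ ω, ENNReal.ofReal (regretBound θ (hiRadius xmax T) (X t ω) v) ∂μ
      ≤ ENNReal.ofReal (8 * CΔ * hiRadius xmax T ^ 2 * ‖v‖ ^ 2 + 1 / (CΔ * T)) := by
  have hr := hiRadius_pos h.xmax_pos h.two_le_T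
  have hC := h.margin_const_pos
  have hT := h.T_pos
  set b := hiRadius xmax T * ‖v‖ with hb
  have hb0 : 0 ≤ b := by positivity
  obtain ⟨h1, h2⟩ := h.integral_sum_excess_hi_le ht one_ne_zero one_le_two v
  have hS := h.measurableSet_nearTie_X ht (2 * b)
  have heq : ∀ ω, regretBound θ (hiRadius xmax T) (X t ω) v
      = {ω | NearTie θ (2 * b) (X t ω)}.indicator (fun _ => 2 * b) ω
        + 2 * ∑ i, excess 1 b (inner ℝ v (X t ω i)) :=
    fun ω => rfl
  have hi1 : Integrable ({ω | NearTie θ (2 * b) (X t ω)}.indicator fun _ => 2 * b) μ :=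
    (integrable_const _).indicator hS
  have hi : Integrable (fun ω => regretBound θ (hiRadius xmax T) (X t ω) v) μ := by
    simp only [heq]
    exact hi1.add (h1.const_mul 2)
  rw [← ofReal_integral_eq_lintegral_ofReal hi
    (ae_of_all _ fun ω => regretBound_nonneg θ hr.le _ v)]
  refine ENNReal.ofReal_le_ofReal ?_
  simp only [heq]
  rw [integral_add hi1 (h1.const_mul 2), integral_const_mul, integral_indicator hS]
  simp only [integral_const, measureReal_restrict_apply_univ, smul_eq_mul, pow_one] at h2 ⊢
  have hsq : Real.sqrt T ≤ T := by
    rw [Real.sqrt_le_left hT.le]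
    have : (1 : ℝ) ≤ T := by have := h.two_le_T; exact_mod_cast (by omega : 1 ≤ T)
    nlinarith
  have hsq0 : 0 < Real.sqrt T := Real.sqrt_pos.2 hT
  have h19 : ((T : ℝ) ^ 19)⁻¹ ≤ 1 / Real.sqrt T := by
    rw [one_div]
    have : (1 : ℝ) ≤ T := by have := h.two_le_T; exact_mod_cast (by omega : 1 ≤ T)
    exact inv_anti₀ hsq0 (hsq.trans (le_self_pow₀ this (by norm_num)))
  have hP : μ.real {ω | NearTie θ (2 * b) (X t ω)} * (2 * b)
      ≤ (2 * b * CΔ + 1 / Real.sqrt T) * (2 * b) := by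
    -- The margin condition is available only for positive `ε`; for `v = 0` the term vanishes.
    rcases hb0.eq_or_lt with h0 | h0
    · rw [← h0]; simp
    · exact mul_le_mul_of_nonneg_right (h.measureReal_nearTie_le ht (by positivity))
        (by positivity)
  -- AM-GM removes the term linear in the error, which comes from the slack `1 / √T` of the margin
  -- condition and from the tail; only `E‖v‖²` is needed afterwards.
  have hamgm : 4 * b * (1 / Real.sqrt T) ≤ 4 * CΔ * b ^ 2 + 1 / (CΔ * T) := by
    have h3 : 1 / (CΔ * T) = CΔ * (1 / (CΔ * Real.sqrt T)) ^ 2 := by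
      rw [div_pow, mul_pow, Real.sq_sqrt hT.le]; field_simp
    have h4 : 1 / Real.sqrt T = CΔ * (1 / (CΔ * Real.sqrt T)) := by field_simp
    rw [h3, h4]
    nlinarith [mul_nonneg hC.le (sq_nonneg (2 * b - 1 / (CΔ * Real.sqrt T)))]
  have h5 := mul_le_mul_of_nonneg_left h19 hb0
  have h6 : hiRadius xmax T ^ 2 * ‖v‖ ^ 2 = b ^ 2 := by rw [hb]; ring
  rw [mul_assoc (8 * CΔ), h6]
  nlinarith

end GreedyBandit

/-! ### Summation over the rounds. -/

lemma sum_range_inv_le_one_add_log {T : ℕ} (hT : 1 ≤ T) :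
    ∑ n ∈ Finset.range T, ((n : ℝ))⁻¹ ≤ 1 + Real.log T := by
  obtain ⟨m, rfl⟩ := Nat.exists_eq_add_of_le' hT
  rw [Finset.sum_range_succ']
  have h1 := harmonic_le_one_add_log m
  have h2 : ((harmonic m : ℚ) : ℝ) = ∑ n ∈ Finset.range m, (((n + 1 : ℕ) : ℝ))⁻¹ := by
    simp [harmonic]
  rw [h2] at h1
  have h3 : Real.log m ≤ Real.log (m + 1 : ℕ) := by
    rcases Nat.eq_zero_or_pos m with h0 | h0
    · simp [h0]
    · exact Real.log_le_log (by exact_mod_cast h0) (by push_cast; linarith)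
  simp only [Nat.cast_zero, inv_zero, add_zero]
  linarith

lemma sum_range_ite_lt_le (T : ℕ) {r : ℝ} (hr : 0 ≤ r) :
    ∑ n ∈ Finset.range T, (if (n : ℝ) < r then (1 : ℝ) else 0) ≤ r + 1 := by
  rw [← Finset.sum_filter, Finset.sum_const, nsmul_eq_mul, mul_one]
  have h1 : (Finset.range T).filter (fun n : ℕ => (n : ℝ) < r) ⊆ Finset.range ⌈r⌉₊ := by
    intro n hn
    exact Finset.mem_range.2 (Nat.lt_ceil.2 (Finset.mem_filter.1 hn).2)
  have h2 := Finset.card_le_card h1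
  rw [Finset.card_range] at h2
  have h3 : (((Finset.range T).filter (fun n : ℕ => (n : ℝ) < r)).card : ℝ) ≤ ⌈r⌉₊ := by
    exact_mod_cast h2
  exact h3.trans (Nat.ceil_lt_add_one hr).le

namespace GreedyBandit

variable {Ω : Type*} [mΩ : MeasurableSpace Ω] {μ : Measure Ω}
  {d K : ℕ} [NeZero K] {T : ℕ} {θ θ₀ : EuclideanSpace ℝ (Fin d)} {σ xmax lam CΔ : ℝ}
  {X : ℕ → Ω → Fin K → EuclideanSpace ℝ (Fin d)} {η : ℕ → Ω → Fin K → ℝ} {a : ℕ → Ω → Fin K}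

/-- The number of rounds after which the Gram matrix is well conditioned. -/
noncomputable def warmUp (d T : ℕ) (xmax lam : ℝ) : ℝ :=
  336000 * (xmax ^ 2 * d * Real.log T ^ 3) / lam

lemma sq_le_lam_mul_of_warmUp_le (h : GreedyBandit μ T θ θ₀ σ xmax lam CΔ X η a)
    (hw : warmUp d T xmax lam ≤ T) : xmax ^ 2 ≤ lam * T := by
  unfold warmUp at hw
  rw [div_le_iff₀ h.lam_pos] at hw
  have h2 := log_ge_of_two_le h.two_le_T
  have h3 := h.one_le_cast_d
  have h4 : (0.693 : ℝ) ^ 3 ≤ Real.log T ^ 3 := by gcongr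
  have h5 : 1 ≤ 336000 * (d * Real.log T ^ 3) := by nlinarith
  have h6 := mul_le_mul_of_nonneg_left h5 (sq_nonneg xmax)
  linarith

variable [IsProbabilityMeasure μ]

lemma integral_envelope_le (h : GreedyBandit μ T θ θ₀ σ xmax lam CΔ X η a) {t : ℕ}
    (ht : t ∈ Finset.Icc 1 T) :
    Integrable (fun ω => 2 * (loRadius xmax K * ‖θ‖)
      + 2 * ∑ i, excess 1 (loRadius xmax K * ‖θ‖) (inner ℝ θ (X t ω i))) μ ∧
    ∫ ω, (2 * (loRadius xmax K * ‖θ‖)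
      + 2 * ∑ i, excess 1 (loRadius xmax K * ‖θ‖) (inner ℝ θ (X t ω i))) ∂μ
      ≤ 44 * (xmax * Real.log K) := by
  obtain ⟨h1, h2⟩ := h.integral_sum_excess_lo_le ht one_ne_zero one_le_two θ
  have h3 := loRadius_le h.xmax_pos.le h.two_le_K
  have h4 := loRadius_nonneg (K := K) h.xmax_pos.le
  have h5 : loRadius xmax K * ‖θ‖ ≤ 11 * (xmax * Real.log K) :=
    (mul_le_of_le_one_right h4 h.norm_le).trans h3
  refine ⟨(integrable_const _).add (h1.const_mul 2), ?_⟩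
  rw [integral_add (integrable_const _) (h1.const_mul 2)]
  simp only [integral_const_mul, integral_const, probReal_univ, one_smul, pow_one] at h2 ⊢
  linarith

/-- The regret is dominated by an envelope over all arms. The envelope depends only on the contexts
of the round, so it is independent of `A` and the probability of `A` factors out. -/
lemma integral_indicator_instRegret_le (h : GreedyBandit μ T θ θ₀ σ xmax lam CΔ X η a) {t : ℕ}
    (ht : t ∈ Finset.Icc 1 T) {A : Set Ω} (hA : MeasurableSet[history θ X η a (t - 1)] A) :
    Integrable (instRegret θ X a t) μ ∧
      ∫ ω, A.indicator (instRegret θ X a t) ω ∂μ ≤ μ.real A * (44 * (xmax * Real.log K)) := by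
  obtain ⟨h1, h2⟩ := h.integral_envelope_le ht
  have hb := mul_nonneg (loRadius_nonneg (K := K) h.xmax_pos.le) (norm_nonneg θ)
  set W : Ω → ℝ := fun ω => 2 * (loRadius xmax K * ‖θ‖)
      + 2 * ∑ i, excess 1 (loRadius xmax K * ‖θ‖) (inner ℝ θ (X t ω i)) with hW
  have hrW : ∀ ω, instRegret θ X a t ω ≤ W ω := fun ω => instRegret_le θ t ω hb
  have hm : history θ X η a (t - 1) ≤ mΩ := h.history_le (by
    have := (Finset.mem_Icc.1 ht); omega)
  have hi : Integrable (instRegret θ X a t) μ :=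
    h1.mono' (h.measurable_instRegret ht).aestronglyMeasurable (ae_of_all _ fun ω => by
      rw [Real.norm_of_nonneg (instRegret_nonneg θ t ω)]; exact hrW ω)
  refine ⟨hi, ?_⟩
  set g : Ω → ℝ := A.indicator fun _ => 1 with hg
  have hgm : Measurable[history θ X η a (t - 1)] g := measurable_const.indicator hA
  have hg0 : ∀ ω, 0 ≤ g ω := fun ω => Set.indicator_apply_nonneg fun _ => zero_le_one
  have hg1 : ∀ ω, g ω ≤ 1 := fun ω => Set.indicator_le_self' (fun _ _ => zero_le_one) ω
  have hgM := (hgm.mono hm le_rfl).aestronglyMeasurable (μ := μ)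
  have hind : ∫ ω, g ω * W ω ∂μ = (∫ ω, g ω ∂μ) * ∫ ω, W ω ∂μ :=
    ((h.indepFun_of_measurable_history ht hgm).comp (measurable_const.add
      ((measurable_sum_excess 1 _ θ).const_mul 2)) measurable_id).symm.integral_mul_eq_mul_integral
      hgM h1.aestronglyMeasurable
  have hgi : ∫ ω, g ω ∂μ = μ.real A := by
    rw [hg, integral_indicator (hm A hA)]; simp
  calc ∫ ω, A.indicator (instRegret θ X a t) ω ∂μ ≤ ∫ ω, g ω * W ω ∂μ := by
        refine integral_mono (hi.indicator (hm A hA)) (h1.bdd_mul (c := 1) hgM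
          (ae_of_all _ fun ω => by rw [Real.norm_of_nonneg (hg0 ω)]; exact hg1 ω)) fun ω => ?_
        by_cases hω : ω ∈ A
        · simp only [hg, Set.indicator_of_mem hω, one_mul]
          exact hrW ω
        · simp only [hg, Set.indicator_of_notMem hω, zero_mul]
          exact le_rfl
    _ = μ.real A * ∫ ω, W ω ∂μ := by rw [hind, hgi]
    _ ≤ _ := mul_le_mul_of_nonneg_left h2 measureReal_nonneg

lemma integral_instRegret_le (h : GreedyBandit μ T θ θ₀ σ xmax lam CΔ X η a) {t : ℕ}
    (ht : t ∈ Finset.Icc 1 T) : ∫ ω, instRegret θ X a t ω ∂μ ≤ 44 * (xmax * Real.log K) := by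
  have := (h.integral_indicator_instRegret_le ht (A := Set.univ) MeasurableSet.univ).2
  simpa using this

lemma integral_indicator_gramGood_instRegret_le
    (h : GreedyBandit μ T θ θ₀ σ xmax lam CΔ X η a)
    (hlam : xmax ^ 2 ≤ lam * T) (hd : d ≤ T) {n : ℕ} (hn : 1 ≤ n) (hnT : n < T) :
    ∫ ω, (gramGood T lam xmax X a n).indicator (instRegret θ X a (n + 1)) ω ∂μ
      ≤ 8 * CΔ * hiRadius xmax T ^ 2 * (9728 * (σ ^ 2 * d * Real.log T) / (lam * n))
        + 1 / (CΔ * T) := by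
  have ht : n + 1 ∈ Finset.Icc 1 T := Finset.mem_Icc.2 ⟨by omega, hnT⟩
  have hC := h.margin_const_pos
  have hT := h.T_pos
  have hL := h.log_T_pos
  have hlam0 := h.lam_pos
  have hr := hiRadius_pos h.xmax_pos h.two_le_T
  set G := gramGood T lam xmax X a n with hG
  have hGm : MeasurableSet[history θ X η a n] G := measurableSet_gramGood n
  -- Off the good event the error is set to zero; `regretBound` is nonnegative there, so the
  -- comparison holds everywhere and only the mean square error on the good event enters.
  set w : Ω → EuclideanSpace ℝ (Fin d) :=
    G.indicator (fun ω => greedyParam θ θ₀ X η a n ω - θ) with hw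
  have hwm : Measurable[history θ X η a n] w :=
    ((measurable_greedyParam n).sub_const θ).indicator hGm
  have hm := h.history_le hnT.le
  obtain ⟨hwi, hwle⟩ := h.integral_norm_sq_indicator_le hlam hd hn hnT.le
  have hpt : ∀ ω, G.indicator (instRegret θ X a (n + 1)) ω
      ≤ regretBound θ (hiRadius xmax T) (X (n + 1) ω) (w ω) := by
    intro ω
    by_cases hω : ω ∈ G
    · rw [Set.indicator_of_mem hω]
      refine instRegret_le_regretBound hr.le fun i => ?_
      have h1 := h.greedy.greedy (n + 1) ht ω i
      have h2 : θ + w ω = greedyParam θ θ₀ X η a n ω := by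
        rw [hw, Set.indicator_of_mem hω, add_sub_cancel]
      rw [h2]
      exact h1
    · rw [Set.indicator_of_notMem hω]
      exact regretBound_nonneg θ hr.le _ _
  have hsum : Integrable (fun ω => 8 * CΔ * hiRadius xmax T ^ 2 * ‖w ω‖ ^ 2 + 1 / (CΔ * T)) μ :=
    (hwi.const_mul _).add (integrable_const _)
  have hmain : ∫⁻ ω, ENNReal.ofReal (G.indicator (instRegret θ X a (n + 1)) ω) ∂μ
      ≤ ENNReal.ofReal (∫ ω, (8 * CΔ * hiRadius xmax T ^ 2 * ‖w ω‖ ^ 2 + 1 / (CΔ * T)) ∂μ) := by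
    calc ∫⁻ ω, ENNReal.ofReal (G.indicator (instRegret θ X a (n + 1)) ω) ∂μ
        ≤ ∫⁻ ω, ENNReal.ofReal (regretBound θ (hiRadius xmax T) (X (n + 1) ω) (w ω)) ∂μ :=
          lintegral_mono fun ω => ENNReal.ofReal_le_ofReal (hpt ω)
      _ = ∫⁻ ω, ∫⁻ ω', ENNReal.ofReal
            (regretBound θ (hiRadius xmax T) (X (n + 1) ω') (w ω)) ∂μ ∂μ :=
          lintegral_eq_lintegral_lintegral_of_indepFun
            (F := fun p => ENNReal.ofReal (regretBound θ (hiRadius xmax T) p.1 p.2))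
            (h.measurable_X _ ht) (hwm.mono hm le_rfl)
            (h.indepFun_of_measurable_history ht hwm)
            (measurable_regretBound θ _).ennreal_ofReal
      _ ≤ ∫⁻ ω, ENNReal.ofReal (8 * CΔ * hiRadius xmax T ^ 2 * ‖w ω‖ ^ 2 + 1 / (CΔ * T)) ∂μ :=
          lintegral_mono fun ω => h.lintegral_regretBound_le ht (w ω)
      _ = _ := (ofReal_integral_eq_lintegral_ofReal hsum
          (ae_of_all _ fun ω => by positivity)).symm
  refine (integrable_and_integral_le_of_lintegral_le
    ((h.measurable_instRegret ht).indicator (hm G hGm))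
    (fun ω => Set.indicator_apply_nonneg fun _ => instRegret_nonneg θ _ ω)
    (integral_nonneg fun ω => by positivity) hmain).2.trans ?_
  rw [integral_add (hwi.const_mul _) (integrable_const _), integral_const_mul]
  simp only [integral_const, probReal_univ, one_smul]
  gcongr

/-- The gap is seldom larger than a multiple of `xmax log K`, so the margin condition at that scale
forces `CΔ` not to be too small. This converts the leftover `1 / (CΔ T)` into a multiple of `xmax
log K / T`. -/
lemma one_le_margin_const_mul (h : GreedyBandit μ T θ θ₀ σ xmax lam CΔ X η a) :
    1 ≤ 2112 * (xmax * Real.log K) * CΔ := by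
  have ht : 1 ∈ Finset.Icc 1 T := Finset.mem_Icc.2 ⟨le_rfl, by have := h.two_le_T; omega⟩
  have hxl := mul_pos h.xmax_pos h.log_K_pos
  -- `352 = 8 · 44`: by Markov, no near tie at this scale has probability at most `1/8`. As `1/√T ≤
  -- 17/24`, it follows that `ε CΔ ≥ 7/8 - 17/24 = 1/6`.
  set ε := 352 * (xmax * Real.log K) with hε
  have hε0 : 0 < ε := by positivity
  obtain ⟨h1, h2⟩ := h.integral_envelope_le ht
  have hb := mul_nonneg (loRadius_nonneg (K := K) h.xmax_pos.le) (norm_nonneg θ)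
  set W : Ω → ℝ := fun ω => 2 * (loRadius xmax K * ‖θ‖)
      + 2 * ∑ i, excess 1 (loRadius xmax K * ‖θ‖) (inner ℝ θ (X 1 ω i)) with hW
  have hW0 : ∀ ω, 0 ≤ W ω := fun ω => by
    have := sum_excess_nonneg 1 (loRadius xmax K * ‖θ‖) θ (X 1 ω)
    simp only [hW]
    positivity
  have h3 := mul_meas_ge_le_integral_of_nonneg (ae_of_all μ hW0) h1 ε
  have hS := h.measurableSet_nearTie_X ht ε
  have hsub : {ω | NearTie θ ε (X 1 ω)}ᶜ ⊆ {ω | ε ≤ W ω} := by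
    intro ω hω
    have : Nontrivial (Fin K) := Fin.nontrivial_iff_two_le.2 h.two_le_K
    obtain ⟨j, hj⟩ := exists_ne (optArm θ (X 1 ω))
    have h4 : ε < instRegret θ X (fun _ _ => j) 1 ω := by
      by_contra hcon
      exact hω ⟨optArm θ (X 1 ω), j, hj.symm, inner_le_inner_optArm θ (X 1 ω), not_lt.1 hcon⟩
    exact h4.le.trans (instRegret_le θ 1 ω hb)
  have h4 := measureReal_mono (μ := μ) hsub
  rw [probReal_compl_eq_one_sub hS] at h4
  have h5 := h.measureReal_nearTie_le ht hε0
  have h6 : μ.real {ω | ε ≤ W ω} ≤ 1 / 8 := by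
    have h7 := h3.trans h2
    have h8 : ε * μ.real {ω | ε ≤ W ω} ≤ ε * (1 / 8) := by linarith
    exact le_of_mul_le_mul_left h8 hε0
  have h7 : 1 / Real.sqrt T ≤ 17 / 24 := by
    have h8 : (24 / 17 : ℝ) ≤ Real.sqrt T := by
      apply Real.le_sqrt_of_sq_le
      have : (2 : ℝ) ≤ T := by exact_mod_cast h.two_le_T
      linarith
    calc 1 / Real.sqrt T ≤ 1 / (24 / 17) := by gcongr
      _ = _ := by norm_num
  have h9 : 2112 * (xmax * Real.log K) * CΔ = 6 * (ε * CΔ) := by rw [hε]; ring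
  linarith

lemma d_mul_log_le_warmUp (h : GreedyBandit μ T θ θ₀ σ xmax lam CΔ X η a) :
    1300 * (d * Real.log T) ≤ warmUp d T xmax lam := by
  have h1 := h.lam_le
  have h2 := h.log_K_le
  have h3 := h.log_K_pos
  have h4 := h.xmax_pos
  have h5 : lam ≤ 242 * (xmax * Real.log T) ^ 2 := h1.trans (by gcongr)
  have h6 := h.log_T_pos
  unfold warmUp
  rw [le_div_iff₀ h.lam_pos]
  calc 1300 * (d * Real.log T) * lam
      ≤ 1300 * (d * Real.log T) * (242 * (xmax * Real.log T) ^ 2) := by gcongr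
    _ = 314600 * (xmax ^ 2 * d * Real.log T ^ 3) := by ring
    _ ≤ _ := by gcongr; norm_num

lemma cast_d_le_warmUp (h : GreedyBandit μ T θ θ₀ σ xmax lam CΔ X η a) :
    (d : ℝ) ≤ warmUp d T xmax lam := by
  have h1 := h.d_mul_log_le_warmUp
  have h2 := log_ge_of_two_le h.two_le_T
  have h3 := h.one_le_cast_d
  nlinarith

lemma integral_instRegret_succ_le (h : GreedyBandit μ T θ θ₀ σ xmax lam CΔ X η a)
    {n : ℕ} (hw : warmUp d T xmax lam ≤ n) (hnT : n < T) :
    ∫ ω, instRegret θ X a (n + 1) ω ∂μ ≤ 2200 * (xmax * Real.log K) / T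
      + 233472000 * (xmax ^ 2 * CΔ * σ ^ 2 * d * Real.log T ^ 3 / lam) * (n : ℝ)⁻¹ := by
  have ht : n + 1 ∈ Finset.Icc 1 T := Finset.mem_Icc.2 ⟨by omega, hnT⟩
  have hnT' : (n : ℝ) ≤ T := by exact_mod_cast hnT.le
  have hlam := h.sq_le_lam_mul_of_warmUp_le (hw.trans hnT')
  have hdn : d ≤ n := by exact_mod_cast h.cast_d_le_warmUp.trans hw
  have hn : 1 ≤ n := h.one_le_d.trans hdn
  have hn0 : (0 : ℝ) < n := by exact_mod_cast hn
  have hC := h.margin_const_pos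
  have hT := h.T_pos
  have hL := h.log_T_pos
  have hlam0 := h.lam_pos
  have hxl := mul_pos h.xmax_pos h.log_K_pos
  set G := gramGood T lam xmax X a n with hG
  have hGm : MeasurableSet[history θ X η a n] G := measurableSet_gramGood n
  have hGM := h.history_le hnT.le G hGm
  have hbad := h.integral_indicator_instRegret_le ht (A := Gᶜ) hGm.compl
  have hgood := h.integral_indicator_gramGood_instRegret_le hlam (hdn.trans hnT.le) hn hnT
  have hμ := h.measureReal_compl_gramGood_le hlam hnT.le hw
  have hi := hbad.1
  have hsplit : ∫ ω, instRegret θ X a (n + 1) ω ∂μ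
      = ∫ ω, G.indicator (instRegret θ X a (n + 1)) ω ∂μ
        + ∫ ω, Gᶜ.indicator (instRegret θ X a (n + 1)) ω ∂μ := by
    rw [integral_indicator hGM, integral_indicator hGM.compl, integral_add_compl hGM hi]
  have hbad' : ∫ ω, Gᶜ.indicator (instRegret θ X a (n + 1)) ω ∂μ
      ≤ 88 * (xmax * Real.log K) / T := by
    refine hbad.2.trans ?_
    calc _ ≤ 2 / T * (44 * (xmax * Real.log K)) := by gcongr
      _ = _ := by ring
  have hC1 : 1 / (CΔ * T) ≤ 2112 * (xmax * Real.log K) / T := by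
    rw [div_le_div_iff₀ (by positivity) hT]
    have := mul_le_mul_of_nonneg_right h.one_le_margin_const_mul hT.le
    linarith
  have hmain : 8 * CΔ * hiRadius xmax T ^ 2 * (9728 * (σ ^ 2 * d * Real.log T) / (lam * n))
      ≤ 233472000 * (xmax ^ 2 * CΔ * σ ^ 2 * d * Real.log T ^ 3 / lam) * (n : ℝ)⁻¹ := by
    calc _ ≤ 8 * CΔ * (3000 * (xmax ^ 2 * Real.log T ^ 2))
          * (9728 * (σ ^ 2 * d * Real.log T) / (lam * n)) := by
          gcongr
          exact hiRadius_sq_le xmax T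
      _ = _ := by field_simp; ring
  rw [hsplit]
  calc _ ≤ _ := add_le_add (hgood.trans (add_le_add hmain hC1)) hbad'
    _ = _ := by ring

lemma cumRegret_le (h : GreedyBandit μ T θ θ₀ σ xmax lam CΔ X η a) :
    cumRegret μ θ X a T
      ≤ 1500000000 * σ ^ 2 * xmax ^ 2 * d * CΔ * (1 / lam) * (Real.log T) ^ 4 := by
  have hC := h.margin_const_pos
  have hT := h.T_pos
  have hL := h.log_T_pos
  have hlam0 := h.lam_pos
  have hxl := mul_pos h.xmax_pos h.log_K_pos
  have hw1 : 1 ≤ warmUp d T xmax lam := h.one_le_cast_d.trans h.cast_d_le_warmUp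
  set w := warmUp d T xmax lam with hw
  set Q := xmax ^ 2 * CΔ * σ ^ 2 * d * Real.log T ^ 3 / lam with hQ
  have hQ0 : 0 ≤ Q := by positivity
  have hround : ∀ n ∈ Finset.range T, ∫ ω, instRegret θ X a (n + 1) ω ∂μ
      ≤ 44 * (xmax * Real.log K) * (if (n : ℝ) < w then (1 : ℝ) else 0)
        + 2200 * (xmax * Real.log K) / T + 233472000 * Q * (n : ℝ)⁻¹ := by
    intro n hn
    have hnT := Finset.mem_range.1 hn
    have hA : 0 ≤ 2200 * (xmax * Real.log K) / T := by positivity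
    have hB : 0 ≤ 233472000 * Q * (n : ℝ)⁻¹ := by positivity
    split_ifs with hlt
    · have := h.integral_instRegret_le (t := n + 1) (Finset.mem_Icc.2 ⟨by omega, hnT⟩)
      linarith
    · have := h.integral_instRegret_succ_le (not_lt.1 hlt) hnT
      linarith
  have hsum : cumRegret μ θ X a T = ∑ n ∈ Finset.range T, ∫ ω, instRegret θ X a (n + 1) ω ∂μ := by
    rw [cumRegret, Finset.range_eq_Ico, Finset.sum_Ico_add' (fun t => ∫ ω, instRegret θ X a t ω ∂μ)]
    rfl
  have h1 := sum_range_ite_lt_le T (zero_le_one.trans hw1)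
  have h2 := sum_range_inv_le_one_add_log (T := T) (by have := h.two_le_T; omega)
  have h3 : 1 + Real.log T ≤ 3 * Real.log T := by
    have := log_ge_of_two_le h.two_le_T
    linarith
  -- The horizon condition makes the warm-up cost comparable with the main term.
  have h4 : w * (xmax * Real.log K) ≤ 336000 * (Q * Real.log T) := by
    calc w * (xmax * Real.log K) ≤ w * (σ ^ 2 * CΔ * Real.log T) :=
          mul_le_mul_of_nonneg_left h.horizon (zero_le_one.trans hw1)
      _ = _ := by rw [hw, hQ, warmUp]; ring
  have h5 : xmax * Real.log K ≤ w * (xmax * Real.log K) := le_mul_of_one_le_left hxl.le hw1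
  calc cumRegret μ θ X a T
      ≤ ∑ n ∈ Finset.range T, (44 * (xmax * Real.log K) * (if (n : ℝ) < w then (1 : ℝ) else 0)
        + 2200 * (xmax * Real.log K) / T + 233472000 * Q * (n : ℝ)⁻¹) := by
        rw [hsum]; exact Finset.sum_le_sum hround
    _ = 44 * (xmax * Real.log K) * ∑ n ∈ Finset.range T, (if (n : ℝ) < w then (1 : ℝ) else 0)
        + 2200 * (xmax * Real.log K) + 233472000 * Q * ∑ n ∈ Finset.range T, (n : ℝ)⁻¹ := by
        rw [Finset.sum_add_distrib, Finset.sum_add_distrib, ← Finset.mul_sum, ← Finset.mul_sum,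
          Finset.sum_const, Finset.card_range, nsmul_eq_mul, mul_div_cancel₀ _ hT.ne']
    _ ≤ 44 * (xmax * Real.log K) * (w + 1) + 2200 * (xmax * Real.log K)
        + 233472000 * Q * (3 * Real.log T) := by
        gcongr
        exact h2.trans h3
    _ ≤ 1500000000 * (Q * Real.log T) := by linarith
    _ = _ := by rw [hQ]; ring

end GreedyBandit

end LinBandit

theorem mainTheorem9 :
    ∃ c : ℝ, 0 < c ∧
      ∀ (d K T : ℕ) [NeZero K] (_ : 1 ≤ d) (_ : 2 ≤ K) (_ : 2 ≤ T)
        (Ω : Type*) [MeasurableSpace Ω] (μ : Measure Ω) [IsProbabilityMeasure μ]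
        (θ θ₀ : EuclideanSpace ℝ (Fin d)) (σ xmax lam CΔ : ℝ)
        (X : ℕ → Ω → Fin K → EuclideanSpace ℝ (Fin d)) (η : ℕ → Ω → Fin K → ℝ)
        (a : ℕ → Ω → Fin K)
        (_ : ‖θ‖ ≤ 1) (_ : 0 ≤ σ) (_ : 0 < xmax) (_ : 0 < lam)
        -- the horizon is not small compared with the problem parameters
        (_ : K ≤ T) (_ : xmax * Real.log K ≤ σ ^ 2 * CΔ * Real.log T)
        (_ : ∀ t ∈ Finset.Icc 1 T, Measurable (X t))
        (_ : ∀ t ∈ Finset.Icc 1 T, Measurable (η t))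
        -- the arms are pulled by LinGreedy
        (_ : LinBandit.IsLinGreedy T θ θ₀ X η a)
        -- the noise is conditionally centred and sub-Gaussian
        (_ : ∀ t ∈ Finset.Icc 1 T, LinBandit.IsCondSubGaussian μ
          (LinBandit.preReward θ X η a t) (LinBandit.chosenNoise η a t) σ)
        -- the contexts are independent across rounds and independent of the past
        (_ : iIndepFun (fun t : Finset.Icc 1 T => X t) μ)
        (_ : ∀ t ∈ Finset.Icc 1 T, Indep (MeasurableSpace.comap (X t) inferInstance)
          (LinBandit.history θ X η a (t - 1)) μ)
        -- the contexts are bounded in `ψ₁` norm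
        (_ : ∀ t ∈ Finset.Icc 1 T, ∀ i,
          LinBandit.psiOneNormVec μ (fun ω => X t ω i) ≤ ENNReal.ofReal xmax)
        -- diversity constant
        (_ : ∀ t ∈ Finset.Icc 1 T, ∀ᵐ ω ∂μ,
          (LinBandit.condSecondMoment μ (LinBandit.history θ X η a (t - 1))
              (LinBandit.chosen X a t) ω
            - lam • (1 : Matrix (Fin d) (Fin d) ℝ)).PosSemidef)
        -- margin constant
        (_ : ∀ t ∈ Finset.Icc 1 T, ∀ ε : ℝ, 0 < ε →
          μ⟦{ω | LinBandit.suboptGap θ (X t ω) ≤ ε} | LinBandit.history θ X η a (t - 1)⟧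
            ≤ᵐ[μ] fun _ => ε * CΔ + 1 / Real.sqrt T),
        (∀ t ∈ Finset.Icc 1 T, Integrable (LinBandit.instRegret θ X a t) μ) ∧
          LinBandit.cumRegret μ θ X a T ≤
            c * σ ^ 2 * xmax ^ 2 * d * CΔ * (1 / lam) * (Real.log T) ^ 4 := by
  refine ⟨1500000000, by norm_num, ?_⟩
  intro d K T _ hd hK hT Ω _ μ _ θ θ₀ σ xmax lam CΔ X η a hθ hσ hx hlam hKT hhor hX hη hgreedy
    hsub _ hindep hpsi hdiv hmar
  have h : LinBandit.GreedyBandit μ T θ θ₀ σ xmax lam CΔ X η a :=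
    ⟨hd, hK, hT, hθ, hσ, hx, hlam, hKT, hhor, hX, hη, hgreedy, hsub, hindep, hpsi, hdiv, hmar⟩
  exact ⟨fun t ht => (h.integral_indicator_instRegret_le ht (A := Set.univ) MeasurableSet.univ).1,
    h.cumRegret_le⟩
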